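/- \textbf{Setting.} Everything is over $\mathbb{C}$ and $\mathbb{Z}/2$-graded. $N_W=1$ \emph{SUSY vertex algebra}: a super vector space $V$ with vacuum $|0\rangle$, an even translation $\partial$, an odd operator $D$ with $D^2=0$, $[\partial,D]=0$, and superfields $Y(a,x,\theta)=a(x)+\theta\,(Da)(x)$, $a(x)=\sum_n a_{(n)}x^{-n-1}$, which are mutually local, create $a$ from $|0\rangle$ and satisfy $[\partial,Y(a)]=\partial_xY(a)$, $[D,Y(a)]=\partial_\theta Y(a)$. Modules carry superfields $Y^M(a,x,\theta)$ satisfying the Borcherds identity. $V$ is \emph{strongly conformal} if there are an even vector $j$ and an odd vector $h$ with $$Y(j,x,\theta)=J(x)-\theta Q(x),\qquad Y(h,x,\theta)=H(x)+\theta\,(L(x)+\partial_xJ(x)),$$ $J=\sum J_nx^{-n-1}$, $H=\sum H_nx^{-n-1}$, $Q=\sum Q_nx^{-n-2}$, $L=\sum L_nx^{-n-2}$, such that for some $c\in\mathbb{C}$ $$[L_m,L_n]=(m-n)L_{m+n},\quad [L_m,J_n]=-nJ_{m+n}+\delta_{m,-n}\tfrac{m^2+m}{6}c,\quad [L_m,H_n]=-nH_{m+n},\quad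 [L_m,Q_n]=(m-n)Q_{m+n},$$ $$[J_m,J_n]=\tfrac m3\delta_{m,-n}c,\quad [J_m,Q_n]=Q_{m+n},\quad [J_m,H_n]=-H_{m+n},\quad [H_m,Q_n]=L_{m+n}-mJ_{m+n}+\delta_{m,-n}\tfrac{m^2-m}{6}c,$$ $[Q_m,Q_n]=[H_m,H_n]=0$ (super-commutators), $L_{-1}=\partial$, $Q_{-1}=D$, and: (i) $L_0$ and $J_0$ are simultaneously diagonalizable with integer eigenvalues and finite-dimensional joint eigenspaces, and the eigenvalues of $L_0$ are $\ge 0$; (ii) the modes $(L_n,Q_n)_{n\ge-1}$, $(J_n,H_n)_{n\ge0}$ satisfy the above relations with $c=0$, and for $N\ge0$ $$[J_N,Y(a)]=\sum_i\tbinom Ni x^{N-i}\bigl(Y(J_ia)+\theta Y(Q_{i-1}a)\bigr),\qquad [H_N,Y(a)]=\sum_i\tbinom Ni x^{N-i}\bigl(Y(H_ia)-\theta\, Y((L_{i-1}-iJ_{i-1})a)\bigr),$$ $$[Q_{N-1},Y(a)]=\sum_i\tbinom Ni x^{N-i}Y(Q_{i-1}a),\qquad [L_{N-1},Y(a)]=\sum_i\tbinom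 Ni x^{N-i}\bigl(Y(L_{i-1}a)+i\,\theta\, Y(Q_{i-2}a)\bigr).$$ A $V$-module $M$ is of \emph{positive energy} if the operators $L_n,Q_n,J_n,H_n$ on $M$ defined by the same expansions of $Y^M(j)$ and $Y^M(h)$ satisfy (i) and (ii) on $M$ with $Y^M$ in place of $Y$. Let $\varepsilon,\delta$ be odd anticommuting parameters, let $0<|q|<1$, $y\ne0$, and put $$\mathbf{q}_M^{-1}=(1+\delta Q_0)\,q^{L_0}y^{J_0}\,(1-\varepsilon H_0),\qquad \varphi_M(b)=\operatorname{str}_M\,Y^M(b,x,\theta)\,\mathbf{q}_M^{-1}\big|_{(x,\theta)=(1,0)}\in\mathbb{C}[\varepsilon,\delta],\quad b\in V,$$ the supertrace being the sum over the joint eigenspaces of $L_0,J_0$ of the supertraces of the diagonal blocks. Extend $\varphi_M$ to $V[\varepsilon,\delta]$ by left $\mathbb{C}[\varepsilon,\delta]$-linearity, with the parameters written to the left. Let $$\bar\zeta(x)=\frac12+\frac1{x-1}+\sum_{n\ne0}\Bigl(\frac1{q^nx-1}-\frac1{q^n-1}\Bigr),\qquad \bar\wp(x)=\sum_{n\in\mathbb{Z}}\frac{q^nx}{(q^nx-1)^2}=-x\,\bar\zeta'(x),$$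 and, for $y\ne1$, define the super Weierstrass zeta function $$\bar\zeta(x,\theta)=\bar\zeta(x)\Bigl(1-\frac{\varepsilon\delta\,\bar\wp(x)}{1-y}\Bigr)+\frac{\theta\varepsilon}{1-y}\,\frac{\bar\wp(x)}{x}.$$ Below these functions are evaluated at $x+1$ and expanded at $x=0$. Here $\operatorname{res}$ is the coefficient of $\theta x^{-1}$ ($\theta$ on the left) for superfields and $\operatorname{res}_x$ the coefficient of $x^{-1}$ for ordinary fields. Derivatives in $\varepsilon,\delta$ are left derivatives. \textbf{Theorem.} Let $V$ be a strongly conformal $N_W=1$ SUSY vertex algebra, $M$ a positive energy $V$-module, and $U\subset\{(q,y)\in\mathbb{C}^2:0<|q|<1,\ y\neq0\}$ an open set. (a) Suppose that for all $b\in V$ and $(q,y)\in U$ the series over the joint eigenspaces defining $\varphi_M(b)$ converges absolutely (in each of its four components). Then for every $b\in V$ and $(q,y)\in U$ with $y\ne1$ the function $\varphi_M(b)$ has complex partial derivatives in $q$ and in $y$, and $$q\,\partial_q\varphi_M(b)=\varphi_M\Bigl(\operatorname{res}\ \bar\zeta(x+1,\theta)\bigl[(x+1)\,Y(h,x,\theta)+\theta\,Y(j,x,\theta)\bigr]b\Bigr),$$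 $$(1+\varepsilon\delta)\,q\,\partial_q\varphi_M(b)+(y-1-\varepsilon\delta)\,y\,\partial_y\varphi_M(b)+y\,(\varepsilon\,\partial_\varepsilon+\delta\,\partial_\delta)\varphi_M(b)$$ $$=\varphi_M\Bigl(\operatorname{res}\ \bar\zeta(x+1,\theta)\bigl[((x+1)+\varepsilon\theta)\,Y(h,x,\theta)+(\delta(x+1)+(y-\varepsilon\delta)\theta)\,Y(j,x,\theta)\bigr]b\Bigr).$$ (b) On the even family $\varepsilon=\delta=0$, write $\varphi_M(b)=\operatorname{str}_M Y^M(b,x,\theta)\,q^{L_0}y^{J_0}\big|_{(x,\theta)=(1,0)}$ and suppose that this series converges absolutely for all $b\in V$ and $(q,y)\in U$. Then for every $b\in V$ and $(q,y)\in U$ (the value $y=1$ included) the function $\varphi_M(b)$ has complex partial derivatives in $q$ and in $y$, and $$q\,\partial_q\varphi_M(b)=\varphi_M\bigl(\operatorname{res}_x\,(x+1)\,\bar\zeta(x+1)\,L(x)\,b\bigr),\qquad y\,\partial_y\varphi_M(b)=\varphi_M\bigl(\operatorname{res}_x\,\bar\zeta(x+1)\,J(x)\,b\bigr).$$ -/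

import Mathlib

/-! ### Adjoining odd variables

Odd parameters are adjoined one at a time.  `OddExt W` consists of the expressions `c₀ + η c₁` with
`c₀ c₁ : W`, where `η` is a new odd variable, always written to the left of its coefficient. -/

/-- Expressions `c₀ + η c₁`, where `η` is an odd variable. -/
@[ext]
structure OddExt (W : Type*) where
  c₀ : W
  c₁ : W

/-- A ring with a parity involution: `par a = a` for even `a` and `par a = -a` for odd `a`. -/
class Superring (A : Type*) [Ring A] where
  par : A →+* A
  par_par : ∀ a, par (par a) = a

namespace OddExt

variable {A W W' : Type*}

instance [Add W] : Add (OddExt W) := ⟨fun v w => ⟨v.c₀ + w.c₀, v.c₁ + w.c₁⟩⟩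
instance [Zero W] : Zero (OddExt W) := ⟨⟨0, 0⟩⟩
instance [Neg W] : Neg (OddExt W) := ⟨fun v => ⟨-v.c₀, -v.c₁⟩⟩
instance [Ring A] : One (OddExt A) := ⟨⟨1, 0⟩⟩

/-- `(a + η b)(c + η d) = a c + η (b c + par(a) d)`, since `a η = η par(a)` and `η² = 0`. -/
instance [Ring A] [Superring A] : Mul (OddExt A) :=
  ⟨fun v w => ⟨v.c₀ * w.c₀, v.c₁ * w.c₀ + Superring.par v.c₀ * w.c₁⟩⟩

/-- `(a + η b) • (v + η w) = a • v + η (b • v + par(a) • w)`. -/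
instance [Ring A] [Superring A] [Add W] [SMul A W] : SMul (OddExt A) (OddExt W) :=
  ⟨fun f v => ⟨f.c₀ • v.c₀, f.c₁ • v.c₀ + Superring.par f.c₀ • v.c₁⟩⟩

@[simp] theorem add_c₀ [Add W] (v w : OddExt W) : (v + w).c₀ = v.c₀ + w.c₀ := rfl
@[simp] theorem add_c₁ [Add W] (v w : OddExt W) : (v + w).c₁ = v.c₁ + w.c₁ := rfl
@[simp] theorem zero_c₀ [Zero W] : (0 : OddExt W).c₀ = 0 := rfl
@[simp] theorem zero_c₁ [Zero W] : (0 : OddExt W).c₁ = 0 := rfl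
@[simp] theorem neg_c₀ [Neg W] (v : OddExt W) : (-v).c₀ = -v.c₀ := rfl
@[simp] theorem neg_c₁ [Neg W] (v : OddExt W) : (-v).c₁ = -v.c₁ := rfl
@[simp] theorem one_c₀ [Ring A] : (1 : OddExt A).c₀ = 1 := rfl
@[simp] theorem one_c₁ [Ring A] : (1 : OddExt A).c₁ = 0 := rfl
@[simp] theorem mul_c₀ [Ring A] [Superring A] (v w : OddExt A) : (v * w).c₀ = v.c₀ * w.c₀ := rfl
@[simp] theorem mul_c₁ [Ring A] [Superring A] (v w : OddExt A) :
    (v * w).c₁ = v.c₁ * w.c₀ + Superring.par v.c₀ * w.c₁ := rfl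

instance [Ring A] [Superring A] : Ring (OddExt A) where
  add_assoc a b c := by ext <;> simp [add_assoc]
  zero_add a := by ext <;> simp
  add_zero a := by ext <;> simp
  add_comm a b := by ext <;> simp [add_comm]
  neg_add_cancel a := by ext <;> simp
  mul_assoc a b c := by ext <;> simp [mul_add, add_mul, mul_assoc, add_assoc]
  one_mul a := by ext <;> simp
  mul_one a := by ext <;> simp
  zero_mul a := by ext <;> simp
  mul_zero a := by ext <;> simp
  left_distrib a b c := by ext <;> simp [mul_add]; abel
  right_distrib a b c := by ext <;> simp [add_mul]; abel
  nsmul := nsmulRec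
  zsmul := zsmulRec

/-- The parity involution: `par (a + η b) = par a - η par b`. -/
instance [Ring A] [Superring A] : Superring (OddExt A) where
  par :=
    { toFun := fun v => ⟨Superring.par v.c₀, -Superring.par v.c₁⟩
      map_one' := by ext <;> simp
      map_mul' := fun v w => by ext <;> simp; abel
      map_zero' := by ext <;> simp
      map_add' := fun v w => by ext <;> simp; abel }
  par_par a := by ext <;> simp [Superring.par_par]

/-- Elements not involving the new variable. -/
def const [Zero W] (w : W) : OddExt W := ⟨w, 0⟩

/-- The new odd variable. -/
def var (A : Type*) [Ring A] : OddExt A := ⟨0, 1⟩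

/-- Apply a function to the coefficients. -/
def map (f : W → W') (v : OddExt W) : OddExt W' := ⟨f v.c₀, f v.c₁⟩

end OddExt

noncomputable section

/-- `A[ε, δ]`: coefficients in `A`, with two anticommuting odd parameters.  An element is
`a₀₀ + δ a₀₁ + ε (a₁₀ + δ a₁₁)` where `aᵢⱼ = x.cᵢ.cⱼ`. -/
abbrev EpsDel (A : Type*) := OddExt (OddExt A)

/-- The odd parameter `ε`. -/
def epsVar (A : Type*) [Ring A] [Superring A] : EpsDel A := OddExt.var (OddExt A)

/-- The odd parameter `δ`. -/
def delVar (A : Type*) [Ring A] [Superring A] : EpsDel A := OddExt.const (OddExt.var A)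

/-- Elements involving neither `ε` nor `δ`. -/
def edConst {W : Type*} [Zero W] (w : W) : EpsDel W := OddExt.const (OddExt.const w)

instance : Superring ℂ := ⟨RingHom.id ℂ, fun _ => rfl⟩
instance : Superring (HahnSeries ℤ ℂ) := ⟨RingHom.id _, fun _ => rfl⟩

/-- The Grassmann algebra `ℂ[ε, δ]`. -/
abbrev Grassmann := EpsDel ℂ

namespace Grassmann

/-- The left partial derivative `∂/∂ε`. -/
def dEps (w : Grassmann) : Grassmann := ⟨w.c₁, 0⟩

/-- The left partial derivative `∂/∂δ`; the sign comes from `∂_δ (ε δ) = -ε`. -/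
def dDel (w : Grassmann) : Grassmann := ⟨⟨w.c₀.c₁, 0⟩, ⟨-w.c₁.c₁, 0⟩⟩

/-- Complex differentiability, coefficient by coefficient, of a `ℂ[ε, δ]`-valued function. -/
def HasDeriv (f : ℂ → Grassmann) (f' : Grassmann) (z : ℂ) : Prop :=
  HasDerivAt (fun w => (f w).c₀.c₀) f'.c₀.c₀ z ∧ HasDerivAt (fun w => (f w).c₀.c₁) f'.c₀.c₁ z ∧
  HasDerivAt (fun w => (f w).c₁.c₀) f'.c₁.c₀ z ∧ HasDerivAt (fun w => (f w).c₁.c₁) f'.c₁.c₁ z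

end Grassmann

/-! ### Superspaces -/

/-- A super vector space, given by its parity involution: even vectors are the `+1`-eigenvectors
and odd vectors the `-1`-eigenvectors. -/
class Superspace (W : Type*) [AddCommGroup W] [Module ℂ W] where
  parity : W →ₗ[ℂ] W
  parity_parity : ∀ w, parity (parity w) = w

section Superspace

variable {W : Type*} [AddCommGroup W] [Module ℂ W] [Superspace W]

/-- The parity operator as an endomorphism. -/
def parityOp (W : Type*) [AddCommGroup W] [Module ℂ W] [Superspace W] : Module.End ℂ W :=
  Superspace.parity

theorem parityOp_mul_self : parityOp W * parityOp W = 1 :=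
  LinearMap.ext fun w => Superspace.parity_parity w

/-- `w` is homogeneous of parity `i` modulo `2`. -/
def HasParity (i : ℕ) (w : W) : Prop := parityOp W w = (-1 : ℂ) ^ i • w

/-- The endomorphisms of a superspace: even ones commute with the parity operator and odd ones
anticommute with it. -/
instance : Superring (Module.End ℂ W) where
  par :=
    { toFun := fun X => parityOp W * X * parityOp W
      map_one' := by simp [parityOp_mul_self]
      map_mul' := fun X Z => by
        rw [show parityOp W * X * parityOp W * (parityOp W * Z * parityOp W) =
          parityOp W * X * (parityOp W * parityOp W) * Z * parityOp W by noncomm_ring,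
          parityOp_mul_self]
        noncomm_ring
      map_zero' := by simp
      map_add' := fun X Z => by noncomm_ring }
  par_par X := by
    change parityOp W * (parityOp W * X * parityOp W) * parityOp W = X
    rw [show parityOp W * (parityOp W * X * parityOp W) * parityOp W =
      (parityOp W * parityOp W) * X * (parityOp W * parityOp W) by noncomm_ring,
      parityOp_mul_self]
    simp

end Superspace

/-! ### SUSY vertex algebras and their modules -/

/-- An `N_W = 1` SUSY vertex algebra.  The superfield of `a` is
`Y(a, z, θ) = a(z) + θ (D a)(z)`; the structure records its even part
`Y a = a(z) = ∑ₙ a₍ₙ₎ z⁻ⁿ⁻¹`, with `a₍ₙ₎ = (Y a).ncoeff n`, together with `∂ = T` and `D`. -/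
structure SUSYVertexAlgebra (V : Type*) [AddCommGroup V] [Module ℂ V] [Superspace V] where
  vac : V
  T : Module.End ℂ V
  D : Module.End ℂ V
  Y : V →ₗ[ℂ] VertexOperator ℂ V
  vac_even : HasParity 0 vac
  T_even : ∀ a, T (parityOp V a) = parityOp V (T a)
  D_odd : ∀ a, D (parityOp V a) = -parityOp V (D a)
  T_D : T * D = D * T
  D_D : D * D = 0
  Y_even : ∀ a n b, parityOp V ((Y a).ncoeff n b) = (Y (parityOp V a)).ncoeff n (parityOp V b)
  Y_vac : ∀ n, (Y vac).ncoeff n = if n = -1 then 1 else 0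
  creation : ∀ a, (Y a).ncoeff (-1) vac = a ∧ ∀ n : ℤ, 0 ≤ n → (Y a).ncoeff n vac = 0
  /-- `[∂, a(z)] = ∂_z a(z)`. -/
  translation : ∀ a n b,
    T ((Y a).ncoeff n b) - (Y a).ncoeff n (T b) = (-(n : ℂ)) • (Y a).ncoeff (n - 1) b
  /-- `[D, Y(a, z, θ)] = ∂_θ Y(a, z, θ)`. -/
  odd_translation : ∀ a n b,
    D ((Y a).ncoeff n b) - (Y (parityOp V a)).ncoeff n (D b) = (Y (D a)).ncoeff n b
  /-- `(z - w)ᴺ [a(z), b(w)] = 0` for `N ≫ 0`, with the supercommutator. -/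
  locality : ∀ a b (i k : ℕ), HasParity i a → HasParity k b → ∃ N₀ : ℕ, ∀ N : ℕ, N₀ ≤ N →
    ∀ (m n : ℤ) (u : V), ∑ l ∈ Finset.range (N + 1), ((-1 : ℂ) ^ l * (N.choose l : ℂ)) •
      ((Y a).ncoeff (m + N - l) ((Y b).ncoeff (n + l) u)
        - (-1 : ℂ) ^ (i * k) • (Y b).ncoeff (n + l) ((Y a).ncoeff (m + N - l) u)) = 0

section VertexAlgebra

variable {V M W : Type*} [AddCommGroup V] [Module ℂ V] [Superspace V]
  [AddCommGroup M] [Module ℂ M] [Superspace M] [AddCommGroup W] [Module ℂ W] [Superspace W]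

/-- A module over a SUSY vertex algebra.  The superfields are `Y^M(a, z, θ) = a(z) + θ (D a)(z)`,
with `Y a = a(z)`.  Associativity is expressed by the Borcherds identity. -/
structure SUSYModule (A : SUSYVertexAlgebra V) (M : Type*) [AddCommGroup M] [Module ℂ M]
    [Superspace M] where
  Y : V →ₗ[ℂ] VertexOperator ℂ M
  Y_even : ∀ a n u, parityOp M ((Y a).ncoeff n u) = (Y (parityOp V a)).ncoeff n (parityOp M u)
  Y_vac : ∀ n, (Y A.vac).ncoeff n = if n = -1 then 1 else 0
  borcherds : ∀ a b (i k : ℕ), HasParity i a → HasParity k b → ∀ (m n r : ℤ) (u : M),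
    ∑ᶠ l : ℕ, ((Ring.choose m l : ℤ) : ℂ) •
        (Y ((A.Y a).ncoeff (n + l) b)).ncoeff (m + r - l) u
      = ∑ᶠ l : ℕ, ((-1 : ℂ) ^ l * ((Ring.choose n l : ℤ) : ℂ)) •
        ((Y a).ncoeff (m + n - l) ((Y b).ncoeff (r + l) u)
          - ((-1 : ℂ) ^ n * (-1 : ℂ) ^ (i * k)) •
            (Y b).ncoeff (n + r - l) ((Y a).ncoeff (m + l) u))

/-! ### The topological superconformal algebra -/

/-- Families of operators `Lₙ, Qₙ, Jₙ, Hₙ`. -/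
structure TopOperators (W : Type*) [AddCommGroup W] [Module ℂ W] where
  L : ℤ → Module.End ℂ W
  Q : ℤ → Module.End ℂ W
  J : ℤ → Module.End ℂ W
  H : ℤ → Module.End ℂ W

/-- The relations of the topological algebra of central charge `c`, for `Lₙ, Qₙ` with `n ∈ I` and
`Jₙ, Hₙ` with `n ∈ K`.  The operators `L, J` are even and `Q, H` are odd. -/
structure TopOperators.Relations (O : TopOperators W) (c : ℂ) (I K : Set ℤ) : Prop where
  L_even : ∀ n ∈ I, parityOp W * O.L n = O.L n * parityOp W
  Q_odd : ∀ n ∈ I, parityOp W * O.Q n = -(O.Q n * parityOp W)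
  J_even : ∀ n ∈ K, parityOp W * O.J n = O.J n * parityOp W
  H_odd : ∀ n ∈ K, parityOp W * O.H n = -(O.H n * parityOp W)
  L_L : ∀ m ∈ I, ∀ n ∈ I, O.L m * O.L n - O.L n * O.L m = ((m - n : ℤ) : ℂ) • O.L (m + n)
  L_J : ∀ m ∈ I, ∀ n ∈ K, O.L m * O.J n - O.J n * O.L m =
    (-(n : ℂ)) • O.J (m + n) + (if m = -n then ((m : ℂ) ^ 2 + m) * c / 6 else 0) • 1
  L_H : ∀ m ∈ I, ∀ n ∈ K, O.L m * O.H n - O.H n * O.L m = (-(n : ℂ)) • O.H (m + n)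
  L_Q : ∀ m ∈ I, ∀ n ∈ I, O.L m * O.Q n - O.Q n * O.L m = ((m - n : ℤ) : ℂ) • O.Q (m + n)
  J_J : ∀ m ∈ K, ∀ n ∈ K, O.J m * O.J n - O.J n * O.J m =
    (if m = -n then (m : ℂ) * c / 3 else 0) • 1
  J_Q : ∀ m ∈ K, ∀ n ∈ I, O.J m * O.Q n - O.Q n * O.J m = O.Q (m + n)
  J_H : ∀ m ∈ K, ∀ n ∈ K, O.J m * O.H n - O.H n * O.J m = -O.H (m + n)
  H_Q : ∀ m ∈ K, ∀ n ∈ I, O.H m * O.Q n + O.Q n * O.H m =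
    O.L (m + n) - (m : ℂ) • O.J (m + n)
      + (if m = -n then ((m : ℂ) ^ 2 - m) * c / 6 else 0) • 1
  Q_Q : ∀ m ∈ I, ∀ n ∈ I, O.Q m * O.Q n + O.Q n * O.Q m = 0
  H_H : ∀ m ∈ K, ∀ n ∈ K, O.H m * O.H n + O.H n * O.H m = 0

/-- The joint eigenspace of `L₀` and `J₀` of conformal weight `p.1` and charge `p.2`. -/
def TopOperators.weightSpace (O : TopOperators W) (p : ℤ × ℤ) : Submodule ℂ W :=
  (O.L 0).eigenspace (p.1 : ℂ) ⊓ (O.J 0).eigenspace (p.2 : ℂ)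

/-- `L₀` and `J₀` are diagonal with integer eigenvalues and finite-dimensional joint eigenspaces,
and the eigenvalues of `L₀` are bounded below by `0`. -/
structure TopOperators.IsGraded (O : TopOperators W) : Prop where
  internal : DirectSum.IsInternal O.weightSpace
  finite : ∀ p, FiniteDimensional ℂ (O.weightSpace p)
  nonneg : ∀ p : ℤ × ℤ, p.1 < 0 → O.weightSpace p = ⊥

/-- The operators `P` on `W` form an integrable representation of the annihilation subalgebra
`(Lₙ, Qₙ)ₙ≥₋₁, (Jₙ, Hₙ)ₙ≥₀` of the topological algebra, compatible with the superfields
`Y^W(a, z, θ) = a(z) + θ (D a)(z)` of vectors `a : V` and with the operators `O` on `V`.  Each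
compatibility condition lists the coefficients of `θ⁰` and of `θ¹`:
`[J_N, Y(a)] = ∑ᵢ (N choose i) z^(N-i) (Y(Jᵢ a) + θ Y(Qᵢ₋₁ a))`,
`[H_N, Y(a)] = ∑ᵢ (N choose i) z^(N-i) (Y(Hᵢ a) - θ Y((Lᵢ₋₁ - i Jᵢ₋₁) a))`,
`[Q_(N-1), Y(a)] = ∑ᵢ (N choose i) z^(N-i) Y(Qᵢ₋₁ a)`,
`[L_(N-1), Y(a)] = ∑ᵢ (N choose i) z^(N-i) (Y(Lᵢ₋₁ a) + i θ Y(Qᵢ₋₂ a))`. -/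
structure IsQuasiConformalAction (A : SUSYVertexAlgebra V) (O : TopOperators V)
    (Y : V →ₗ[ℂ] VertexOperator ℂ W) (P : TopOperators W) : Prop where
  relations : P.Relations 0 (Set.Ici (-1)) (Set.Ici 0)
  graded : P.IsGraded
  comm_J : ∀ (N : ℕ) (a : V) (k : ℤ),
    P.J N * (Y a).ncoeff k - (Y a).ncoeff k * P.J N =
      ∑ i ∈ Finset.range (N + 1), (N.choose i : ℂ) • (Y (O.J i a)).ncoeff (k + N - i)
    ∧ P.J N * (Y (A.D a)).ncoeff k - (Y (A.D a)).ncoeff k * P.J N =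
      ∑ i ∈ Finset.range (N + 1), (N.choose i : ℂ) •
        (Y (A.D (O.J i a) + O.Q (i - 1) a)).ncoeff (k + N - i)
  comm_H : ∀ (N : ℕ) (a : V) (k : ℤ),
    P.H N * (Y a).ncoeff k - (Y (parityOp V a)).ncoeff k * P.H N =
      ∑ i ∈ Finset.range (N + 1), (N.choose i : ℂ) • (Y (O.H i a)).ncoeff (k + N - i)
    ∧ -(P.H N * (Y (A.D a)).ncoeff k - (Y (parityOp V (A.D a))).ncoeff k * P.H N) =
      ∑ i ∈ Finset.range (N + 1), (N.choose i : ℂ) •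
        (Y (A.D (O.H i a) - (O.L (i - 1) a - (i : ℂ) • O.J (i - 1) a))).ncoeff (k + N - i)
  comm_Q : ∀ (N : ℕ) (a : V) (k : ℤ),
    P.Q (N - 1) * (Y a).ncoeff k - (Y (parityOp V a)).ncoeff k * P.Q (N - 1) =
      ∑ i ∈ Finset.range (N + 1), (N.choose i : ℂ) • (Y (O.Q (i - 1) a)).ncoeff (k + N - i)
    ∧ -(P.Q (N - 1) * (Y (A.D a)).ncoeff k
        - (Y (parityOp V (A.D a))).ncoeff k * P.Q (N - 1)) =
      ∑ i ∈ Finset.range (N + 1), (N.choose i : ℂ) •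
        (Y (A.D (O.Q (i - 1) a))).ncoeff (k + N - i)
  comm_L : ∀ (N : ℕ) (a : V) (k : ℤ),
    P.L (N - 1) * (Y a).ncoeff k - (Y a).ncoeff k * P.L (N - 1) =
      ∑ i ∈ Finset.range (N + 1), (N.choose i : ℂ) • (Y (O.L (i - 1) a)).ncoeff (k + N - i)
    ∧ P.L (N - 1) * (Y (A.D a)).ncoeff k - (Y (A.D a)).ncoeff k * P.L (N - 1) =
      ∑ i ∈ Finset.range (N + 1), (N.choose i : ℂ) •
        (Y (A.D (O.L (i - 1) a) + (i : ℂ) • O.Q (i - 2) a)).ncoeff (k + N - i)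

/-- The operators `Lₙ, Qₙ, Jₙ, Hₙ` on `W` read off from the superfields of `j` and `h` through
`Y(j, z, θ) = J(z) - θ Q(z)` and `Y(h, z, θ) = H(z) + θ (L(z) + ∂_z J(z))`, where
`J(z) = ∑ Jₙ z⁻ⁿ⁻¹`, `H(z) = ∑ Hₙ z⁻ⁿ⁻¹`, `Q(z) = ∑ Qₙ z⁻ⁿ⁻²`, `L(z) = ∑ Lₙ z⁻ⁿ⁻²`. -/
def topModes (A : SUSYVertexAlgebra V) (Y : V →ₗ[ℂ] VertexOperator ℂ W) (j h : V) :
    TopOperators W where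
  L n := (Y (A.D h)).ncoeff (n + 1) - (Y (A.T j)).ncoeff (n + 1)
  Q n := -(Y (A.D j)).ncoeff (n + 1)
  J n := (Y j).ncoeff n
  H n := (Y h).ncoeff n

/-- A strongly conformal structure on a SUSY vertex algebra: an even vector `j` and an odd vector
`h` whose fields satisfy the relations of the topological algebra with some central charge and give
a quasi-conformal structure. -/
structure StronglyConformal (A : SUSYVertexAlgebra V) where
  c : ℂ
  j : V
  h : V
  j_even : HasParity 0 j
  h_odd : HasParity 1 h
  relations : (topModes A A.Y j h).Relations c Set.univ Set.univ
  quasiConformal : IsQuasiConformalAction A (topModes A A.Y j h) A.Y (topModes A A.Y j h)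
  L_neg_one : (topModes A A.Y j h).L (-1) = A.T
  Q_neg_one : (topModes A A.Y j h).Q (-1) = A.D

variable {A : SUSYVertexAlgebra V}

/-- The operators `Lₙ, Qₙ, Jₙ, Hₙ` on a module over a strongly conformal algebra. -/
def SUSYModule.ops (X : SUSYModule A M) (S : StronglyConformal A) : TopOperators M :=
  topModes A X.Y S.j S.h

/-- Positive energy modules over a strongly conformal SUSY vertex algebra. -/
def SUSYModule.IsPositiveEnergy (X : SUSYModule A M) (S : StronglyConformal A) : Prop :=
  IsQuasiConformalAction A (topModes A A.Y S.j S.h) X.Y (X.ops S)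

/-! ### Supertraces and the conformal block -/

/-- The decomposition of `W` as the direct sum of the joint eigenspaces. -/
def TopOperators.IsGraded.decomp {O : TopOperators W} (hO : O.IsGraded) :
    (DirectSum (ℤ × ℤ) fun p => O.weightSpace p) ≃ₗ[ℂ] W :=
  LinearEquiv.ofBijective (DirectSum.coeLinearMap O.weightSpace)
    (show Function.Bijective (DirectSum.coeLinearMap O.weightSpace) from hO.internal)

theorem TopOperators.IsGraded.decomp_lof {O : TopOperators W} (hO : O.IsGraded) (p : ℤ × ℤ)
    (w : O.weightSpace p) :
    hO.decomp (DirectSum.lof ℂ (ℤ × ℤ) (fun p => O.weightSpace p) p w) = (w : W) :=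
  DirectSum.coeLinearMap_lof O.weightSpace p w

theorem TopOperators.IsGraded.decomp_symm_coe {O : TopOperators W} (hO : O.IsGraded) (p : ℤ × ℤ)
    (w : O.weightSpace p) :
    hO.decomp.symm (w : W) = DirectSum.lof ℂ (ℤ × ℤ) (fun p => O.weightSpace p) p w := by
  rw [LinearEquiv.symm_apply_eq, hO.decomp_lof]

/-- The projection of `W` onto a joint eigenspace along the others. -/
def TopOperators.IsGraded.proj {O : TopOperators W} (hO : O.IsGraded) (p : ℤ × ℤ) :
    W →ₗ[ℂ] O.weightSpace p :=
  DirectSum.component ℂ (ℤ × ℤ) (fun p => O.weightSpace p) p ∘ₗ hO.decomp.symm.toLinearMap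

/-- The operator `q^(L₀) y^(J₀)`. -/
def TopOperators.IsGraded.qy {O : TopOperators W} (hO : O.IsGraded) (q y : ℂ) :
    Module.End ℂ W :=
  DirectSum.toModule ℂ (ℤ × ℤ) W (fun p => (q ^ p.1 * y ^ p.2) • (O.weightSpace p).subtype) ∘ₗ
    hO.decomp.symm.toLinearMap

theorem TopOperators.IsGraded.qy_coe {O : TopOperators W} (hO : O.IsGraded) (q y : ℂ)
    (p : ℤ × ℤ) (w : O.weightSpace p) : hO.qy q y (w : W) = (q ^ p.1 * y ^ p.2) • (w : W) := by
  rw [qy, LinearMap.comp_apply, LinearEquiv.coe_coe, hO.decomp_symm_coe, DirectSum.toModule_lof]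
  rfl

theorem TopOperators.IsGraded.qy_inv_mul {O : TopOperators W} (hO : O.IsGraded) {q y : ℂ}
    (hq : q ≠ 0) (hy : y ≠ 0) : hO.qy q⁻¹ y⁻¹ * hO.qy q y = 1 := by
  apply LinearMap.ext
  intro w
  obtain ⟨v, rfl⟩ := hO.decomp.surjective w
  induction v using DirectSum.induction_on with
  | zero => simp
  | add v v' hv hv' => rw [map_add, map_add, hv, hv', map_add]
  | of p w =>
    rw [show DirectSum.of (fun p => O.weightSpace p) p w =
        DirectSum.lof ℂ (ℤ × ℤ) (fun p => O.weightSpace p) p w from rfl, hO.decomp_lof,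
      Module.End.mul_apply, hO.qy_coe, map_smul, hO.qy_coe, smul_smul, Module.End.one_apply,
      show q ^ p.1 * y ^ p.2 * (q⁻¹ ^ p.1 * y⁻¹ ^ p.2) = 1 by
        rw [inv_zpow, inv_zpow]; field_simp, one_smul]

/-- The contribution of one joint eigenspace to the supertrace of an operator. -/
def TopOperators.IsGraded.strAt {O : TopOperators W} (hO : O.IsGraded) (p : ℤ × ℤ)
    (X : Module.End ℂ W) : ℂ :=
  LinearMap.trace ℂ (O.weightSpace p)
    (hO.proj p ∘ₗ parityOp W ∘ₗ X ∘ₗ (O.weightSpace p).subtype)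

/-- The action `exp(ε H₀) y^(-J₀) q^(-L₀) exp(-δ Q₀)` of the group element with parameters
`(q, y, ε, δ)`, which corresponds to the coordinate change
`(x, θ) ↦ (q (x + ε θ), q (y - ε δ) θ + q δ x)`.  Here `exp(ε H₀) = 1 + ε H₀` and
`exp(-δ Q₀) = 1 - δ Q₀`. -/
def TopOperators.IsGraded.group {O : TopOperators W} (hO : O.IsGraded) (q y : ℂ) :
    EpsDel (Module.End ℂ W) :=
  (1 + epsVar _ * edConst (O.H 0)) * edConst (hO.qy q⁻¹ y⁻¹) * (1 - delVar _ * edConst (O.Q 0))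

/-- The inverse `exp(δ Q₀) q^(L₀) y^(J₀) exp(-ε H₀)` of the previous action. -/
def TopOperators.IsGraded.groupInv {O : TopOperators W} (hO : O.IsGraded) (q y : ℂ) :
    EpsDel (Module.End ℂ W) :=
  (1 + delVar _ * edConst (O.Q 0)) * edConst (hO.qy q y) * (1 - epsVar _ * edConst (O.H 0))

theorem TopOperators.IsGraded.group_mul_groupInv {O : TopOperators W} (hO : O.IsGraded) {q y : ℂ}
    (hq : q ≠ 0) (hy : y ≠ 0) : hO.group q y * hO.groupInv q y = 1 := by
  have h1 : (1 - delVar (Module.End ℂ W) * edConst (O.Q 0))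
      * (1 + delVar (Module.End ℂ W) * edConst (O.Q 0)) = 1 := by
    ext : 2 <;> simp [sub_eq_add_neg, delVar, edConst, OddExt.var, OddExt.const]
  have h2 : (1 + epsVar (Module.End ℂ W) * edConst (O.H 0))
      * (1 - epsVar (Module.End ℂ W) * edConst (O.H 0)) = 1 := by
    ext : 2 <;> simp [sub_eq_add_neg, epsVar, edConst, OddExt.var, OddExt.const]
  have h3 : edConst (hO.qy q⁻¹ y⁻¹) * edConst (hO.qy q y) = 1 := by
    ext : 2 <;> simp [edConst, OddExt.const, hO.qy_inv_mul hq hy]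
  calc hO.group q y * hO.groupInv q y
      = (1 + epsVar (Module.End ℂ W) * edConst (O.H 0)) * (edConst (hO.qy q⁻¹ y⁻¹) *
          ((1 - delVar (Module.End ℂ W) * edConst (O.Q 0))
            * (1 + delVar (Module.End ℂ W) * edConst (O.Q 0))) * edConst (hO.qy q y))
          * (1 - epsVar (Module.End ℂ W) * edConst (O.H 0)) := by
        rw [group, groupInv]; noncomm_ring
    _ = 1 := by rw [h1, mul_one, h3, mul_one, h2]

namespace SUSYModule.IsPositiveEnergy

variable {X : SUSYModule A M} {S : StronglyConformal A}

/-- The contribution of one joint eigenspace of `M` to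
`φ_M(b) = str_M Y^M(b, x, θ) q_M⁻¹` at `(x, θ) = (1, 0)`; there `Y^M(b, x, θ) = ∑ₖ b₍ₖ₎`, and only
finitely many `k` contribute to a given eigenspace. -/
def blockTerm (hX : X.IsPositiveEnergy S) (q y : ℂ) (b : V) (p : ℤ × ℤ) : Grassmann :=
  ∑ᶠ k : ℤ, OddExt.map (OddExt.map (hX.graded.strAt p))
    (edConst ((X.Y b).ncoeff k) * hX.graded.groupInv q y)

/-- The conformal block `φ_M(b)` at the parameters `(q, y)`, as an element of `ℂ[ε, δ]`. -/
def block (hX : X.IsPositiveEnergy S) (q y : ℂ) (b : V) : Grassmann :=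
  ⟨⟨∑' p, (hX.blockTerm q y b p).c₀.c₀, ∑' p, (hX.blockTerm q y b p).c₀.c₁⟩,
   ⟨∑' p, (hX.blockTerm q y b p).c₁.c₀, ∑' p, (hX.blockTerm q y b p).c₁.c₁⟩⟩

/-- Absolute convergence of the series defining the conformal block. -/
def BlockConverges (hX : X.IsPositiveEnergy S) (q y : ℂ) : Prop :=
  ∀ b : V, Summable (fun p => (hX.blockTerm q y b p).c₀.c₀) ∧
    Summable (fun p => (hX.blockTerm q y b p).c₀.c₁) ∧
    Summable (fun p => (hX.blockTerm q y b p).c₁.c₀) ∧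
    Summable (fun p => (hX.blockTerm q y b p).c₁.c₁)

/-- The `ℂ[ε, δ]`-linear extension of the conformal block to `V[ε, δ]`. -/
def blockExt (hX : X.IsPositiveEnergy S) (q y : ℂ) (w : EpsDel V) : Grassmann :=
  hX.block q y w.c₀.c₀ + delVar ℂ * hX.block q y w.c₀.c₁ + epsVar ℂ * hX.block q y w.c₁.c₀
    + epsVar ℂ * delVar ℂ * hX.block q y w.c₁.c₁

/-- The conformal block on the even family `ε = δ = 0`. -/
def evenBlock (hX : X.IsPositiveEnergy S) (q y : ℂ) (b : V) : ℂ := (hX.block q y b).c₀.c₀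

/-- Absolute convergence of the series defining the conformal block on the even family. -/
def EvenBlockConverges (hX : X.IsPositiveEnergy S) (q y : ℂ) : Prop :=
  ∀ b : V, Summable (fun p => (hX.blockTerm q y b p).c₀.c₀)

end SUSYModule.IsPositiveEnergy

/-! ### The Weierstrass functions

All functions of `x` are expanded at `x = 1`; the variable of the Laurent series is `x - 1`. -/

/-- The Taylor series of a function at `1`. -/
def taylorAtOne (f : ℂ → ℂ) : HahnSeries ℤ ℂ :=
  HahnSeries.ofPowerSeries ℤ ℂ (PowerSeries.mk fun n => iteratedDeriv n f 1 / (n.factorial : ℂ))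

/-- The Laurent series of the function `x`, namely `1 + (x - 1)`. -/
def xSeries : HahnSeries ℤ ℂ := 1 + HahnSeries.single 1 1

/-- The part of `ζ̄(x) = 1/2 + 1/(x-1) + ∑_{n≠0} (1/(qⁿx-1) - 1/(qⁿ-1))` that is regular
at `x = 1`. -/
def zetaRegular (q x : ℂ) : ℂ :=
  1 / 2 + ∑' n : {n : ℤ // n ≠ 0}, (1 / (q ^ (n : ℤ) * x - 1) - 1 / (q ^ (n : ℤ) - 1))

/-- The Laurent series of `ζ̄` at `x = 1`. -/
def zetaSeries (q : ℂ) : HahnSeries ℤ ℂ :=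
  HahnSeries.single (-1) 1 + taylorAtOne (zetaRegular q)

/-- The part of `℘̄(x) = x/(x-1)² + ∑_{n≠0} qⁿx/(qⁿx-1)²` that is regular at `x = 1`. -/
def wpRegular (q x : ℂ) : ℂ :=
  ∑' n : {n : ℤ // n ≠ 0}, q ^ (n : ℤ) * x / (q ^ (n : ℤ) * x - 1) ^ 2

/-- The Laurent series of `℘̄` at `x = 1`; the polar part is that of
`x/(x-1)² = (x-1)⁻² + (x-1)⁻¹`. -/
def wpSeries (q : ℂ) : HahnSeries ℤ ℂ :=
  HahnSeries.single (-2) 1 + HahnSeries.single (-1) 1 + taylorAtOne (wpRegular q)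

/-- Superfunctions `f₀ + θ f₁`, with `f₀, f₁` Laurent series over `ℂ[ε, δ]`. -/
abbrev SuperFunction := OddExt (EpsDel (HahnSeries ℤ ℂ))

namespace SuperFunction

/-- A Laurent series as a superfunction. -/
def ofSeries (f : HahnSeries ℤ ℂ) : SuperFunction := OddExt.const (edConst f)
/-- A constant as a superfunction. -/
def ofConst (z : ℂ) : SuperFunction := ofSeries (HahnSeries.C z)
/-- The odd coordinate. -/
def theta : SuperFunction := OddExt.var _
/-- The parameter `ε` as a superfunction. -/
def eps : SuperFunction := OddExt.const (epsVar _)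
/-- The parameter `δ` as a superfunction. -/
def del : SuperFunction := OddExt.const (delVar _)
/-- The even coordinate (of `𝔾_m`) as a superfunction. -/
def x : SuperFunction := ofSeries xSeries

/-- The super zeta function
`ζ̄(x) (1 - ε δ ℘̄(x) / (1-y)) + (θ ε / (1-y)) (℘̄(x) / x)`, expanded at `x = 1`. -/
def superZeta (q y : ℂ) : SuperFunction :=
  ofSeries (zetaSeries q) * (1 - ofConst (1 - y)⁻¹ * eps * del * ofSeries (wpSeries q))
    + ofConst (1 - y)⁻¹ * theta * eps * ofSeries (wpSeries q / xSeries)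

end SuperFunction

/-- The superfield `Y(a, x, θ) b = a(x) b + θ (D a)(x) b`. -/
def SUSYVertexAlgebra.superfield (A : SUSYVertexAlgebra V) (a b : V) :
    OddExt (EpsDel (HahnModule ℤ ℂ V)) :=
  ⟨edConst (A.Y a b), edConst (A.Y (A.D a) b)⟩

/-- The residue of a `V`-valued Laurent series. -/
def residue (v : HahnModule ℤ ℂ V) : V := ((HahnModule.of ℂ).symm v).coeff (-1)

/-- The residue in `(x, θ)`: the coefficient of `θ x⁻¹`, with `θ` on the left. -/
def superResidue (F : OddExt (EpsDel (HahnModule ℤ ℂ V))) : EpsDel V :=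
  OddExt.map (OddExt.map residue) F.c₁

/-- The Virasoro field `L(z) = (D h)(z) - ∂_z J(z)`. -/
def StronglyConformal.virasoro (S : StronglyConformal A) : VertexOperator ℂ V :=
  A.Y (A.D S.h) - A.Y (A.T S.j)

end VertexAlgebra

end

/-! Write `o(b)` for the zero mode of `b`, the mode preserving conformal weight. Only `o(b)`
contributes to supertraces, so for `ε = δ = 0` the block is `ψ(b) = str o(b) q^(L₀) y^(J₀)`.
Applying `q∂_q` or `y∂_y` inserts `L₀` or `J₀`, the zero modes on the module of the conformal vector
and of `j`. Zhu's recursion `hasSum_strAt_zeroMode_mul` evaluates such insertions: for an even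
vector `a` of weight `m + 1` and charge `0`, inserting `a₍ₘ₎` changes `ψ(b)` into `ψ(res xᵐ ζ̄ Y(a)
b)`.

The recursion comes from two facts. The Borcherds identity turns the polar part of `ζ̄` into a sum
of products of modes of `a` and `b`. Cyclicity carries a mode of `a` around the supertrace at the
cost of a power of `q`, so the supertrace of each product is a geometric series of supertraces of
commutators; the Lambert series that appear are the Taylor coefficients of the regular part of `ζ̄`.
With termwise differentiation, for which absolute convergence at the points of an open set is enough
(`hasDerivAt_tsum_zpow`), this proves (b).

For (a), cyclicity is applied to `Q₀` and `H₀` as well. They have charge `±1`, so the supertrace of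
a commutator with them is `y - 1` times an odd component of the block. For `y ≠ 1` all four
components are thereby values of `ψ` (`block_eq`), and both equations become identities for `ψ`. The
derivatives are implemented by `E[ζ̄]` and `J[ζ̄]`, where `E[g]` is the anticommutator of `H[g]`
with `Q₋₁ + Q₀`; commuting them past `Q₋₁ + Q₀` and `H₀` produces the other terms of the residues.

In the `εδ`-component `∂_q` also acts on `ζ̄`. There one needs that `ψ` kills residues against
derivatives `z d/dz` (`ψ_smear_laurentD`), that `ζ̄ ℘̄ + q ∂_q ζ̄ = ½ (z d/dz)² ζ̄`
(`zetaSeries_mul_wpSeries`), and that mixed derivatives agree (`trace_J_E`). The identity is the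
`z`-derivative of `ζ̄² = ℘̄ + G`, which results from squaring the Fourier series of `ζ̄`. -/

set_option linter.unusedSectionVars false

/-! ### Gradings by joint eigenspaces and blockwise supertraces. -/

namespace TopOperators

variable {W : Type*} [AddCommGroup W] [Module ℂ W] [Superspace W] {O : TopOperators W}

theorem mem_weightSpace_iff {p : ℤ × ℤ} {w : W} :
    w ∈ O.weightSpace p ↔ O.L 0 w = (p.1 : ℂ) • w ∧ O.J 0 w = (p.2 : ℂ) • w := by
  rw [weightSpace, Submodule.mem_inf, Module.End.mem_eigenspace_iff, Module.End.mem_eigenspace_iff]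

/-- `X` shifts the joint weights by `d`. -/
def HasWeight (O : TopOperators W) (d : ℤ × ℤ) (X : Module.End ℂ W) : Prop :=
  ∀ p, ∀ w ∈ O.weightSpace p, X w ∈ O.weightSpace (p + d)

namespace IsGraded

theorem induction (hO : O.IsGraded) {P : W → Prop} (zero : P 0)
    (add : ∀ v w, P v → P w → P (v + w)) (mem : ∀ p, ∀ w ∈ O.weightSpace p, P w) (w : W) :
    P w := by
  obtain ⟨v, rfl⟩ := hO.decomp.surjective w
  induction v using DirectSum.induction_on with
  | zero => simpa using zero
  | add v v' hv hv' => rw [map_add]; exact add _ _ hv hv'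
  | of p w =>
    rw [show DirectSum.of (fun p => O.weightSpace p) p w =
        DirectSum.lof ℂ (ℤ × ℤ) (fun p => O.weightSpace p) p w from rfl, hO.decomp_lof]
    exact mem p _ w.2

theorem linearMap_ext (hO : O.IsGraded) {W' : Type*} [AddCommGroup W'] [Module ℂ W']
    {f g : W →ₗ[ℂ] W'} (h : ∀ p, ∀ w ∈ O.weightSpace p, f w = g w) : f = g :=
  LinearMap.ext fun w => hO.induction (P := fun w => f w = g w) (by simp)
    (fun v w hv hw => by simp [hv, hw]) h w

theorem proj_coe (hO : O.IsGraded) (p : ℤ × ℤ) (w : O.weightSpace p) : hO.proj p (w : W) = w := by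
  rw [proj, LinearMap.comp_apply, LinearEquiv.coe_coe, hO.decomp_symm_coe]
  simp

theorem proj_of_ne (hO : O.IsGraded) {p r : ℤ × ℤ} (h : r ≠ p) {w : W} (hw : w ∈ O.weightSpace r) :
    hO.proj p w = 0 := by
  rw [proj, LinearMap.comp_apply, LinearEquiv.coe_coe, hO.decomp_symm_coe r ⟨w, hw⟩]
  exact (DirectSum.component.of ℂ (M := fun p => O.weightSpace p) p r ⟨w, hw⟩).trans
    (dif_neg h)

theorem eq_bot_of_neg (hO : O.IsGraded) {p : ℤ × ℤ} (h : p.1 < 0) {w : W}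
    (hw : w ∈ O.weightSpace p) : w = 0 := by
  simpa [hO.nonneg p h] using hw

/-- A homogeneous operator commutes with the projections up to the shift of weights. -/
theorem proj_comp (hO : O.IsGraded) {d : ℤ × ℤ} {X : Module.End ℂ W} (hX : O.HasWeight d X)
    (p : ℤ × ℤ) (w : W) : (hO.proj (p + d) (X w) : W) = X (hO.proj p w) := by
  refine hO.induction (P := fun w => (hO.proj (p + d) (X w) : W) = X (hO.proj p w))
    (by simp) (fun v w hv hw => by simp [hv, hw]) (fun r w hw => ?_) w
  by_cases h : r = p
  · subst h
    rw [hO.proj_coe r ⟨w, hw⟩, hO.proj_coe (r + d) ⟨X w, hX r w hw⟩]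
  · rw [hO.proj_of_ne h hw, hO.proj_of_ne (r := r + d) (by simpa using h) (hX r w hw)]
    simp

end IsGraded

theorem HasWeight.mul {d e : ℤ × ℤ} {X Z : Module.End ℂ W} (hX : O.HasWeight d X)
    (hZ : O.HasWeight e Z) : O.HasWeight (d + e) (X * Z) := fun p w hw => by
  rw [Module.End.mul_apply, show p + (d + e) = p + e + d by abel]
  exact hX _ _ (hZ _ _ hw)

namespace IsGraded

section trace

variable (hO : O.IsGraded)

@[simp] theorem strAt_zero (p : ℤ × ℤ) : hO.strAt p 0 = 0 := by
  simp [strAt]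

theorem strAt_add (p : ℤ × ℤ) (X Z : Module.End ℂ W) :
    hO.strAt p (X + Z) = hO.strAt p X + hO.strAt p Z := by
  simp only [strAt, LinearMap.add_comp, LinearMap.comp_add, map_add]

theorem strAt_smul (p : ℤ × ℤ) (c : ℂ) (X : Module.End ℂ W) :
    hO.strAt p (c • X) = c * hO.strAt p X := by
  simp only [strAt, LinearMap.smul_comp, LinearMap.comp_smul, map_smul, smul_eq_mul]

/-- The blockwise supertrace as a linear functional. -/
noncomputable def strLin (p : ℤ × ℤ) : Module.End ℂ W →ₗ[ℂ] ℂ where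
  toFun := hO.strAt p
  map_add' := hO.strAt_add p
  map_smul' := hO.strAt_smul p

theorem strAt_neg (p : ℤ × ℤ) (X : Module.End ℂ W) : hO.strAt p (-X) = -hO.strAt p X :=
  map_neg (hO.strLin p) X

theorem strAt_sub (p : ℤ × ℤ) (X Z : Module.End ℂ W) :
    hO.strAt p (X - Z) = hO.strAt p X - hO.strAt p Z :=
  map_sub (hO.strLin p) X Z

theorem strAt_sum {ι : Type*} (p : ℤ × ℤ) (s : Finset ι) (f : ι → Module.End ℂ W) :
    hO.strAt p (∑ i ∈ s, f i) = ∑ i ∈ s, hO.strAt p (f i) :=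
  map_sum (hO.strLin p) f s

theorem strAt_congr {p : ℤ × ℤ} {X Z : Module.End ℂ W} (h : ∀ w ∈ O.weightSpace p, X w = Z w) :
    hO.strAt p X = hO.strAt p Z := by
  rw [strAt, strAt]
  congr 3
  ext w
  simp [h w w.2]

theorem strAt_eq_zero_of_neg {p : ℤ × ℤ} (h : p.1 < 0) (X : Module.End ℂ W) :
    hO.strAt p X = 0 := by
  rw [← hO.strAt_zero p]
  refine hO.strAt_congr fun w hw => ?_
  simp [hO.eq_bot_of_neg h hw]

/-- Under the supertrace this turns `q^(L₀) y^(J₀)`, `L₀` and `J₀`, standing on the right, into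
scalars. -/
theorem strAt_mul_of_eigen {p : ℤ × ℤ} {X Z : Module.End ℂ W} {c : ℂ}
    (h : ∀ w ∈ O.weightSpace p, Z w = c • w) : hO.strAt p (X * Z) = c * hO.strAt p X := by
  rw [← hO.strAt_smul]
  refine hO.strAt_congr fun w hw => ?_
  simp [h w hw]

variable (hP : O.HasWeight 0 (parityOp W))

include hP in
/-- An operator without diagonal part has vanishing blockwise supertrace. -/
theorem strAt_eq_zero {p r : ℤ × ℤ} (h : r ≠ p) {X : Module.End ℂ W}
    (hX : ∀ w ∈ O.weightSpace p, X w ∈ O.weightSpace r) : hO.strAt p X = 0 := by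
  rw [strAt]
  convert map_zero (LinearMap.trace ℂ (O.weightSpace p))
  ext w
  have h1 := hP r _ (hX w w.2)
  rw [add_zero] at h1
  simp [hO.proj_of_ne h h1]

include hP in
/-- Cyclicity of the supertrace: moving a homogeneous operator around. -/
theorem strAt_mul {d : ℤ × ℤ} {X : Module.End ℂ W} (hX : O.HasWeight d X) (Z : Module.End ℂ W)
    (p : ℤ × ℤ) :
    hO.strAt (p + d) (X * Z) = hO.strAt p (Superring.par Z * X) := by
  have := hO.finite p
  have := hO.finite (p + d)
  -- Ordinary cyclicity for two maps between the finite-dimensional eigenspaces at `p` and `p + d`.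
  -- The parity operator of the supertrace stays next to `X`, so reversing the order conjugates `Z`
  -- by it.
  let f : O.weightSpace p →ₗ[ℂ] O.weightSpace (p + d) :=
    (parityOp W ∘ₗ X ∘ₗ (O.weightSpace p).subtype).codRestrict (O.weightSpace (p + d))
      fun w => by simpa using hP _ _ (hX p w w.2)
  let g : O.weightSpace (p + d) →ₗ[ℂ] O.weightSpace p :=
    hO.proj p ∘ₗ Z ∘ₗ (O.weightSpace (p + d)).subtype
  have h1 : hO.proj (p + d) ∘ₗ parityOp W ∘ₗ (X * Z) ∘ₗ (O.weightSpace (p + d)).subtype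
      = f ∘ₗ g := by
    ext w
    have h2 := hO.proj_comp (hP.mul hX) p (Z w)
    rw [zero_add] at h2
    simpa [f, g] using h2
  have h2 : hO.proj p ∘ₗ parityOp W ∘ₗ (Superring.par Z * X) ∘ₗ (O.weightSpace p).subtype
      = g ∘ₗ f := by
    ext w
    have h3 : ∀ v, parityOp W (parityOp W v) = v := Superspace.parity_parity
    simp [f, g, Superring.par, h3]
  rw [strAt, strAt, h1, h2, LinearMap.trace_comp_comm']

-- The parity operator preserves the eigenspace, and conjugation does not change a trace. This
-- removes the sign when an even operator is carried around.
include hP in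
theorem strAt_par (p : ℤ × ℤ) (X : Module.End ℂ W) :
    hO.strAt p (Superring.par X) = hO.strAt p X := by
  have := hO.finite p
  let f : O.weightSpace p →ₗ[ℂ] O.weightSpace p :=
    (parityOp W ∘ₗ (O.weightSpace p).subtype).codRestrict (O.weightSpace p)
      fun w => by simpa using hP _ _ w.2
  let g : O.weightSpace p →ₗ[ℂ] O.weightSpace p :=
    hO.proj p ∘ₗ X ∘ₗ (O.weightSpace p).subtype
  have h1 : hO.proj p ∘ₗ parityOp W ∘ₗ X ∘ₗ (O.weightSpace p).subtype = f ∘ₗ g := by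
    ext w
    have h2 := hO.proj_comp hP p (X w)
    rw [add_zero] at h2
    simpa [f, g] using h2
  have h2 : hO.proj p ∘ₗ parityOp W ∘ₗ Superring.par X ∘ₗ (O.weightSpace p).subtype
      = g ∘ₗ f := by
    ext w
    have h3 : ∀ v, parityOp W (parityOp W v) = v := Superspace.parity_parity
    simp [f, g, Superring.par, h3]
  rw [strAt, strAt, h1, h2, LinearMap.trace_comp_comm']

end trace

end IsGraded

end TopOperators

/-! ### Translation covariance. -/

section Translation

variable {V : Type*} [AddCommGroup V] [Module ℂ V] [Superspace V] {A : SUSYVertexAlgebra V}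

/-- The identity `Y(∂a, z) = ∂_z Y(a, z)`. -/
def IsTranslationCovariant (A : SUSYVertexAlgebra V) {W : Type*} [AddCommGroup W] [Module ℂ W]
    (Y : V →ₗ[ℂ] VertexOperator ℂ W) : Prop :=
  ∀ a k, (Y (A.T a)).ncoeff k = (-(k : ℂ)) • (Y a).ncoeff (k - 1)

/-- The case `N = 0` of the bracket with `L_(N-1)` gives `[L₋₁, Y(a)] = Y(L₋₁ a)`, and `L₋₁ = ∂`;
compare with the translation axiom. -/
theorem StronglyConformal.translationCovariant (S : StronglyConformal A) :
    IsTranslationCovariant A A.Y := fun a k => by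
  have h1 := (S.quasiConformal.comm_L 0 a k).1
  have h2 := LinearMap.ext_iff.1 h1
  ext b
  have h3 := h2 b
  have h4 := A.translation a k b
  simp [S.L_neg_one] at h3
  rw [← h3, h4]
  simp

theorem HahnModule.exists_ncoeff_eq_zero {W : Type*} [AddCommGroup W] [Module ℂ W]
    (F : VertexOperator ℂ W) (u : W) : ∃ N : ℕ, ∀ n : ℤ, N ≤ n → F.ncoeff n u = 0 := by
  refine ⟨(-HahnSeries.order ((HahnModule.of ℂ).symm (F u))).toNat, fun n hn => ?_⟩
  refine VertexOperator.ncoeff_eq_zero_of_lt_order F n u ?_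
  have := Int.self_le_toNat (-HahnSeries.order ((HahnModule.of ℂ).symm (F u)))
  lia

variable {M : Type*} [AddCommGroup M] [Module ℂ M] [Superspace M]

/-- The Borcherds identity is available for homogeneous vectors only; this splitting extends its
consequences to all vectors by linearity. -/
theorem exists_parity_decomp (a : V) :
    ∃ a₀ a₁ : V, HasParity 0 a₀ ∧ HasParity 1 a₁ ∧ a = a₀ + a₁ := by
  have h3 : ∀ v : V, parityOp V (parityOp V v) = v := Superspace.parity_parity
  refine ⟨(1 / 2 : ℂ) • (a + parityOp V a), (1 / 2 : ℂ) • (a - parityOp V a), ?_, ?_, ?_⟩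
  · simp [HasParity, h3, add_comm]
  · simp [HasParity, h3, ← smul_neg]
  · module

theorem StronglyConformal.T_eq (S : StronglyConformal A) (a : V) :
    A.T a = (A.Y a).ncoeff (-2) A.vac := by
  have h1 := (A.creation (A.T a)).1
  rw [S.translationCovariant] at h1
  rw [← h1]
  simp

/-- These are the coefficients of `(1 - x)⁻²`, the weights in the Borcherds identity with `n = -2`.
-/
theorem Ring.choose_neg_two (l : ℕ) : (-1 : ℂ) ^ l * ((Ring.choose (-2 : ℤ) l : ℤ) : ℂ) =
    l + 1 := by
  rw [Ring.choose_neg]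
  have h : Ring.choose (2 + (l : ℤ) - 1) l = l + 1 := by
    rw [show 2 + (l : ℤ) - 1 = ((l + 1 : ℕ) : ℤ) by push_cast; ring, Ring.choose_natCast]
    simp
  rw [h]
  simp [Int.negOnePow_def, Units.smul_def]
  rw [← mul_add_one, ← mul_assoc, ← mul_pow]
  simp

theorem Ring.choose_neg_one (l : ℕ) : (-1 : ℂ) ^ l * ((Ring.choose (-1 : ℤ) l : ℤ) : ℂ) = 1 := by
  rw [Ring.choose_neg]
  have h : Ring.choose (1 + (l : ℤ) - 1) l = 1 := by
    rw [show 1 + (l : ℤ) - 1 = (l : ℤ) by ring, Ring.choose_natCast]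
    simp
  rw [h]
  simp [Int.negOnePow_def, Units.smul_def, ← mul_pow]

/-- The Borcherds identity for `a` and the vacuum with `m = 0`, `n = -2`. On the left only `a₍₋₂₎|0⟩
= ∂a` occurs. On the right the vacuum modes are Kronecker deltas, leaving the term `l = -1 - k` if
`k < 0`, `l = k - 1` if `k > 0`, and nothing if `k = 0`. -/
theorem SUSYModule.translationCovariant (X : SUSYModule A M) (S : StronglyConformal A) :
    IsTranslationCovariant A X.Y := by
  have key : ∀ a (i : ℕ), HasParity i a → ∀ k : ℤ,
      (X.Y (A.T a)).ncoeff k = (-(k : ℂ)) • (X.Y a).ncoeff (k - 1) := by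
    intro a i hi k
    ext u
    have h := X.borcherds a A.vac i 0 hi A.vac_even 0 (-2) k u
    rw [finsum_eq_single _ 0 (fun l hl => by
      rw [Ring.choose_zero_pos ℤ (Nat.pos_of_ne_zero hl)]; simp)] at h
    rw [S.T_eq]
    simp only [Ring.choose_zero_right, Nat.cast_zero, add_zero, zero_add, sub_zero, Int.cast_one,
      one_smul, mul_zero, pow_zero, mul_one] at h
    rw [h]
    simp only [Ring.choose_neg_two, X.Y_vac]
    rcases lt_or_ge k 0 with hk | hk
    · rw [finsum_eq_single _ (-1 - k).toNat]
      · have h1 : (((-1 - k).toNat : ℕ) : ℤ) = -1 - k := Int.toNat_of_nonneg (by lia)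
        have h2 : (((-1 - k).toNat : ℕ) : ℂ) = -1 - k := by
          exact_mod_cast congrArg (Int.cast (R := ℂ)) h1
        rw [if_pos (by lia), if_neg (by lia), h1, h2]
        simp only [show -2 - (-1 - k) = k - 1 by ring]
        simp
        module
      · intro l hl
        rw [if_neg (by lia), if_neg (by lia)]
        simp
    · rcases eq_or_lt_of_le hk with rfl | hk
      · rw [finsum_eq_zero_of_forall_eq_zero]
        · simp
        · intro l
          rw [if_neg (by lia), if_neg (by lia)]
          simp
      · rw [finsum_eq_single _ (k - 1).toNat]
        · have h1 : (((k - 1).toNat : ℕ) : ℤ) = k - 1 := Int.toNat_of_nonneg (by lia)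
          have h2 : (((k - 1).toNat : ℕ) : ℂ) = k - 1 := by
            exact_mod_cast congrArg (Int.cast (R := ℂ)) h1
          rw [if_neg (by lia), if_pos (by lia), h1, h2]
          simp
        · intro l hl
          rw [if_neg (by lia), if_neg (by lia)]
          simp
  intro a k
  obtain ⟨a₀, a₁, h₀, h₁, rfl⟩ := exists_parity_decomp a
  simp only [map_add, Pi.add_apply, key _ _ h₀, key _ _ h₁, smul_add]

end Translation

/-! ### Weights of the modes, and zero modes. -/

section Weights

variable {V W : Type*} [AddCommGroup V] [Module ℂ V] [Superspace V]
  [AddCommGroup W] [Module ℂ W] [Superspace W] {A : SUSYVertexAlgebra V}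

namespace TopOperators.Relations

variable {P : TopOperators W} (h : P.Relations 0 (Set.Ici (-1)) (Set.Ici 0))
include h

theorem hasWeight_parity : P.HasWeight 0 (parityOp W) := by
  intro p w hw
  rw [mem_weightSpace_iff] at hw
  rw [add_zero, mem_weightSpace_iff]
  have h1 := LinearMap.ext_iff.1 (h.L_even 0 (by simp)) w
  have h2 := LinearMap.ext_iff.1 (h.J_even 0 (by simp)) w
  simp only [Module.End.mul_apply, hw.1, hw.2] at h1 h2
  rw [← h1, ← h2]
  simp

theorem hasWeight_L (n : ℤ) (hn : -1 ≤ n) : P.HasWeight (-n, 0) (P.L n) := by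
  intro p w hw
  rw [mem_weightSpace_iff] at hw ⊢
  have h1 := LinearMap.ext_iff.1 (h.L_L 0 (by simp) n hn) w
  have h2 := LinearMap.ext_iff.1 (h.L_J n hn 0 (by simp)) w
  simp [hw.1, hw.2] at h1 h2
  rw [sub_eq_iff_eq_add] at h1
  constructor
  · rw [h1]; simp; module
  · rw [sub_eq_zero] at h2; rw [← h2]; simp

theorem hasWeight_Q (n : ℤ) (hn : -1 ≤ n) : P.HasWeight (-n, 1) (P.Q n) := by
  intro p w hw
  rw [mem_weightSpace_iff] at hw ⊢
  have h1 := LinearMap.ext_iff.1 (h.L_Q 0 (by simp) n hn) w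
  have h2 := LinearMap.ext_iff.1 (h.J_Q 0 (by simp) n hn) w
  simp [hw.1, hw.2] at h1 h2
  rw [sub_eq_iff_eq_add] at h1 h2
  constructor
  · rw [h1]; simp; module
  · rw [h2]; simp; module

theorem hasWeight_H (n : ℤ) (hn : 0 ≤ n) : P.HasWeight (-n, -1) (P.H n) := by
  intro p w hw
  rw [mem_weightSpace_iff] at hw ⊢
  have h1 := LinearMap.ext_iff.1 (h.L_H 0 (by simp) n hn) w
  have h2 := LinearMap.ext_iff.1 (h.J_H 0 (by simp) n hn) w
  simp [hw.1, hw.2] at h1 h2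
  rw [sub_eq_iff_eq_add] at h1 h2
  constructor
  · rw [h1]; simp; module
  · rw [h2]; simp; module

end TopOperators.Relations

namespace IsQuasiConformalAction

variable {O : TopOperators V} {Y : V →ₗ[ℂ] VertexOperator ℂ W} {P : TopOperators W}
  (h : IsQuasiConformalAction A O Y P)
include h

/-- For `N = 1` the bracket with `L₀` involves `L₋₁ a = ∂a` and `L₀ a`; translation covariance turns
the former into a multiple of the same mode of `a`, whence the shift `wt a - k - 1`. The charge
comes from the bracket with `J₀`. -/
theorem hasWeight_ncoeff (hT : IsTranslationCovariant A Y) (hL : O.L (-1) = A.T) {p : ℤ × ℤ}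
    {a : V} (ha : a ∈ O.weightSpace p) (k : ℤ) :
    P.HasWeight (p.1 - k - 1, p.2) ((Y a).ncoeff k) := by
  intro r w hw
  rw [TopOperators.mem_weightSpace_iff] at ha hw ⊢
  have h1 := LinearMap.ext_iff.1 (h.comm_L 1 a k).1 w
  have h2 := LinearMap.ext_iff.1 (h.comm_J 0 a k).1 w
  simp [Finset.sum_range_succ, hL, ha.1, ha.2, hw.1, hw.2, hT a] at h1 h2
  rw [sub_eq_iff_eq_add] at h1 h2
  constructor
  · rw [h1]; simp; module
  · rw [h2]; simp; module

end IsQuasiConformalAction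

/-- The mode of `Y(b, z)` preserving the conformal weight; it is the part of `Y(b, 1)` that
contributes to traces. -/
noncomputable def TopOperators.IsGraded.zeroMode {O : TopOperators V} (hO : O.IsGraded)
    (Y : V →ₗ[ℂ] VertexOperator ℂ W) : V →ₗ[ℂ] Module.End ℂ W :=
  DirectSum.toModule ℂ (ℤ × ℤ) _ (fun p => (LinearMap.proj (p.1 - 1) ∘ₗ
    VertexOperator.ncoeff ∘ₗ Y) ∘ₗ (O.weightSpace p).subtype) ∘ₗ hO.decomp.symm.toLinearMap

theorem TopOperators.IsGraded.zeroMode_of_mem {O : TopOperators V} (hO : O.IsGraded)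
    (Y : V →ₗ[ℂ] VertexOperator ℂ W) {p : ℤ × ℤ} {b : V} (hb : b ∈ O.weightSpace p) :
    hO.zeroMode Y b = (Y b).ncoeff (p.1 - 1) := by
  rw [zeroMode, LinearMap.comp_apply, LinearEquiv.coe_coe, hO.decomp_symm_coe p ⟨b, hb⟩,
    DirectSum.toModule_lof]
  rfl

namespace IsQuasiConformalAction

variable {O : TopOperators V} {Y : V →ₗ[ℂ] VertexOperator ℂ W} {P : TopOperators W}
  (h : IsQuasiConformalAction A O Y P) (hO : O.IsGraded)
  (hr : O.Relations 0 (Set.Ici (-1)) (Set.Ici 0))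

theorem par_zeroMode
    (hY : ∀ a n u, parityOp W ((Y a).ncoeff n u) = (Y (parityOp V a)).ncoeff n (parityOp W u))
    (hr : O.Relations 0 (Set.Ici (-1)) (Set.Ici 0)) (b : V) :
    Superring.par (hO.zeroMode Y b) = hO.zeroMode Y (parityOp V b) := by
  have h3 : ∀ v : W, parityOp W (parityOp W v) = v := Superspace.parity_parity
  refine hO.induction (P := fun b => Superring.par (hO.zeroMode Y b) =
    hO.zeroMode Y (parityOp V b)) (by simp) (fun v w hv hw => by simp [hv, hw]) ?_ b
  intro p b hb
  have h1 := hr.hasWeight_parity p b hb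
  rw [add_zero] at h1
  rw [hO.zeroMode_of_mem Y hb, hO.zeroMode_of_mem Y h1]
  ext u
  change parityOp W _ = _
  simp [hY, h3]

include h hr

/-- In `[Q₀, Y(b)] = x Y(Q₋₁ b) + Y(Q₀ b)` the factor `x` is absorbed by the higher weight of `Q₋₁
b`, so both terms are zero modes. This is why `Q₋₁ + Q₀` is the operator on `V` that corresponds to
`Q₀` on the module. -/
theorem comm_Q_zeroMode
    (hY : ∀ a n u, parityOp W ((Y a).ncoeff n u) = (Y (parityOp V a)).ncoeff n (parityOp W u))
    (b : V) :
    P.Q 0 * hO.zeroMode Y b - Superring.par (hO.zeroMode Y b) * P.Q 0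
      = hO.zeroMode Y (O.Q (-1) b + O.Q 0 b) := by
  rw [par_zeroMode hO hY hr]
  refine hO.induction (P := fun b => P.Q 0 * hO.zeroMode Y b -
    hO.zeroMode Y (parityOp V b) * P.Q 0 = hO.zeroMode Y (O.Q (-1) b + O.Q 0 b))
    (by simp) (fun v w hv hw => ?_) ?_ b
  · simp only [map_add] at hv hw ⊢
    calc _ = (P.Q 0 * hO.zeroMode Y v - hO.zeroMode Y (parityOp V v) * P.Q 0) +
          (P.Q 0 * hO.zeroMode Y w - hO.zeroMode Y (parityOp V w) * P.Q 0) := by noncomm_ring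
      _ = _ := by rw [hv, hw]; abel
  · intro p b hb
    have h1 := hr.hasWeight_parity p b hb
    have h2 := hr.hasWeight_Q (-1) (by simp) p b hb
    have h3 := hr.hasWeight_Q 0 (by simp) p b hb
    rw [add_zero] at h1
    have h4 := (h.comm_Q 1 b (p.1 - 1)).1
    simp [Finset.sum_range_succ] at h4
    rw [hO.zeroMode_of_mem Y hb, hO.zeroMode_of_mem Y h1, map_add, hO.zeroMode_of_mem Y h2,
      hO.zeroMode_of_mem Y h3, h4]
    simp

theorem comm_H_zeroMode
    (hY : ∀ a n u, parityOp W ((Y a).ncoeff n u) = (Y (parityOp V a)).ncoeff n (parityOp W u))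
    (b : V) :
    P.H 0 * hO.zeroMode Y b - Superring.par (hO.zeroMode Y b) * P.H 0
      = hO.zeroMode Y (O.H 0 b) := by
  rw [par_zeroMode hO hY hr]
  refine hO.induction (P := fun b => P.H 0 * hO.zeroMode Y b -
    hO.zeroMode Y (parityOp V b) * P.H 0 = hO.zeroMode Y (O.H 0 b))
    (by simp) (fun v w hv hw => ?_) ?_ b
  · simp only [map_add] at hv hw ⊢
    rw [← hv, ← hw]
    noncomm_ring
  · intro p b hb
    have h1 := hr.hasWeight_parity p b hb
    have h3 := hr.hasWeight_H 0 (by simp) p b hb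
    rw [add_zero] at h1
    have h4 := (h.comm_H 0 b (p.1 - 1)).1
    simp at h4
    rw [hO.zeroMode_of_mem Y hb, hO.zeroMode_of_mem Y h1, hO.zeroMode_of_mem Y h3, h4]
    simp

end IsQuasiConformalAction

end Weights

-- The range in the Borcherds identity depends on the vectors. Truncation at every sufficiently
-- large cut-off allows several such identities to be compared and added.
open Filter in
theorem finsum_nat_eventually_eq {G : Type*} [AddCommMonoid G] {f : ℕ → G} {N₀ : ℕ}
    (h : ∀ n, N₀ ≤ n → f n = 0) : ∀ᶠ N in atTop, ∑ᶠ n, f n = ∑ n ∈ Finset.range N, f n := by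
  filter_upwards [eventually_ge_atTop N₀] with N hN
  refine finsum_eq_sum_of_support_subset _ fun n hn => ?_
  by_contra hc
  exact hn (h n (by simp at hc; lia))

/-! ### The commutator and normal ordering cases of the Borcherds identity. -/

section Borcherds

variable {V M : Type*} [AddCommGroup V] [Module ℂ V] [Superspace V]
  [AddCommGroup M] [Module ℂ M] [Superspace M] {A : SUSYVertexAlgebra V} (X : SUSYModule A M)
  {a : V} (ha : HasParity 0 a)

namespace SUSYModule

open Filter

include ha

/-- For `n = 0` only `l = 0` survives on the right of the Borcherds identity, and there is no sign
because `a` is even. -/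
theorem commutator_eventually (b : V) (m r : ℤ) (u : M) : ∀ᶠ N in atTop,
    (X.Y a).ncoeff m ((X.Y b).ncoeff r u) - (X.Y b).ncoeff r ((X.Y a).ncoeff m u)
      = ∑ l ∈ Finset.range N, ((Ring.choose m l : ℤ) : ℂ) •
        (X.Y ((A.Y a).ncoeff l b)).ncoeff (m + r - l) u := by
  have key : ∀ (b : V) (k : ℕ), HasParity k b → ∀ᶠ N in atTop,
    (X.Y a).ncoeff m ((X.Y b).ncoeff r u) - (X.Y b).ncoeff r ((X.Y a).ncoeff m u)
      = ∑ l ∈ Finset.range N, ((Ring.choose m l : ℤ) : ℂ) •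
        (X.Y ((A.Y a).ncoeff l b)).ncoeff (m + r - l) u := by
    intro b k hb
    have h := X.borcherds a b 0 k ha hb m 0 r u
    obtain ⟨N₀, hN₀⟩ := HahnModule.exists_ncoeff_eq_zero (A.Y a) b
    have h2 := finsum_nat_eventually_eq (N₀ := N₀) (f := fun l : ℕ => ((Ring.choose m l : ℤ) : ℂ) •
      (X.Y ((A.Y a).ncoeff (0 + l) b)).ncoeff (m + r - l) u) (fun n hn => by
        rw [hN₀ _ (by simpa using hn)]; simp)
    filter_upwards [h2] with N hN
    rw [hN, finsum_eq_single _ 0 (fun l hl => by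
      rw [Ring.choose_zero_pos ℤ (Nat.pos_of_ne_zero hl)]; simp)] at h
    simpa using h.symm
  obtain ⟨b₀, b₁, h₀, h₁, rfl⟩ := exists_parity_decomp b
  filter_upwards [key b₀ _ h₀, key b₁ _ h₁] with N h2 h3
  simp only [map_add, Pi.add_apply, LinearMap.add_apply, smul_add, Finset.sum_add_distrib, ← h2,
    ← h3]
  abel

/-- For `n = -1` all weights `(-1)^l (n choose l)` are `1`, and `(-1)^n = -1` turns the difference
of the two orders into a sum. -/
theorem normalOrder_eventually (b : V) (m r : ℤ) (u : M) : ∀ᶠ N in atTop,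
    ∑ l ∈ Finset.range N, ((Ring.choose m l : ℤ) : ℂ) •
        (X.Y ((A.Y a).ncoeff (l - 1) b)).ncoeff (m + r - l) u
      = ∑ l ∈ Finset.range N, ((X.Y a).ncoeff (m - 1 - l) ((X.Y b).ncoeff (r + l) u)
        + (X.Y b).ncoeff (r - 1 - l) ((X.Y a).ncoeff (m + l) u)) := by
  have key : ∀ (b : V) (k : ℕ), HasParity k b → ∀ᶠ N in atTop,
    ∑ l ∈ Finset.range N, ((Ring.choose m l : ℤ) : ℂ) •
        (X.Y ((A.Y a).ncoeff (l - 1) b)).ncoeff (m + r - l) u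
      = ∑ l ∈ Finset.range N, ((X.Y a).ncoeff (m - 1 - l) ((X.Y b).ncoeff (r + l) u)
        + (X.Y b).ncoeff (r - 1 - l) ((X.Y a).ncoeff (m + l) u)) := by
    intro b k hb
    have h := X.borcherds a b 0 k ha hb m (-1) r u
    obtain ⟨N₀, hN₀⟩ := HahnModule.exists_ncoeff_eq_zero (A.Y a) b
    obtain ⟨N₁, hN₁⟩ := HahnModule.exists_ncoeff_eq_zero (X.Y a) u
    obtain ⟨N₂, hN₂⟩ := HahnModule.exists_ncoeff_eq_zero (X.Y b) u
    have h2 := finsum_nat_eventually_eq (N₀ := N₀ + 1) (f := fun l : ℕ =>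
      ((Ring.choose m l : ℤ) : ℂ) •
      (X.Y ((A.Y a).ncoeff (-1 + l) b)).ncoeff (m + r - l) u) (fun n hn => by
        rw [hN₀ _ (by lia)]; simp)
    simp only [Ring.choose_neg_one] at h
    have h3 := finsum_nat_eventually_eq (N₀ := N₁ + N₂ + (-r).toNat + (-m).toNat) (f := fun l : ℕ =>
      (1 : ℂ) • ((X.Y a).ncoeff (m + -1 - l) ((X.Y b).ncoeff (r + l) u)
          - ((-1 : ℂ) ^ (-1 : ℤ) * (-1 : ℂ) ^ (0 * k)) •
            (X.Y b).ncoeff (-1 + r - l) ((X.Y a).ncoeff (m + l) u))) (fun n hn => by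
        rw [hN₁ _ (by lia), hN₂ _ (by lia)]; simp)
    filter_upwards [h2, h3] with N h4 h5
    rw [h4, h5] at h
    convert h using 3 with l hl l hl
    · rw [show (l : ℤ) - 1 = -1 + l by ring]
    · simp only [show m - 1 - (l : ℤ) = m + -1 - l by ring, show r - 1 - (l : ℤ) = -1
        + r - l by ring]
      simp
  obtain ⟨b₀, b₁, h₀, h₁, rfl⟩ := exists_parity_decomp b
  filter_upwards [key b₀ _ h₀, key b₁ _ h₁] with N h2 h3
  simp only [map_add, Pi.add_apply, LinearMap.add_apply, smul_add,
      Finset.sum_add_distrib] at h2 h3 ⊢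
  rw [h2, h3]
  abel

/-- The commutator formula. -/
theorem commutator (b : V) (m r : ℤ) {N : ℕ} (hN : ∀ i : ℤ, N ≤ i → (A.Y a).ncoeff i b = 0) :
    (X.Y a).ncoeff m * (X.Y b).ncoeff r - (X.Y b).ncoeff r * (X.Y a).ncoeff m
      = ∑ l ∈ Finset.range N, ((Ring.choose m l : ℤ) : ℂ) •
        (X.Y ((A.Y a).ncoeff l b)).ncoeff (m + r - l) := by
  ext u
  obtain ⟨N', hN', h⟩ := ((eventually_ge_atTop N).and (X.commutator_eventually ha b m r u)).exists
  simp only [LinearMap.sub_apply, Module.End.mul_apply, h, LinearMap.sum_apply,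
    LinearMap.smul_apply]
  symm
  refine Finset.sum_subset (Finset.range_mono hN') fun l _ hl => ?_
  rw [hN _ (by simpa using hl)]
  simp

end SUSYModule

end Borcherds

/-! ### Supertraces of products of modes. -/

section Recursion

variable {V M : Type*} [AddCommGroup V] [Module ℂ V] [Superspace V]
  [AddCommGroup M] [Module ℂ M] [Superspace M] {A : SUSYVertexAlgebra V} {X : SUSYModule A M}
  {S : StronglyConformal A}

namespace SUSYModule.IsPositiveEnergy

variable (hX : X.IsPositiveEnergy S)

/-- The operators `Lₙ, Qₙ, Jₙ, Hₙ` on the algebra itself. -/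
noncomputable abbrev _root_.StronglyConformal.ops (S : StronglyConformal A) : TopOperators V :=
  topModes A A.Y S.j S.h

include hX in
theorem hasWeight_parity : (X.ops S).HasWeight 0 (parityOp M) :=
  hX.relations.hasWeight_parity

include hX in
theorem hasWeight_ncoeff {p : ℤ × ℤ} {a : V} (ha : a ∈ S.ops.weightSpace p) (k : ℤ) :
    (X.ops S).HasWeight (p.1 - k - 1, p.2) ((X.Y a).ncoeff k) :=
  IsQuasiConformalAction.hasWeight_ncoeff hX (X.translationCovariant S) S.L_neg_one ha k

theorem _root_.StronglyConformal.hasWeight_ncoeff {p : ℤ × ℤ} {a : V}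
    (ha : a ∈ S.ops.weightSpace p) (k : ℤ) :
    S.ops.HasWeight (p.1 - k - 1, p.2) ((A.Y a).ncoeff k) :=
  S.quasiConformal.hasWeight_ncoeff S.translationCovariant S.L_neg_one ha k

/-- The zero mode of `b` on the module. -/
noncomputable abbrev zeroMode (_ : X.IsPositiveEnergy S) : V →ₗ[ℂ] Module.End ℂ M :=
  S.quasiConformal.graded.zeroMode X.Y

variable {a : V} (ha : HasParity 0 a) {m : ℕ} (haw : a ∈ S.ops.weightSpace ((m : ℤ) + 1, 0))
  {b : V} {r : ℤ × ℤ} (hb : b ∈ S.ops.weightSpace r)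

include haw hb in
theorem _root_.StronglyConformal.ncoeff_mem (i : ℤ) :
    (A.Y a).ncoeff i b ∈ S.ops.weightSpace (r.1 + m - i, r.2) := by
  have := S.hasWeight_ncoeff haw i r b hb
  convert this using 2
  ext <;> simp
  lia

-- The shifts `l` and `-l` of the two modes cancel in total, so every term of the commutator formula
-- is a zero mode.
include ha haw hb in
theorem comm_eq_sum_zeroMode (l : ℤ) {N : ℕ} (hN : ∀ i : ℤ, N ≤ i → (A.Y a).ncoeff i b = 0) :
    (X.Y a).ncoeff (m + l) * (X.Y b).ncoeff (r.1 - 1 - l)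
      - (X.Y b).ncoeff (r.1 - 1 - l) * (X.Y a).ncoeff (m + l)
      = ∑ i ∈ Finset.range N, ((Ring.choose (m + l) i : ℤ) : ℂ) •
        hX.zeroMode ((A.Y a).ncoeff i b) := by
  rw [X.commutator ha b _ _ hN]
  refine Finset.sum_congr rfl fun i _ => ?_
  rw [TopOperators.IsGraded.zeroMode_of_mem _ _ (S.ncoeff_mem haw hb i)]
  congr 2
  ring

include hX haw in
theorem hasWeight_mode (l : ℤ) : (X.ops S).HasWeight (-l, 0) ((X.Y a).ncoeff (m + l)) := by
  have := hX.hasWeight_ncoeff haw (m + l)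
  convert this using 2
  simp

include ha in
theorem par_ncoeff (k : ℤ) : Superring.par ((X.Y a).ncoeff k) = (X.Y a).ncoeff k := by
  have h3 : ∀ v : M, parityOp M (parityOp M v) = v := Superspace.parity_parity
  ext u
  change parityOp M _ = _
  rw [HasParity, pow_zero, one_smul] at ha
  simp [X.Y_even, h3, ha]

include ha haw in
/-- Moving a mode of an even vector around the supertrace. -/
theorem strAt_mode_mul (Z : Module.End ℂ M) (l : ℤ) (p : ℤ × ℤ) :
    hX.graded.strAt p ((X.Y a).ncoeff (m + l) * Z)
      = hX.graded.strAt (p + (l, 0)) (Z * (X.Y a).ncoeff (m + l)) := by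
  have h := hX.graded.strAt_mul hX.hasWeight_parity (hX.hasWeight_mode haw l) Z (p + (l, 0))
  rw [show p + (l, 0) + (-l, 0) = p by ext <;> simp] at h
  rw [h, ← hX.graded.strAt_par hX.hasWeight_parity (_ + _) (Z * _), map_mul, par_ncoeff ha]

-- The supertrace of the normal ordering formula. Conformal weights are nonnegative, so on a block
-- of weight below `K` the rightmost factors kill everything once `l ≥ K`; the cut-off thus depends
-- on the block alone. The left side is the contribution of the pole of `ζ̄`, including the factor
-- `xᵐ`.
include ha haw hb in
theorem sum_choose_strAt (p : ℤ × ℤ) {N K : ℕ} (hN : ∀ i : ℤ, N ≤ i → (A.Y a).ncoeff i b = 0)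
    (hK : p.1 < K) :
    ∑ i ∈ Finset.range (N + 1), ((Ring.choose (m : ℤ) i : ℤ) : ℂ) *
        hX.graded.strAt p (hX.zeroMode ((A.Y a).ncoeff (i - 1) b))
      = ∑ l ∈ Finset.range K,
        (hX.graded.strAt p ((X.Y a).ncoeff (m + (-1 - l)) * (X.Y b).ncoeff (r.1 - 1 - (-1 - l)))
          + hX.graded.strAt p ((X.Y b).ncoeff (r.1 - 1 - l) * (X.Y a).ncoeff (m + l))) := by
  simp only [← TopOperators.IsGraded.strAt_smul, ← TopOperators.IsGraded.strAt_sum,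
    ← TopOperators.IsGraded.strAt_add]
  refine hX.graded.strAt_congr fun u hu => ?_
  obtain ⟨N', ⟨h1, h2⟩, h⟩ := (((Filter.eventually_ge_atTop (N + 1)).and
    (Filter.eventually_ge_atTop K)).and (X.normalOrder_eventually ha b m r.1 u)).exists
  simp only [LinearMap.sum_apply, LinearMap.smul_apply, LinearMap.add_apply, Module.End.mul_apply]
  trans ∑ l ∈ Finset.range N', ((Ring.choose (m : ℤ) l : ℤ) : ℂ) •
        (X.Y ((A.Y a).ncoeff (l - 1) b)).ncoeff (m + r.1 - l) u
  · rw [Finset.sum_subset (Finset.range_mono h1)]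
    · refine Finset.sum_congr rfl fun i _ => ?_
      rw [TopOperators.IsGraded.zeroMode_of_mem _ _ (S.ncoeff_mem haw hb _)]
      simp only [show r.1 + (m : ℤ) - (i - 1) - 1 = m + r.1 - i by ring]
    · intro i _ hi
      rw [hN (i - 1) (by simp at hi; lia)]
      simp
  · rw [h]
    symm
    rw [Finset.sum_subset (Finset.range_mono h2)]
    · refine Finset.sum_congr rfl fun i _ => ?_
      simp only [show r.1 - 1 - (-1 - (i : ℤ)) = r.1 + i by ring,
        show (m : ℤ) + (-1 - i) = m - 1 - i by ring]
    · intro l _ hl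
      have hl' : K ≤ l := by simpa using hl
      have h3 := hX.hasWeight_mode haw l p u hu
      have h4 := hX.hasWeight_ncoeff hb (r.1 + l) p u hu
      rw [hX.graded.eq_bot_of_neg (by simp; lia) h3,
        show r.1 - 1 - (-1 - (l : ℤ)) = r.1 + l by ring,
        hX.graded.eq_bot_of_neg (by simp; lia) h4]
      simp

end SUSYModule.IsPositiveEnergy

end Recursion

/-! ### Termwise differentiation of sums of integral powers. -/

section PowerSums

open Filter Topology

/-- Bernoulli's inequality `1 + k η ≤ (1 + η)^k` trades the factor `|n|` produced by differentiation
for a slight dilation of the radius. Two dilations occur because the exponent may have either sign.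
-/
theorem natAbs_mul_zpow_le {η r t : ℝ} (hη : 0 < η) (hr : 0 < r) (h1 : (1 + η)⁻¹ * r ≤ t)
    (h2 : t ≤ (1 + η) * r) (n : ℤ) :
    |(n : ℝ)| * t ^ n ≤ η⁻¹ * (((1 + η) ^ 2 * r) ^ n + ((1 + η)⁻¹ ^ 2 * r) ^ n) := by
  have hη' : 0 < 1 + η := by linarith
  have ht : 0 < t := lt_of_lt_of_le (by positivity) h1
  have key : ∀ k : ℕ, (k : ℝ) ≤ η⁻¹ * (1 + η) ^ k := fun k => by
    have := one_add_mul_le_pow (a := η) (by linarith) k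
    rw [inv_mul_eq_div, le_div_iff₀ hη]
    linarith
  rcases Int.eq_nat_or_neg n with ⟨k, rfl | rfl⟩
  · have h3 : t ^ k ≤ ((1 + η) * r) ^ k := pow_le_pow_left₀ ht.le h2 k
    have h4 := mul_le_mul (key k) h3 (by positivity) (by positivity)
    simp only [zpow_natCast, Int.cast_natCast, Nat.abs_cast]
    refine h4.trans ?_
    rw [mul_add, mul_assoc, ← mul_pow, show (1 + η) * ((1 + η) * r) = (1 + η) ^ 2 * r by ring]
    have : 0 ≤ η⁻¹ * ((1 + η)⁻¹ ^ 2 * r) ^ k := by positivity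
    linarith
  · have h3 : (t ^ k)⁻¹ ≤ (((1 + η)⁻¹ * r) ^ k)⁻¹ :=
      inv_anti₀ (by positivity) (pow_le_pow_left₀ (by positivity) h1 k)
    have h4 := mul_le_mul (key k) h3 (by positivity) (by positivity)
    simp only [zpow_neg, zpow_natCast, Int.cast_neg, Int.cast_natCast, abs_neg, Nat.abs_cast]
    refine h4.trans ?_
    rw [mul_add, mul_assoc, ← inv_pow, ← mul_pow,
      show (1 + η) * ((1 + η)⁻¹ * r)⁻¹ = ((1 + η)⁻¹ ^ 2 * r)⁻¹ by field_simp, inv_pow]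
    have : 0 ≤ η⁻¹ * (((1 + η) ^ 2 * r) ^ k)⁻¹ := by positivity
    linarith

theorem exists_dilation {U : Set ℂ} (hU : IsOpen U) {z : ℂ} (hz : z ∈ U) :
    ∃ η : ℝ, 0 < η ∧ (((1 + η) ^ 2 : ℝ) : ℂ) * z ∈ U ∧ (((1 + η)⁻¹ ^ 2 : ℝ) : ℂ) * z ∈ U := by
  have h1 : ContinuousAt (fun η : ℝ => (((1 + η) ^ 2 : ℝ) : ℂ) * z) 0 := by fun_prop
  have h2 : ContinuousAt (fun η : ℝ => (((1 + η)⁻¹ ^ 2 : ℝ) : ℂ) * z) 0 := by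
    have : ContinuousAt (fun η : ℝ => (1 + η)⁻¹) 0 :=
      ContinuousAt.inv₀ (by fun_prop) (by simp)
    fun_prop
  have h3 := h1.eventually (hU.mem_nhds (by simpa using hz))
  have h4 := h2.eventually (hU.mem_nhds (by simpa using hz))
  have h5 := ((h3.and h4).filter_mono (nhdsWithin_le_nhds (s := Set.Ioi 0))).and
    self_mem_nhdsWithin
  obtain ⟨η, ⟨h6, h7⟩, h8⟩ := h5.exists
  exact ⟨η, h8, h6, h7⟩

variable {ι : Type*} {c : ι → ℂ} {e : ι → ℤ} {U : Set ℂ}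

/-- The terms at the two dilated points `(1 + η)^(±2) z`, which lie in `U` for small `η`, dominate
the differentiated terms on a disc about `z`. Hence no locally uniform bound has to be assumed. -/
theorem hasDerivAt_tsum_zpow (hU : IsOpen U) (h0 : (0 : ℂ) ∉ U)
    (hs : ∀ z ∈ U, Summable fun i => c i * z ^ e i) {z : ℂ} (hz : z ∈ U) :
    Summable (fun i => c i * e i * z ^ (e i - 1)) ∧
    HasDerivAt (fun w => ∑' i, c i * w ^ e i) (∑' i, c i * e i * z ^ (e i - 1)) z := by
  obtain ⟨η, hη, h1, h2⟩ := exists_dilation hU hz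
  have hz0 : z ≠ 0 := fun h => h0 (h ▸ hz)
  have hr : 0 < ‖z‖ := norm_pos_iff.2 hz0
  have hη' : 0 < 1 + η := by linarith
  set r := ‖z‖ with hrdef
  let u : ι → ℝ := fun i => (1 + η) * r⁻¹ * (η⁻¹ * (‖c i * ((((1 + η) ^ 2 : ℝ) : ℂ) * z) ^ e i‖
    + ‖c i * ((((1 + η)⁻¹ ^ 2 : ℝ) : ℂ) * z) ^ e i‖))
  have hu : Summable u := (((hs _ h1).norm.add (hs _ h2).norm).mul_left _).mul_left _
  have hn1 : ‖(((1 + η) ^ 2 : ℝ) : ℂ) * z‖ = (1 + η) ^ 2 * r := by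
    rw [norm_mul, Complex.norm_real, Real.norm_of_nonneg (by positivity)]
  have hn2 : ‖(((1 + η)⁻¹ ^ 2 : ℝ) : ℂ) * z‖ = (1 + η)⁻¹ ^ 2 * r := by
    rw [norm_mul, Complex.norm_real, Real.norm_of_nonneg (by positivity)]
  -- The radius equals `r - (1 + η)⁻¹ r`, which makes the lower bound immediate; the upper bound has
  -- room to spare.
  have hball : ∀ w ∈ Metric.ball z (r * (η * (1 + η)⁻¹)),
      (1 + η)⁻¹ * r ≤ ‖w‖ ∧ ‖w‖ ≤ (1 + η) * r := by
    intro w hw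
    rw [mem_ball_iff_norm] at hw
    have h3 := norm_sub_norm_le z w
    have h4 := norm_sub_norm_le w z
    rw [norm_sub_rev] at h3
    have h5 : r * (η * (1 + η)⁻¹) = r - (1 + η)⁻¹ * r := by field_simp; ring
    have h6 : (1 + η)⁻¹ * r ≥ r - η * r := by
      rw [ge_iff_le, inv_mul_eq_div, le_div_iff₀ hη']
      nlinarith [mul_pos hη hr, mul_pos (mul_pos hη hr) hη]
    constructor <;> linarith
  have hbound : ∀ i, ∀ w ∈ Metric.ball z (r * (η * (1 + η)⁻¹)),
      ‖c i * e i * w ^ (e i - 1)‖ ≤ u i := by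
    intro i w hw
    obtain ⟨h3, h4⟩ := hball w hw
    have hw0 : 0 < ‖w‖ := lt_of_lt_of_le (by positivity) h3
    have h5 := natAbs_mul_zpow_le hη hr h3 h4 (e i)
    have h6 : ‖w‖⁻¹ ≤ (1 + η) * r⁻¹ := by
      rw [show (1 + η) * r⁻¹ = ((1 + η)⁻¹ * r)⁻¹ by field_simp]
      exact inv_anti₀ (by positivity) h3
    calc ‖c i * e i * w ^ (e i - 1)‖ = ‖w‖⁻¹ * (‖c i‖ * (|(e i : ℝ)| * ‖w‖ ^ e i)) := by
          rw [norm_mul, norm_mul, norm_zpow, zpow_sub_one₀ hw0.ne', Complex.norm_intCast]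
          ring
      _ ≤ (1 + η) * r⁻¹ * (‖c i‖ * (η⁻¹ * (((1 + η) ^ 2 * r) ^ e i +
          ((1 + η)⁻¹ ^ 2 * r) ^ e i))) := by gcongr
      _ = u i := by
          simp only [u, norm_mul (c i), norm_zpow, hn1, hn2]
          ring
  have hmem : z ∈ Metric.ball z (r * (η * (1 + η)⁻¹)) := Metric.mem_ball_self (by positivity)
  refine ⟨Summable.of_norm_bounded hu fun i => hbound i z hmem, ?_⟩
  refine hasDerivAt_tsum_of_isPreconnected hu Metric.isOpen_ball
    (convex_ball _ _).isPreconnected (fun i w hw => ?_) hbound hmem (hs z hz) hmem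
  have hw0 : w ≠ 0 := norm_pos_iff.1 (lt_of_lt_of_le (by positivity) (hball w hw).1)
  have := (hasDerivAt_zpow (e i) w (Or.inl hw0)).const_mul (c i)
  rwa [← mul_assoc] at this

theorem iteratedDeriv_tsum_zpow (hU : IsOpen U) (h0 : (0 : ℂ) ∉ U)
    (hs : ∀ z ∈ U, Summable fun i => c i * z ^ e i) (n : ℕ) {z : ℂ} (hz : z ∈ U) :
    Summable (fun i => c i * ((n.factorial : ℂ) * (Ring.choose (e i) n : ℤ)) * z ^ (e i - n)) ∧
    iteratedDeriv n (fun w => ∑' i, c i * w ^ e i) z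
      = ∑' i, c i * ((n.factorial : ℂ) * (Ring.choose (e i) n : ℤ)) * z ^ (e i - n) := by
  induction n generalizing z with
  | zero => simpa using hs z hz
  | succ n ih =>
    have h1 := hasDerivAt_tsum_zpow (e := fun i => e i - n) hU h0 (fun z hz => (ih hz).1) hz
    have hch : ∀ i, c i * ((n.factorial : ℂ) * (Ring.choose (e i) n : ℤ)) * ((e i - n : ℤ) : ℂ)
        = c i * (((n + 1).factorial : ℂ) * (Ring.choose (e i) (n + 1) : ℤ)) := by
      intro i
      have h2 : (n.factorial : ℤ) * Ring.choose (e i) n * (e i - n)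
          = ((n + 1).factorial : ℤ) * Ring.choose (e i) (n + 1) := by
        have h3 := Ring.descPochhammer_eq_factorial_smul_choose (e i) n
        have h4 := Ring.descPochhammer_eq_factorial_smul_choose (e i) (n + 1)
        rw [descPochhammer_succ_right, Polynomial.smeval_mul, h3] at h4
        simpa [Polynomial.smeval_sub, Polynomial.smeval_X, Polynomial.smeval_natCast] using h4
      have h5 := congrArg (Int.cast (R := ℂ)) h2
      push_cast at h5 ⊢
      rw [← h5]
      ring
    simp only [hch, show ∀ i, e i - (n : ℤ) - 1 = e i - ((n + 1 : ℕ) : ℤ) by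
      intro i; push_cast; ring] at h1
    refine ⟨h1.1, ?_⟩
    rw [iteratedDeriv_succ, ← h1.2.deriv]
    apply Filter.EventuallyEq.deriv_eq
    filter_upwards [hU.mem_nhds hz] with w hw
    exact (ih hw).2

/-- Taylor coefficients at `1` of a convergent sum of powers. -/
theorem hasSum_taylor_tsum_zpow (hU : IsOpen U) (h0 : (0 : ℂ) ∉ U) (h1 : (1 : ℂ) ∈ U)
    (hs : ∀ z ∈ U, Summable fun i => c i * z ^ e i) {f : ℂ → ℂ}
    (hf : ∀ z ∈ U, f z = ∑' i, c i * z ^ e i) (n : ℕ) :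
    HasSum (fun i => c i * (Ring.choose (e i) n : ℤ)) (iteratedDeriv n f 1 / n.factorial) := by
  have h2 := iteratedDeriv_tsum_zpow hU h0 hs n h1
  have h3 : f =ᶠ[𝓝 1] fun w => ∑' i, c i * w ^ e i := by
    filter_upwards [hU.mem_nhds h1] with w hw using hf w hw
  rw [h3.iteratedDeriv_eq n, h2.2]
  have h4 := (h2.1.hasSum.div_const (n.factorial : ℂ))
  have hn : (n.factorial : ℂ) ≠ 0 := by exact_mod_cast n.factorial_ne_zero
  rwa [show (fun i => c i * ((Ring.choose (e i) n : ℤ) : ℂ)) = fun i =>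
    c i * ((n.factorial : ℂ) * (Ring.choose (e i) n : ℤ)) * 1 ^ (e i - n) / n.factorial from
      funext fun i => by rw [one_zpow]; field_simp]

end PowerSums

/-! ### Two-sided Lambert series. -/

section Lambert

open Filter Topology

/-- The exponents of `z` in a two-sided Lambert series. -/
def lambertExp : (ℕ × ℕ) ⊕ (ℕ × ℕ) → ℤ :=
  Sum.elim (fun x => -((x.2 : ℤ) + 1)) (fun x => (x.2 : ℤ) + 1)

/-- The coefficients of a two-sided Lambert series. -/
noncomputable def lambertCoeff (a b : ℕ) (s t q : ℂ) : (ℕ × ℕ) ⊕ (ℕ × ℕ) → ℂ :=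
  Sum.elim (fun x => s * ((x.1 : ℂ) + 1) ^ a * ((x.2 : ℂ) + 1) ^ b * q ^ ((x.1 + 1) * (x.2 + 1)))
    (fun x => t * ((x.1 : ℂ) + 1) ^ a * ((x.2 : ℂ) + 1) ^ b * q ^ ((x.1 + 1) * (x.2 + 1)))

/-- The two-sided Lambert series `∑ lᵃ kᵇ q^(l k) (s z⁻ᵏ + t zᵏ)` over `l, k ≥ 1`. -/
noncomputable def lambertSum (a b : ℕ) (s t q z : ℂ) : ℂ :=
  ∑' i, lambertCoeff a b s t q i * z ^ lambertExp i

/-- The annulus `|q| < |z| < 1 / |q|`. -/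
def lambertAnnulus (q : ℂ) : Set ℂ := {z | ‖q‖ < ‖z‖ ∧ ‖q‖ * ‖z‖ < 1}

theorem isOpen_lambertAnnulus (q : ℂ) : IsOpen (lambertAnnulus q) :=
  (isOpen_lt continuous_const continuous_norm).inter
    (isOpen_lt (continuous_const.mul continuous_norm) continuous_const)

theorem zero_notMem_lambertAnnulus (q : ℂ) : (0 : ℂ) ∉ lambertAnnulus q := fun h => by
  have := h.1
  rw [norm_zero] at this
  exact absurd this (not_lt.2 (norm_nonneg q))

theorem one_mem_lambertAnnulus {q : ℂ} (hq : ‖q‖ < 1) : (1 : ℂ) ∈ lambertAnnulus q := by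
  simpa [lambertAnnulus] using hq

/-- Since `l k ≥ (l - 1) + k` for `l, k ≥ 1`, the double series is dominated by a product of two
one-variable series. -/
theorem summable_lambert_aux (a b : ℕ) {q w : ℂ} (hq : ‖q‖ < 1) (hw : ‖q‖ * ‖w‖ < 1) (s : ℂ) :
    Summable fun x : ℕ × ℕ => s * ((x.1 : ℂ) + 1) ^ a * ((x.2 : ℂ) + 1) ^ b *
      q ^ ((x.1 + 1) * (x.2 + 1)) * w ^ (x.2 + 1) := by
  have key : ∀ (n : ℕ) {r : ℝ}, 0 ≤ r → r < 1 →
      Summable fun l : ℕ => ((l : ℝ) + 1) ^ n * r ^ l := by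
    intro n r hr hr1
    rcases eq_or_lt_of_le hr with rfl | hr0
    · refine summable_of_ne_finset_zero (s := {0}) fun l hl => ?_
      simp at hl
      simp [hl]
    have := (summable_nat_add_iff 1).2 (summable_pow_mul_geometric_of_norm_lt_one n
      (r := r) (by rwa [Real.norm_of_nonneg hr]))
    refine (this.mul_left r⁻¹).congr fun l => ?_
    push_cast
    field_simp
    ring
  have h1 := key a (norm_nonneg q) hq
  have h2 := (key b (mul_nonneg (norm_nonneg q) (norm_nonneg w)) hw).mul_right (‖q‖ * ‖w‖)
  refine Summable.of_norm_bounded ((h1.mul_of_nonneg h2 (fun l => by positivity)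
    (fun l => by positivity)).mul_left ‖s‖) fun x => ?_
  have h3 : ‖q‖ ^ ((x.1 + 1) * (x.2 + 1)) ≤ ‖q‖ ^ (x.1 + (x.2 + 1)) :=
    pow_le_pow_of_le_one (norm_nonneg q) hq.le (by nlinarith)
  have h4 : ∀ n : ℕ, ‖(n : ℂ) + 1‖ = n + 1 := fun n => by
    rw [← Nat.cast_one (R := ℂ), ← Nat.cast_add, Complex.norm_natCast]; simp
  simp only [norm_mul, norm_pow, h4]
  calc _ ≤ ‖s‖ * ((x.1 : ℝ) + 1) ^ a * ((x.2 : ℝ) + 1) ^ b * ‖q‖ ^ (x.1 + (x.2 + 1)) *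
        ‖w‖ ^ (x.2 + 1) := by gcongr
    _ = _ := by rw [pow_add, mul_pow]; ring

theorem summable_lambert (a b : ℕ) (s t : ℂ) {q z : ℂ} (hq : ‖q‖ < 1)
    (hz : z ∈ lambertAnnulus q) :
    Summable fun i => lambertCoeff a b s t q i * z ^ lambertExp i := by
  have hz0 : 0 < ‖z‖ := lt_of_le_of_lt (norm_nonneg _) hz.1
  refine Summable.sum _ ?_ ?_
  · have := summable_lambert_aux a b (w := z⁻¹) hq (by
      rw [norm_inv, ← div_eq_mul_inv, div_lt_one hz0]; exact hz.1) s
    refine this.congr fun x => ?_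
    simp only [Function.comp_apply, lambertCoeff, lambertExp, Sum.elim_inl]
    rw [zpow_neg, inv_pow, ← Nat.cast_one (R := ℤ), ← Nat.cast_add, zpow_natCast]
  · have := summable_lambert_aux a b (w := z) hq hz.2 t
    refine this.congr fun x => ?_
    simp only [Function.comp_apply, lambertCoeff, lambertExp, Sum.elim_inr]
    rw [← Nat.cast_one (R := ℤ), ← Nat.cast_add, zpow_natCast]

theorem hasDerivAt_lambertSum (a b : ℕ) (s t : ℂ) {q z : ℂ} (hq : ‖q‖ < 1)
    (hz : z ∈ lambertAnnulus q) :
    HasDerivAt (lambertSum a b s t q) (z⁻¹ * lambertSum a (b + 1) (-s) t q z) z := by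
  have h := (hasDerivAt_tsum_zpow (isOpen_lambertAnnulus q) (zero_notMem_lambertAnnulus q)
    (fun z hz => summable_lambert a b s t hq hz) hz).2
  have hz0 : z ≠ 0 := fun h => zero_notMem_lambertAnnulus q (h ▸ hz)
  refine h.congr_deriv ?_
  unfold lambertSum
  rw [← tsum_mul_left]
  congr 1
  funext i
  rw [zpow_sub_one₀ hz0]
  rcases i with x | x <;> simp [lambertCoeff, lambertExp] <;> ring

theorem taylor_lambertSum (a b : ℕ) (s t : ℂ) {q : ℂ} (hq : ‖q‖ < 1) (m n : ℕ) :
    HasSum (fun i => lambertCoeff a b s t q i * (Ring.choose (m + lambertExp i) n : ℤ))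
      (iteratedDeriv n (fun z => z ^ m * lambertSum a b s t q z) 1 / n.factorial) := by
  refine hasSum_taylor_tsum_zpow (isOpen_lambertAnnulus q) (zero_notMem_lambertAnnulus q)
    (one_mem_lambertAnnulus hq) (c := lambertCoeff a b s t q) (e := fun i => m + lambertExp i)
    (fun z hz => ?_) (fun z hz => ?_) n
  · have hz0 : z ≠ 0 := fun h => zero_notMem_lambertAnnulus q (h ▸ hz)
    refine ((summable_lambert a b s t hq hz).mul_left (z ^ m)).congr fun i => ?_
    rw [zpow_add₀ hz0, zpow_natCast]
    ring
  · have hz0 : z ≠ 0 := fun h => zero_notMem_lambertAnnulus q (h ▸ hz)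
    simp only [lambertSum]
    rw [← tsum_mul_left]
    congr 1
    funext i
    rw [zpow_add₀ hz0, zpow_natCast]
    ring

/-- The Taylor coefficients at `z = 1` of a Lambert series are differentiable in `q`. -/
theorem hasDerivAt_taylor_lambertSum (a b : ℕ) (s t : ℂ) {q : ℂ} (hq0 : q ≠ 0) (hq : ‖q‖ < 1)
    (n : ℕ) :
    HasDerivAt (fun q => iteratedDeriv n (lambertSum a b s t q) 1 / n.factorial)
      (q⁻¹ * (iteratedDeriv n (lambertSum (a + 1) (b + 1) s t q) 1 / n.factorial)) q := by
  have key : ∀ a b, ∀ q : ℂ, ‖q‖ < 1 →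
      HasSum (fun i => lambertCoeff a b s t q i * (Ring.choose (lambertExp i) n : ℤ))
      (iteratedDeriv n (lambertSum a b s t q) 1 / n.factorial) := fun a b q hq => by
    simpa using taylor_lambertSum a b s t hq 0 n
  -- At a fixed order in `z - 1` the coefficient is a sum of powers `q^(l k)`. Hence `q ∂_q`
  -- multiplies each term by `l k`, which raises both `a` and `b` by one.
  let N : (ℕ × ℕ) ⊕ (ℕ × ℕ) → ℤ := Sum.elim (fun x => (x.1 + 1) * (x.2 + 1))
    (fun x => (x.1 + 1) * (x.2 + 1))
  have hN : ∀ a b, ∀ q : ℂ, ∀ i, lambertCoeff a b s t q i * (Ring.choose (lambertExp i) n : ℤ)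
      = lambertCoeff a b s t 1 i * (Ring.choose (lambertExp i) n : ℤ) * q ^ N i := by
    intro a b q i
    rcases i with x | x <;> simp only [lambertCoeff, N, Sum.elim_inl, Sum.elim_inr, one_pow] <;>
    · rw [← Nat.cast_one (R := ℤ), ← Nat.cast_add, ← Nat.cast_add, ← Nat.cast_mul, zpow_natCast]
      ring
  have hU : IsOpen {q : ℂ | q ≠ 0 ∧ ‖q‖ < 1} :=
    isOpen_ne.inter (isOpen_lt continuous_norm continuous_const)
  have h := (hasDerivAt_tsum_zpow hU (by simp) (c := fun i => lambertCoeff a b s t 1 i *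
    (Ring.choose (lambertExp i) n : ℤ)) (e := N) (fun q hq => by
      simpa only [hN a b q] using (key a b q hq.2).summable) ⟨hq0, hq⟩).2
  rw [← (key _ _ q hq).tsum_eq, ← tsum_mul_left]
  refine (h.congr_of_eventuallyEq ?_).congr_deriv ?_
  rotate_left
  · congr 1
    funext i
    rw [hN (a + 1) (b + 1) q i, zpow_sub_one₀ hq0]
    rcases i with x | x <;> simp only [lambertCoeff, N, Sum.elim_inl, Sum.elim_inr, one_pow] <;>
    · rw [← Nat.cast_one (R := ℤ), ← Nat.cast_add, ← Nat.cast_add, ← Nat.cast_mul, zpow_natCast]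
      push_cast
      ring
  · filter_upwards [hU.mem_nhds ⟨hq0, hq⟩] with q' hq'
    rw [← (key _ _ q' hq'.2).tsum_eq]
    simp only [hN a b q']

end Lambert

/-! ### Fourier expansions of the Weierstrass functions and the square of `ζ̄`. -/

section Zeta

open Filter Topology

theorem hasSum_int_of_succ {f : ℤ → ℂ} {a b : ℂ} (h1 : HasSum (fun n : ℕ => f (n + 1)) a)
    (h2 : HasSum (fun n : ℕ => f (-(n + 1))) b) : HasSum f (f 0 + a + b) := by
  refine HasSum.of_nat_of_neg_add_one ?_ h2
  have := (hasSum_nat_add_iff (f := fun n : ℕ => f n) 1).1 (by simpa using h1)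
  simpa [add_comm] using this

theorem hasSum_int_ne_zero {f : ℤ → ℂ} {a b : ℂ} (h1 : HasSum (fun n : ℕ => f (n + 1)) a)
    (h2 : HasSum (fun n : ℕ => f (-(n + 1))) b) :
    HasSum (fun n : {n : ℤ // n ≠ 0} => f n) (a + b) := by
  have h3 : HasSum (fun n : ℤ => if n = 0 then 0 else f n) (a + b) := by
    have := hasSum_int_of_succ (f := fun n : ℤ => if n = 0 then 0 else f n) (a := a) (b := b)
      (by
        refine h1.congr_fun fun n => ?_
        rw [if_neg (by lia)])
      (by
        refine h2.congr_fun fun n => ?_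
        rw [if_neg (by lia)])
    simpa using this
  refine (hasSum_subtype_iff_indicator (f := f) (s := {n : ℤ | n ≠ 0})).2 ?_
  refine h3.congr_fun fun n => ?_
  by_cases hn : n = 0 <;> simp [Set.indicator, hn]

theorem hasSum_pow_succ {w : ℂ} (hw : ‖w‖ < 1) :
    HasSum (fun k : ℕ => w ^ (k + 1)) (w / (1 - w)) := by
  have := (hasSum_geometric_of_norm_lt_one hw).mul_left w
  simpa [pow_succ', div_eq_mul_inv] using this

theorem hasSum_succ_mul_pow {w : ℂ} (hw : ‖w‖ < 1) :
    HasSum (fun k : ℕ => ((k : ℂ) + 1) * w ^ (k + 1)) (w / (1 - w) ^ 2) := by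
  have h := (hasSum_choose_mul_geometric_of_norm_lt_one 1 hw).mul_left w
  have h1 : (fun k : ℕ => ((k : ℂ) + 1) * w ^ (k + 1))
      = fun k : ℕ => w * (((k + 1).choose 1 : ℕ) * w ^ k) := by
    funext k
    simp [pow_succ']
    ring
  rw [h1]
  simpa [div_eq_mul_inv] using h

/-- The one-sided Lambert series `∑ lᵃ kᵇ q^(l k) vᵏ` over `l, k ≥ 1`. -/
noncomputable def lambertHalf (a b : ℕ) (q v : ℂ) : ℂ :=
  ∑' x : ℕ × ℕ, ((x.1 : ℂ) + 1) ^ a * ((x.2 : ℂ) + 1) ^ b * q ^ ((x.1 + 1) * (x.2 + 1)) *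
    v ^ (x.2 + 1)

variable {q v z : ℂ}

theorem hasSum_lambertHalf (a b : ℕ) (hq : ‖q‖ < 1) (hv : ‖q‖ * ‖v‖ < 1) :
    HasSum (fun x : ℕ × ℕ => ((x.1 : ℂ) + 1) ^ a * ((x.2 : ℂ) + 1) ^ b *
      q ^ ((x.1 + 1) * (x.2 + 1)) * v ^ (x.2 + 1)) (lambertHalf a b q v) := by
  have := summable_lambert_aux a b hq hv 1
  simp only [one_mul] at this
  exact this.hasSum

theorem norm_inv_lt (hz : z ∈ lambertAnnulus q) : ‖q‖ * ‖z⁻¹‖ < 1 := by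
  have hz0 : 0 < ‖z‖ := lt_of_le_of_lt (norm_nonneg _) hz.1
  rw [norm_inv, ← div_eq_mul_inv, div_lt_one hz0]
  exact hz.1

theorem lambertSum_eq (a b : ℕ) (s t : ℂ) (hq : ‖q‖ < 1) (hz : z ∈ lambertAnnulus q) :
    lambertSum a b s t q z = s * lambertHalf a b q z⁻¹ + t * lambertHalf a b q z := by
  refine HasSum.tsum_eq (HasSum.sum ?_ ?_)
  · have h := (hasSum_lambertHalf a b hq (norm_inv_lt hz)).mul_left s
    refine h.congr_fun fun x => ?_
    simp only [Function.comp_apply, lambertCoeff, lambertExp, Sum.elim_inl]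
    rw [zpow_neg, inv_pow, ← Nat.cast_one (R := ℤ), ← Nat.cast_add, zpow_natCast]
    ring
  · have h := (hasSum_lambertHalf a b hq hz.2).mul_left t
    refine h.congr_fun fun x => ?_
    simp only [Function.comp_apply, lambertCoeff, lambertExp, Sum.elim_inr]
    rw [← Nat.cast_one (R := ℤ), ← Nat.cast_add, zpow_natCast]
    ring

theorem norm_pow_succ_mul_lt (hq : ‖q‖ < 1) (hv : ‖q‖ * ‖v‖ < 1) (l : ℕ) :
    ‖q ^ (l + 1) * v‖ < 1 := by
  rw [pow_succ, mul_assoc, norm_mul, norm_mul, norm_pow]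
  calc ‖q‖ ^ l * (‖q‖ * ‖v‖) ≤ 1 * (‖q‖ * ‖v‖) := by
        gcongr; exact pow_le_one₀ (norm_nonneg _) hq.le
    _ < 1 := by simpa using hv

theorem norm_pow_succ_lt (hq : ‖q‖ < 1) (l : ℕ) : ‖q ^ (l + 1)‖ < 1 := by
  rw [norm_pow]
  exact pow_lt_one₀ (norm_nonneg _) hq (by simp)

/-- Summing over `k` first gives sums over the translates `qˡ v`, as in the definitions of `ζ̄` and
`℘̄`. -/
theorem hasSum_lambertHalf_left (hq : ‖q‖ < 1) (hv : ‖q‖ * ‖v‖ < 1) :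
    HasSum (fun l : ℕ => q ^ (l + 1) * v / (1 - q ^ (l + 1) * v)) (lambertHalf 0 0 q v) := by
  refine (hasSum_lambertHalf 0 0 hq hv).prod_fiberwise fun l => ?_
  refine (hasSum_pow_succ (norm_pow_succ_mul_lt hq hv l)).congr_fun fun k => ?_
  rw [mul_pow, ← pow_mul]
  simp

theorem hasSum_lambertHalf_left' (hq : ‖q‖ < 1) (hv : ‖q‖ * ‖v‖ < 1) :
    HasSum (fun l : ℕ => q ^ (l + 1) * v / (1 - q ^ (l + 1) * v) ^ 2) (lambertHalf 0 1 q v) := by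
  refine (hasSum_lambertHalf 0 1 hq hv).prod_fiberwise fun l => ?_
  refine (hasSum_succ_mul_pow (norm_pow_succ_mul_lt hq hv l)).congr_fun fun k => ?_
  rw [mul_pow, ← pow_mul]
  simp
  ring

/-- Summing over `l` first gives the power series in `v`, hence the Fourier coefficients. -/
theorem hasSum_lambertHalf_right (b : ℕ) (hq : ‖q‖ < 1) (hv : ‖q‖ * ‖v‖ < 1) :
    HasSum (fun k : ℕ => ((k : ℂ) + 1) ^ b * v ^ (k + 1) * (q ^ (k + 1) / (1 - q ^ (k + 1))))
      (lambertHalf 0 b q v) := by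
  refine ((Equiv.prodComm ℕ ℕ).hasSum_iff.2 (hasSum_lambertHalf 0 b hq hv)).prod_fiberwise
    fun k => ?_
  refine ((hasSum_pow_succ (norm_pow_succ_lt hq k)).mul_left
    (((k : ℂ) + 1) ^ b * v ^ (k + 1))).congr_fun fun l => ?_
  rw [← pow_mul]
  simp
  ring

theorem hasSum_lambertHalf_right' (hq : ‖q‖ < 1) (hv : ‖q‖ * ‖v‖ < 1) :
    HasSum (fun k : ℕ => v ^ (k + 1) * (q ^ (k + 1) / (1 - q ^ (k + 1)) ^ 2))
      (lambertHalf 1 0 q v) := by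
  refine ((Equiv.prodComm ℕ ℕ).hasSum_iff.2 (hasSum_lambertHalf 1 0 hq hv)).prod_fiberwise
    fun k => ?_
  refine ((hasSum_succ_mul_pow (norm_pow_succ_lt hq k)).mul_left
    (v ^ (k + 1))).congr_fun fun l => ?_
  rw [← pow_mul]
  simp
  ring

theorem one_sub_ne_zero_of_norm_lt {w : ℂ} (hw : ‖w‖ < 1) : 1 - w ≠ 0 := fun h => by
  rw [← sub_eq_zero.1 h] at hw
  simp at hw

/-- Terms with `n > 0` are expanded in powers of `z`, those with `n < 0` in powers of `z⁻¹`. The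
subtracted constants become opposite for `n` and `-n` and cancel. -/
theorem zetaRegular_eq (hq0 : q ≠ 0) (hq : ‖q‖ < 1) (hz : z ∈ lambertAnnulus q) :
    zetaRegular q z = 1 / 2 + lambertSum 0 0 1 (-1) q z := by
  have hz0 : z ≠ 0 := fun h => zero_notMem_lambertAnnulus q (h ▸ hz)
  have hA := hasSum_lambertHalf_left (v := 1) hq (by simpa using hq)
  have h1 := hA.sub (hasSum_lambertHalf_left hq hz.2)
  have h2 := (hasSum_lambertHalf_left hq (norm_inv_lt hz)).sub hA
  rw [zetaRegular, lambertSum_eq _ _ _ _ hq hz]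
  congr 1
  refine HasSum.tsum_eq ?_
  have h3 := hasSum_int_ne_zero (f := fun n : ℤ => 1 / (q ^ n * z - 1) - 1 / (q ^ n - 1))
    (h1.congr_fun fun l => ?_) (h2.congr_fun fun l => ?_)
  · convert h3 using 1
    ring
  · have h4 := one_sub_ne_zero_of_norm_lt (norm_pow_succ_mul_lt hq hz.2 l)
    have h5 := one_sub_ne_zero_of_norm_lt (norm_pow_succ_lt hq l)
    rw [← Nat.cast_one (R := ℤ), ← Nat.cast_add, zpow_natCast, mul_one]
    have h4' : q ^ (l + 1) * z - 1 ≠ 0 := by rwa [← neg_sub, neg_ne_zero]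
    have h5' : q ^ (l + 1) - 1 ≠ 0 := by rwa [← neg_sub, neg_ne_zero]
    field_simp
    ring
  · have h4 := one_sub_ne_zero_of_norm_lt (norm_pow_succ_mul_lt hq (norm_inv_lt hz) l)
    have h5 := one_sub_ne_zero_of_norm_lt (norm_pow_succ_lt hq l)
    rw [zpow_neg, ← Nat.cast_one (R := ℤ), ← Nat.cast_add, zpow_natCast, mul_one]
    have hq1 : q ^ (l + 1) ≠ 0 := pow_ne_zero _ hq0
    set w := q ^ (l + 1)
    have h4' : z - w ≠ 0 := by
      intro h
      apply h4
      rw [← sub_eq_zero.1 h, mul_inv_cancel₀ hz0, sub_self]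
    rw [show w⁻¹ * z - 1 = (z - w) / w by field_simp, show w⁻¹ - 1 = (1 - w) / w by field_simp,
      show 1 - w * z⁻¹ = (z - w) / z by field_simp]
    field_simp

theorem wpRegular_eq (hq0 : q ≠ 0) (hq : ‖q‖ < 1) (hz : z ∈ lambertAnnulus q) :
    wpRegular q z = lambertSum 0 1 1 1 q z := by
  have hz0 : z ≠ 0 := fun h => zero_notMem_lambertAnnulus q (h ▸ hz)
  have h1 := hasSum_lambertHalf_left' hq hz.2
  have h2 := hasSum_lambertHalf_left' hq (norm_inv_lt hz)
  rw [wpRegular, lambertSum_eq _ _ _ _ hq hz]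
  refine HasSum.tsum_eq ?_
  have h3 := hasSum_int_ne_zero (f := fun n : ℤ => q ^ n * z / (q ^ n * z - 1) ^ 2)
    (h1.congr_fun fun l => ?_) (h2.congr_fun fun l => ?_)
  · convert h3 using 1
    ring
  · rw [← Nat.cast_one (R := ℤ), ← Nat.cast_add, zpow_natCast, ← neg_sub, neg_sq]
  · have h4 := one_sub_ne_zero_of_norm_lt (norm_pow_succ_mul_lt hq (norm_inv_lt hz) l)
    rw [zpow_neg, ← Nat.cast_one (R := ℤ), ← Nat.cast_add, zpow_natCast]
    have hq1 : q ^ (l + 1) ≠ 0 := pow_ne_zero _ hq0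
    set w := q ^ (l + 1)
    have h4' : z - w ≠ 0 := by
      intro h
      apply h4
      rw [← sub_eq_zero.1 h, mul_inv_cancel₀ hz0, sub_self]
    rw [show w⁻¹ * z - 1 = (z - w) / w by field_simp,
      show 1 - w * z⁻¹ = (z - w) / z by field_simp]
    field_simp

/-- The Fourier coefficients of `ζ̄` on the annulus `1 < |z| < 1 / |q|`. -/
noncomputable def zetaFourier (q : ℂ) (k : ℤ) : ℂ := if k = 0 then 1 / 2 else 1 / (1 - q ^ k)

theorem zetaFourier_succ (hq : ‖q‖ < 1) (n : ℕ) :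
    zetaFourier q (n + 1) = 1 + q ^ (n + 1) / (1 - q ^ (n + 1)) := by
  have h5 := one_sub_ne_zero_of_norm_lt (norm_pow_succ_lt hq n)
  rw [zetaFourier, if_neg (by lia), ← Nat.cast_one (R := ℤ), ← Nat.cast_add, zpow_natCast]
  field_simp
  ring

theorem zetaFourier_neg_succ (hq0 : q ≠ 0) (hq : ‖q‖ < 1) (n : ℕ) :
    zetaFourier q (-(n + 1)) = -(q ^ (n + 1) / (1 - q ^ (n + 1))) := by
  have h5 := one_sub_ne_zero_of_norm_lt (norm_pow_succ_lt hq n)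
  have hq1 : q ^ (n + 1) ≠ 0 := pow_ne_zero _ hq0
  rw [zetaFourier, if_neg (by lia), zpow_neg, ← Nat.cast_one (R := ℤ), ← Nat.cast_add,
    zpow_natCast]
  set w := q ^ (n + 1)
  rw [show 1 - w⁻¹ = -((1 - w) / w) by field_simp; ring]
  field_simp

theorem zpow_ne_one (hq0 : q ≠ 0) (hq : ‖q‖ < 1) {n : ℤ} (hn : n ≠ 0) : 1 - q ^ n ≠ 0 := by
  intro h
  have h1 : ‖q‖ ^ n = 1 := by rw [← norm_zpow, ← sub_eq_zero.1 h, norm_one]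
  rcases lt_or_gt_of_ne hn with h2 | h2
  · exact absurd h1 (one_lt_zpow_of_neg₀ (norm_pos_iff.2 hq0) hq h2).ne'
  · exact absurd h1 (zpow_lt_one₀ (norm_pos_iff.2 hq0) hq h2).ne

/-- The partial fraction identity behind the square of `ζ̄`. -/
theorem zetaFourier_mul (hq0 : q ≠ 0) (hq : ‖q‖ < 1) {n : ℤ} (hn : n ≠ 0) (i : ℤ) :
    zetaFourier q i * zetaFourier q (n - i)
      = zetaFourier q n * (zetaFourier q i - zetaFourier q (i - n))
        + ((if i = 0 then zetaFourier q n * (1 - zetaFourier q n) else 0)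
        + (if i = n then zetaFourier q n * (1 - zetaFourier q n) else 0)) := by
  have hn1 := zpow_ne_one hq0 hq hn
  have hqn : q ^ n ≠ 0 := zpow_ne_zero n hq0
  have hneg : zetaFourier q (-n) = 1 - zetaFourier q n := by
    rw [zetaFourier, zetaFourier, if_neg hn, if_neg (by lia), zpow_neg]
    set w := q ^ n
    have : w - 1 ≠ 0 := by rwa [← neg_sub, neg_ne_zero]
    rw [show 1 - w⁻¹ = (w - 1) / w by field_simp]
    field_simp
    ring
  have h0 : zetaFourier q 0 = 1 / 2 := by simp [zetaFourier]
  -- The coefficient at `0` is `1/2` and not of the form `1 / (1 - qᵏ)`; the two delta terms correct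
  -- for this at `i = 0` and `i = n`. Otherwise the claim is an identity of rational functions in
  -- `qⁱ` and `qⁿ`.
  by_cases hi : i = 0
  · subst hi
    rw [if_pos rfl, if_neg hn.symm, sub_zero, zero_sub, hneg, h0]
    ring
  by_cases hi' : i = n
  · subst hi'
    rw [if_pos rfl, if_neg hn, sub_self, h0]
    ring
  · rw [if_neg hi, if_neg hi']
    simp only [zetaFourier, if_neg hi, if_neg hn, if_neg (sub_ne_zero.2 hi'),
      if_neg (sub_ne_zero.2 (Ne.symm hi'))]
    have h1 := zpow_ne_one hq0 hq hi
    have h2 := zpow_ne_one hq0 hq (sub_ne_zero.2 hi')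
    have h3 := zpow_ne_one hq0 hq (sub_ne_zero.2 (Ne.symm hi'))
    rw [zpow_sub₀ hq0] at h2 h3 ⊢
    rw [zpow_sub₀ hq0]
    have hqi : q ^ i ≠ 0 := zpow_ne_zero i hq0
    set u := q ^ i
    set w := q ^ n
    have h4 : u - w ≠ 0 := by
      intro h; apply h2; rw [sub_eq_zero.1 h, div_self hqn, sub_self]
    have h5 : w - u ≠ 0 := by rwa [← neg_sub, neg_ne_zero]
    rw [show 1 - w / u = -(w - u) / u by field_simp; ring,
      show 1 - u / w = (w - u) / w by field_simp]
    field_simp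
    ring

/-- Up to a summable error `g` is the indicator function of the positive integers, and a unit shift
of that step has total difference `1`. General `n` follows by telescoping. -/
theorem hasSum_sub_shift {g : ℤ → ℂ} (hg : Summable fun i => g i - if 0 < i then 1 else 0) (n : ℤ) :
    HasSum (fun i => g i - g (i - n)) n := by
  have h1 : HasSum (fun i => g i - g (i - 1)) 1 := by
    have h2 := hg.hasSum.sub ((Equiv.subRight (1 : ℤ)).hasSum_iff.2 hg.hasSum)
    rw [sub_self] at h2
    have h3 := h2.add (hasSum_ite_eq (1 : ℤ) (1 : ℂ))
    rw [zero_add] at h3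
    refine h3.congr_fun fun i => ?_
    simp only [Function.comp_apply, Equiv.subRight_apply]
    rcases lt_trichotomy i 1 with h | h | h
    · rw [if_neg (by lia), if_neg (by lia), if_neg (by lia)]; ring
    · subst h; simp; ring
    · rw [if_pos (by lia), if_pos (by lia), if_neg (by lia)]; ring
  induction n using Int.induction_on with
  | zero => simp
  | succ n ih =>
    have h2 := ih.add ((Equiv.subRight (n : ℤ)).hasSum_iff.2 h1)
    push_cast at h2 ⊢
    refine h2.congr_fun fun i => ?_
    simp only [Function.comp_apply, Equiv.subRight_apply]
    rw [show i - ((n : ℤ) + 1) = i - n - 1 by ring]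
    ring
  | pred n ih =>
    have h2 := ih.sub ((Equiv.subRight (-(n : ℤ) - 1)).hasSum_iff.2 h1)
    push_cast at h2 ⊢
    refine h2.congr_fun fun i => ?_
    simp only [Function.comp_apply, Equiv.subRight_apply]
    rw [show i - (-(n : ℤ) - 1) - 1 = i - -n by ring]
    ring

/-- With `c = 1 / (1 - qⁿ)`, the shifted difference in the partial fraction identity sums to `n` and
contributes `n c`, the Fourier coefficient of `℘̄`. The two exceptional terms contribute `2 c (1 -
c) = -2 qⁿ / (1 - qⁿ)²`, that of `G`. -/
theorem hasSum_zetaFourier_conv (hq0 : q ≠ 0) (hq : ‖q‖ < 1) {n : ℤ} (hn : n ≠ 0) :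
    HasSum (fun i => zetaFourier q i * zetaFourier q (n - i))
      (zetaFourier q n * (n + 2 - 2 * zetaFourier q n)) := by
  have h1 : Summable fun i => zetaFourier q i - if 0 < i then 1 else 0 := by
    have hA := hasSum_lambertHalf_right (v := 1) 0 hq (by simpa using hq)
    refine (hasSum_int_of_succ (hA.congr_fun fun n => ?_) (hA.neg.congr_fun fun n => ?_)).summable
    · rw [if_pos (by lia), zetaFourier_succ hq]
      simp
    · rw [if_neg (by lia), zetaFourier_neg_succ hq0 hq]
      simp
  have h2 := ((hasSum_sub_shift h1 n).mul_left (zetaFourier q n)).add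
    ((hasSum_ite_eq (0 : ℤ) (zetaFourier q n * (1 - zetaFourier q n))).add
      (hasSum_ite_eq n (zetaFourier q n * (1 - zetaFourier q n))))
  simp only [← zetaFourier_mul hq0 hq hn] at h2
  rwa [show zetaFourier q n * (n + 2 - 2 * zetaFourier q n) = zetaFourier q n * n +
    (zetaFourier q n * (1 - zetaFourier q n) + zetaFourier q n * (1 - zetaFourier q n)) by ring]

/-- The constant Fourier coefficient of `ζ̄² - ℘̄`. -/
noncomputable def zetaSqConst (q : ℂ) : ℂ := ∑' i : ℤ, zetaFourier q i * zetaFourier q (0 - i)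

/-- The identity `ζ̄² = ℘̄ + G`, with a Lambert series `G`, on the outer annulus. -/
theorem zeta_sq_outer (hq0 : q ≠ 0) (hq : ‖q‖ < 1) (hz1 : 1 < ‖z‖) (hz2 : ‖q‖ * ‖z‖ < 1) :
    (1 / (z - 1) + zetaRegular q z) ^ 2 = z / (z - 1) ^ 2 + wpRegular q z
      + (zetaSqConst q + lambertSum 1 0 (-2) (-2) q z) := by
  have hz : z ∈ lambertAnnulus q := ⟨hq.trans hz1, hz2⟩
  have hz0 : z ≠ 0 := fun h => zero_notMem_lambertAnnulus q (h ▸ hz)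
  have hzi : ‖z⁻¹‖ < 1 := by rw [norm_inv]; exact inv_lt_one_of_one_lt₀ hz1
  have hzi' := norm_inv_lt hz
  have hz3 : z - 1 ≠ 0 := fun h => by rw [sub_eq_zero.1 h] at hz1; simp at hz1
  rw [zetaRegular_eq hq0 hq hz, wpRegular_eq hq0 hq hz]
  -- Outside the unit circle `1 / (z - 1)` expands in powers of `z⁻¹`, so `ζ̄` including its pole is
  -- one absolutely convergent series that can be squared.
  have hv : HasSum (fun k : ℤ => zetaFourier q k * z ^ (-k))
      (1 / (z - 1) + (1 / 2 + lambertSum 0 0 1 (-1) q z)) := by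
    have h1 := (hasSum_pow_succ hzi).add (hasSum_lambertHalf_right 0 hq hzi')
    have h2 := (hasSum_lambertHalf_right 0 hq hz2).neg
    have h3 := hasSum_int_of_succ (f := fun k : ℤ => zetaFourier q k * z ^ (-k))
      (h1.congr_fun fun n => ?_) (h2.congr_fun fun n => ?_)
    · convert h3 using 1
      rw [lambertSum_eq _ _ _ _ hq hz]
      simp only [zetaFourier, if_true, neg_zero, zpow_zero]
      rw [show 1 - z⁻¹ = (z - 1) / z by field_simp]
      field_simp
      ring
    · rw [zetaFourier_succ hq, zpow_neg, ← Nat.cast_one (R := ℤ), ← Nat.cast_add, zpow_natCast,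
        inv_pow]
      simp
      ring
    · rw [zetaFourier_neg_succ hq0 hq, neg_neg, ← Nat.cast_one (R := ℤ), ← Nat.cast_add,
        zpow_natCast]
      simp
      ring
  have hn := hv.summable.norm
  have hsq := (summable_mul_of_summable_norm hn hn).hasSum
  rw [← tsum_mul_tsum_of_summable_norm hn hn, hv.tsum_eq] at hsq
  -- The pair `(n, i)` corresponds to the pair of indices `(i, n - i)`, so the double series is
  -- collected by powers of `z`.
  let e : ℤ × ℤ ≃ ℤ × ℤ :=
    { toFun := fun x => (x.2, x.1 - x.2)
      invFun := fun x => (x.1 + x.2, x.1)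
      left_inv := fun x => by simp
      right_inv := fun x => by simp }
  have hsq2 := e.hasSum_iff.2 hsq
  have hfib : ∀ n : ℤ, HasSum (fun i => ((fun x : ℤ × ℤ => zetaFourier q x.1 * z ^ (-x.1) *
      (zetaFourier q x.2 * z ^ (-x.2))) ∘ e) (n, i)) ((if n = 0 then zetaSqConst q else
        zetaFourier q n * (n + 2 - 2 * zetaFourier q n)) * z ^ (-n)) := by
    intro n
    have h4 : ∀ i, ((fun x : ℤ × ℤ => zetaFourier q x.1 * z ^ (-x.1) *
      (zetaFourier q x.2 * z ^ (-x.2))) ∘ e) (n, i)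
      = zetaFourier q i * zetaFourier q (n - i) * z ^ (-n) := by
      intro i
      simp only [Function.comp_apply, e, Equiv.coe_fn_mk]
      rw [show -n = -i + -(n - i) by ring, zpow_add₀ hz0]
      ring
    simp only [h4]
    split_ifs with hn0
    · subst hn0
      have h5 := hsq2.summable.prod_factor 0
      simp only [h4] at h5
      simp only [neg_zero, zpow_zero, mul_one] at h5 ⊢
      exact h5.hasSum
    · exact (hasSum_zetaFourier_conv hq0 hq hn0).mul_right _
  have htot := hsq2.prod_fiberwise hfib
  have h1 := ((hasSum_succ_mul_pow hzi).add (hasSum_lambertHalf_right 1 hq hzi')).sub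
    ((hasSum_lambertHalf_right' hq hzi').mul_left 2)
  have h2 := (hasSum_lambertHalf_right 1 hq hz2).sub ((hasSum_lambertHalf_right' hq hz2).mul_left 2)
  have h3 := hasSum_int_of_succ (f := fun n : ℤ => (if n = 0 then zetaSqConst q else
        zetaFourier q n * (n + 2 - 2 * zetaFourier q n)) * z ^ (-n))
      (h1.congr_fun fun n => ?_) (h2.congr_fun fun n => ?_)
  · rw [sq, htot.unique h3, lambertSum_eq _ _ _ _ hq hz, lambertSum_eq _ _ _ _ hq hz]
    simp only [if_true, neg_zero, zpow_zero]
    rw [show 1 - z⁻¹ = (z - 1) / z by field_simp]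
    field_simp
    ring
  · have h5 := one_sub_ne_zero_of_norm_lt (norm_pow_succ_lt hq n)
    rw [if_neg (by lia), zetaFourier_succ hq, zpow_neg, ← Nat.cast_one (R := ℤ), ← Nat.cast_add,
      zpow_natCast, inv_pow]
    push_cast
    field_simp
    ring
  · have h5 := one_sub_ne_zero_of_norm_lt (norm_pow_succ_lt hq n)
    rw [if_neg (by lia), zetaFourier_neg_succ hq0 hq, neg_neg, ← Nat.cast_one (R := ℤ),
      ← Nat.cast_add, zpow_natCast]
    push_cast
    field_simp
    ring

end Zeta

/-! ### Laurent series at `z = 1` and the differential identity for `ζ̄`. -/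

section Taylor

open Filter Topology

theorem taylorAtOne_coeff_natCast (f : ℂ → ℂ) (n : ℕ) :
    (taylorAtOne f).coeff n = iteratedDeriv n f 1 / n.factorial := by
  rw [taylorAtOne, HahnSeries.ofPowerSeries_apply_coeff, PowerSeries.coeff_mk]

theorem taylorAtOne_coeff_of_neg (f : ℂ → ℂ) {n : ℤ} (hn : n < 0) :
    (taylorAtOne f).coeff n = 0 := by
  rw [taylorAtOne]
  have := PowerSeries.coeff_coe (R := ℂ) (f := PowerSeries.mk fun n => iteratedDeriv n f 1 /
    (n.factorial : ℂ)) n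
  rw [if_pos hn] at this
  exact this

theorem taylorAtOne_ext {f g : ℂ → ℂ} (h : ∀ n : ℕ, iteratedDeriv n f 1 = iteratedDeriv n g 1) :
    taylorAtOne f = taylorAtOne g := by
  rw [taylorAtOne, taylorAtOne]
  simp only [h]

theorem taylorAtOne_congr {f g : ℂ → ℂ} (h : f =ᶠ[𝓝 1] g) : taylorAtOne f = taylorAtOne g :=
  taylorAtOne_ext fun n => h.iteratedDeriv_eq n

theorem taylorAtOne_add {f g : ℂ → ℂ} (hf : AnalyticAt ℂ f 1) (hg : AnalyticAt ℂ g 1) :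
    taylorAtOne (fun z => f z + g z) = taylorAtOne f + taylorAtOne g := by
  rw [taylorAtOne, taylorAtOne, taylorAtOne, ← map_add]
  congr 1
  ext n
  have h := iteratedDeriv_fun_add (n := n) (x := (1 : ℂ)) hf.contDiffAt hg.contDiffAt
  simp [h, add_div]

theorem taylorAtOne_mul {f g : ℂ → ℂ} (hf : AnalyticAt ℂ f 1) (hg : AnalyticAt ℂ g 1) :
    taylorAtOne (fun z => f z * g z) = taylorAtOne f * taylorAtOne g := by
  rw [taylorAtOne, taylorAtOne, taylorAtOne, ← map_mul]
  congr 1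
  ext n
  have h := iteratedDeriv_fun_mul (n := n) (x := (1 : ℂ)) hf.contDiffAt hg.contDiffAt
  rw [PowerSeries.coeff_mk, h, PowerSeries.coeff_mul,
      Finset.Nat.sum_antidiagonal_eq_sum_range_succ_mk,
    Finset.sum_div]
  refine Finset.sum_congr rfl fun i hi => ?_
  have hi' : i ≤ n := by simp at hi; lia
  simp only [PowerSeries.coeff_mk]
  rw [Nat.cast_choose ℂ hi']
  have h1 : (n.factorial : ℂ) ≠ 0 := by exact_mod_cast n.factorial_ne_zero
  field_simp

theorem taylorAtOne_const (c : ℂ) : taylorAtOne (fun _ => c) = HahnSeries.C c := by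
  rw [taylorAtOne, ← PowerSeries.coe_C]
  congr 1
  ext n
  rcases n with _ | n <;> simp [PowerSeries.coeff_C, iteratedDeriv_const]

theorem taylorAtOne_id : taylorAtOne (fun z => z) = xSeries := by
  rw [taylorAtOne, xSeries, ← PowerSeries.coe_X, ← PowerSeries.coe_one, ← PowerSeries.coe_add]
  congr 1
  ext n
  rcases n with _ | _ | n
  · simp
  · simp [PowerSeries.coeff_one]
  · have : iteratedDeriv (n + 1 + 1) (fun z : ℂ => z) 1 = 0 := by
      rw [iteratedDeriv_succ', iteratedDeriv_succ']
      simp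
    simp [this, PowerSeries.coeff_one, PowerSeries.coeff_X]

theorem taylorAtOne_pow_mul (m : ℕ) {f : ℂ → ℂ} (hf : AnalyticAt ℂ f 1) :
    taylorAtOne (fun z => z ^ m * f z) = xSeries ^ m * taylorAtOne f := by
  induction m with
  | zero => simp
  | succ m ih =>
    have := taylorAtOne_mul (f := fun z => z) (g := fun z => z ^ m * f z) (by fun_prop)
        (by fun_prop)
    rw [pow_succ', mul_assoc, ← ih, ← taylorAtOne_id, ← this]
    simp only [pow_succ', mul_assoc]

/-- The derivation `z d/dz` of the field of Laurent series at `z = 1`. -/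
noncomputable def laurentD (g : HahnSeries ℤ ℂ) : HahnSeries ℤ ℂ :=
  xSeries * LaurentSeries.derivative ℂ g

theorem derivative_coeff (g : HahnSeries ℤ ℂ) (n : ℤ) :
    (LaurentSeries.derivative ℂ g).coeff n = ((n : ℂ) + 1) * g.coeff (n + 1) := by
  rw [LaurentSeries.derivative_apply, LaurentSeries.hasseDeriv_coeff]
  simp

theorem taylorAtOne_deriv (f : ℂ → ℂ) :
    taylorAtOne (deriv f) = LaurentSeries.derivative ℂ (taylorAtOne f) := by
  ext n
  rw [derivative_coeff]
  rcases lt_or_ge n 0 with hn | hn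
  · rw [taylorAtOne_coeff_of_neg _ hn]
    rcases eq_or_ne n (-1) with rfl | hn1
    · simp
    · rw [taylorAtOne_coeff_of_neg _ (by lia), mul_zero]
  · lift n to ℕ using hn
    have := taylorAtOne_coeff_natCast f (n + 1)
    push_cast at this
    rw [taylorAtOne_coeff_natCast, this, ← iteratedDeriv_succ', Nat.factorial_succ]
    have h1 : (n.factorial : ℂ) ≠ 0 := by exact_mod_cast n.factorial_ne_zero
    have h2 : (n : ℂ) + 1 ≠ 0 := by exact_mod_cast Nat.succ_ne_zero n
    push_cast
    field_simp

theorem single_mul_derivative_coeff (g : HahnSeries ℤ ℂ) (n : ℤ) :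
    (HahnSeries.single 1 1 * LaurentSeries.derivative ℂ g).coeff n = n * g.coeff n := by
  have := HahnSeries.coeff_single_mul_add (r := (1 : ℂ)) (x := LaurentSeries.derivative ℂ g)
    (a := n - 1) (b := 1)
  rw [sub_add_cancel] at this
  rw [this, derivative_coeff]
  simp

/-- With `t = z - 1`, the operator `t d/dt` multiplies the `n`-th coefficient by `n`, and `n = i +
j` in each term of a product. The factor `t` is cancelled at the end. -/
theorem derivative_mul (f g : HahnSeries ℤ ℂ) : LaurentSeries.derivative ℂ (f * g)
    = LaurentSeries.derivative ℂ f * g + f * LaurentSeries.derivative ℂ g := by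
  have hx : (HahnSeries.single 1 1 : HahnSeries ℤ ℂ) ≠ 0 := by simp
  apply mul_left_cancel₀ hx
  ext n
  rw [single_mul_derivative_coeff, mul_add, ← mul_assoc, mul_left_comm _ f, HahnSeries.coeff_add]
  have hf : (HahnSeries.single 1 1 * LaurentSeries.derivative ℂ f).support ⊆ f.support := by
    intro i hi hc
    exact hi (by rw [single_mul_derivative_coeff, hc, mul_zero])
  have hg : (HahnSeries.single 1 1 * LaurentSeries.derivative ℂ g).support ⊆ g.support := by
    intro i hi hc
    exact hi (by rw [single_mul_derivative_coeff, hc, mul_zero])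
  rw [HahnSeries.coeff_mul, HahnSeries.coeff_mul_left' f.isPWO_support hf,
    HahnSeries.coeff_mul_right' g.isPWO_support hg, Finset.mul_sum, ← Finset.sum_add_distrib]
  refine Finset.sum_congr rfl fun ij hij => ?_
  rw [single_mul_derivative_coeff, single_mul_derivative_coeff]
  have : ij.1 + ij.2 = n := by simp at hij; exact hij.2.2
  rw [← this]
  push_cast
  ring

theorem laurentD_mul (f g : HahnSeries ℤ ℂ) :
    laurentD (f * g) = laurentD f * g + f * laurentD g := by
  rw [laurentD, laurentD, laurentD, derivative_mul]
  ring

theorem laurentD_add (f g : HahnSeries ℤ ℂ) : laurentD (f + g) = laurentD f + laurentD g := by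
  rw [laurentD, laurentD, laurentD, map_add, mul_add]

theorem laurentD_neg (f : HahnSeries ℤ ℂ) : laurentD (-f) = -laurentD f := by
  rw [laurentD, laurentD, map_neg]
  ring

theorem laurentD_taylorAtOne {f g : ℂ → ℂ} (hf : AnalyticAt ℂ f 1)
    (hg : g =ᶠ[𝓝 1] fun z => z * deriv f z) : laurentD (taylorAtOne f) = taylorAtOne g := by
  rw [taylorAtOne_congr hg, taylorAtOne_mul (f := fun z => z) (by fun_prop) hf.deriv,
    taylorAtOne_id, taylorAtOne_deriv, laurentD]

theorem xSeries_ne_zero : xSeries ≠ 0 := fun h => by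
  have := congrArg (fun f : HahnSeries ℤ ℂ => f.coeff 0) h
  simp [xSeries] at this

variable {q : ℂ}

theorem analyticAt_lambertSum (a b : ℕ) (s t : ℂ) (hq : ‖q‖ < 1) {z : ℂ}
    (hz : z ∈ lambertAnnulus q) : AnalyticAt ℂ (lambertSum a b s t q) z := by
  have h : DifferentiableOn ℂ (lambertSum a b s t q) (lambertAnnulus q) := fun z hz =>
    (hasDerivAt_lambertSum a b s t hq hz).differentiableAt.differentiableWithinAt
  exact h.analyticAt ((isOpen_lambertAnnulus q).mem_nhds hz)

theorem laurentD_taylor_lambertSum (a b : ℕ) (s t : ℂ) (hq : ‖q‖ < 1) :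
    laurentD (taylorAtOne (lambertSum a b s t q))
      = taylorAtOne (lambertSum a (b + 1) (-s) t q) := by
  refine laurentD_taylorAtOne (analyticAt_lambertSum a b s t hq (one_mem_lambertAnnulus hq)) ?_
  filter_upwards [(isOpen_lambertAnnulus q).mem_nhds (one_mem_lambertAnnulus hq)] with z hz
  have hz0 : z ≠ 0 := fun h => zero_notMem_lambertAnnulus q (h ▸ hz)
  rw [(hasDerivAt_lambertSum a b s t hq hz).deriv]
  field_simp

theorem lambertSum_neg (a b : ℕ) (s t z : ℂ) :
    lambertSum a b (-s) (-t) q z = -lambertSum a b s t q z := by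
  rw [lambertSum, lambertSum, ← tsum_neg]
  congr 1
  funext i
  rcases i with x | x <;> simp [lambertCoeff]

theorem lambertSum_smul (a b : ℕ) (c s t z : ℂ) :
    lambertSum a b (c * s) (c * t) q z = c * lambertSum a b s t q z := by
  rw [lambertSum, lambertSum, ← tsum_mul_left]
  congr 1
  funext i
  rcases i with x | x <;> simp [lambertCoeff] <;> ring

theorem zetaSeries_eq (hq0 : q ≠ 0) (hq : ‖q‖ < 1) : zetaSeries q = HahnSeries.single (-1) 1 +
    (HahnSeries.C (1 / 2) + taylorAtOne (lambertSum 0 0 1 (-1) q)) := by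
  rw [zetaSeries, ← taylorAtOne_const, ← taylorAtOne_add (by fun_prop)
    (analyticAt_lambertSum _ _ _ _ hq (one_mem_lambertAnnulus hq))]
  congr 1
  apply taylorAtOne_congr
  filter_upwards [(isOpen_lambertAnnulus q).mem_nhds (one_mem_lambertAnnulus hq)] with z hz
  exact zetaRegular_eq hq0 hq hz

theorem wpSeries_eq (hq0 : q ≠ 0) (hq : ‖q‖ < 1) : wpSeries q = HahnSeries.single (-2) 1 +
    HahnSeries.single (-1) 1 + taylorAtOne (lambertSum 0 1 1 1 q) := by
  rw [wpSeries]
  congr 1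
  apply taylorAtOne_congr
  filter_upwards [(isOpen_lambertAnnulus q).mem_nhds (one_mem_lambertAnnulus hq)] with z hz
  exact wpRegular_eq hq0 hq hz

theorem derivative_single_neg_one : LaurentSeries.derivative ℂ (HahnSeries.single (-1) (1 : ℂ)) =
    -HahnSeries.single (-2) 1 := by
  ext n
  rw [derivative_coeff, HahnSeries.coeff_neg]
  rcases eq_or_ne n (-2) with rfl | hn
  · simp
    norm_num
  · rw [HahnSeries.coeff_single_of_ne (by lia), HahnSeries.coeff_single_of_ne hn]
    simp

theorem laurentD_C (c : ℂ) : laurentD (HahnSeries.C c) = 0 := by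
  have : LaurentSeries.derivative ℂ (HahnSeries.C c) = 0 := by
    ext n
    rw [derivative_coeff]
    rcases eq_or_ne n (-1) with rfl | hn
    · simp
    · rw [HahnSeries.C_apply, HahnSeries.coeff_single_of_ne (by lia)]
      simp
  rw [laurentD, this, mul_zero]

/-- `℘̄ = -z ζ̄'`. -/
theorem laurentD_zetaSeries (hq0 : q ≠ 0) (hq : ‖q‖ < 1) :
    laurentD (zetaSeries q) = -wpSeries q := by
  rw [zetaSeries_eq hq0 hq, wpSeries_eq hq0 hq, laurentD_add, laurentD_add, laurentD_C,
    laurentD_taylor_lambertSum _ _ _ _ hq, zero_add]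
  have h1 : taylorAtOne (lambertSum 0 1 1 1 q) =
      -taylorAtOne (lambertSum 0 (0 + 1) (-1) (-1) q) := by
    rw [taylorAtOne, taylorAtOne, ← map_neg]
    congr 1
    ext n
    have : lambertSum 0 1 1 1 q = fun z => -lambertSum 0 (0 + 1) (-1) (-1) q z := by
      funext z
      rw [lambertSum_neg]
      simp
    rw [this]
    simp [iteratedDeriv_fun_neg, neg_div]
  rw [h1, laurentD, derivative_single_neg_one, xSeries]
  have h2 : (HahnSeries.single 1 1 : HahnSeries ℤ ℂ) * HahnSeries.single (-2) 1
      = HahnSeries.single (-1) 1 := by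
    rw [HahnSeries.single_mul_single]; norm_num
  linear_combination -h2

/-- The regular part `G` of `ζ̄²`. -/
noncomputable def zetaSqRegular (q z : ℂ) : ℂ := zetaSqConst q + lambertSum 1 0 (-2) (-2) q z

/-- Subtracting `z / (z - 1)²` from `ζ̄²` leaves a simple pole, so after multiplication by `z - 1`
both sides are analytic near `1`. They agree where `|z| > 1` by `zeta_sq_outer`, hence on a whole
disc by the identity theorem. -/
theorem zeta_sq_near_one (hq0 : q ≠ 0) (hq : ‖q‖ < 1) :
    (fun z => (2 * zetaRegular q z - 1) + (z - 1) * zetaRegular q z ^ 2) =ᶠ[𝓝 1]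
      fun z => (z - 1) * (wpRegular q z + zetaSqRegular q z) := by
  let R : ℂ → ℂ := fun z => 1 / 2 + lambertSum 0 0 1 (-1) q z
  let F : ℂ → ℂ := fun z => (2 * R z - 1) + (z - 1) * R z ^ 2
  let G : ℂ → ℂ := fun z => (z - 1) * (lambertSum 0 1 1 1 q z + zetaSqRegular q z)
  obtain ⟨r, hr, hball⟩ := Metric.isOpen_iff.1 (isOpen_lambertAnnulus q) 1
      (one_mem_lambertAnnulus hq)
  have hL : ∀ a b s t, AnalyticOnNhd ℂ (lambertSum a b s t q) (Metric.ball 1 r) :=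
    fun a b s t z hz => analyticAt_lambertSum a b s t hq (hball hz)
  have hR : AnalyticOnNhd ℂ R (Metric.ball 1 r) := fun z hz =>
    analyticAt_const.add (hL 0 0 1 (-1) z hz)
  have hid : AnalyticOnNhd ℂ (fun z : ℂ => z - 1) (Metric.ball 1 r) := fun z _ => by fun_prop
  have hF : AnalyticOnNhd ℂ F (Metric.ball 1 r) := fun z hz =>
    ((analyticAt_const.mul (hR z hz)).sub analyticAt_const).add ((hid z hz).mul ((hR z hz).pow 2))
  have hG : AnalyticOnNhd ℂ G (Metric.ball 1 r) := fun z hz =>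
    (hid z hz).mul ((hL 0 1 1 1 z hz).add (analyticAt_const.add (hL 1 0 (-2) (-2) z hz)))
  have hz₀ : (1 + r / 2 : ℂ) ∈ Metric.ball (1 : ℂ) r := by
    rw [mem_ball_iff_norm, add_sub_cancel_left, ← Complex.ofReal_ofNat, ← Complex.ofReal_div,
      Complex.norm_real, Real.norm_of_nonneg (by positivity)]
    linarith
  have hz₁ : 1 < ‖(1 + r / 2 : ℂ)‖ := by
    rw [← Complex.ofReal_ofNat, ← Complex.ofReal_div, ← Complex.ofReal_one, ← Complex.ofReal_add,
      Complex.norm_real, Real.norm_of_nonneg (by positivity)]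
    linarith
  have hnear : F =ᶠ[𝓝 (1 + r / 2 : ℂ)] G := by
    have h1 : {z : ℂ | 1 < ‖z‖} ∈ 𝓝 (1 + r / 2 : ℂ) :=
      (isOpen_lt continuous_const continuous_norm).mem_nhds hz₁
    filter_upwards [h1, Metric.isOpen_ball.mem_nhds hz₀] with z hz hz'
    have h2 := zeta_sq_outer hq0 hq hz (hball hz').2
    rw [zetaRegular_eq hq0 hq (hball hz'), wpRegular_eq hq0 hq (hball hz')] at h2
    have hz3 : z - 1 ≠ 0 := fun h => by
      change 1 < ‖z‖ at hz
      rw [sub_eq_zero.1 h] at hz; simp at hz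
    simp only [F, G, R, zetaSqRegular]
    field_simp at h2
    have h4 : (z - 1) * (2 * (1 / 2 + lambertSum 0 0 1 (-1) q z) - 1 +
        (z - 1) * (1 / 2 + lambertSum 0 0 1 (-1) q z) ^ 2) = (z - 1) * ((z - 1) *
        (lambertSum 0 1 1 1 q z + (zetaSqConst q + lambertSum 1 0 (-2) (-2) q z))) := by
      linear_combination h2 / 4
    exact mul_left_cancel₀ hz3 h4
  have heq := hF.eqOn_of_preconnected_of_eventuallyEq hG (convex_ball _ _).isPreconnected hz₀ hnear
  filter_upwards [Metric.ball_mem_nhds 1 hr] with z hz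
  have := heq hz
  simp only [F, G, R] at this
  rw [zetaRegular_eq hq0 hq (hball hz), wpRegular_eq hq0 hq (hball hz), this]

theorem zetaSeries_sq (hq0 : q ≠ 0) (hq : ‖q‖ < 1) :
    zetaSeries q * zetaSeries q = wpSeries q + taylorAtOne (zetaSqRegular q) := by
  have hL : ∀ a b s t, AnalyticAt ℂ (lambertSum a b s t q) 1 :=
    fun a b s t => analyticAt_lambertSum a b s t hq (one_mem_lambertAnnulus hq)
  have hev := (isOpen_lambertAnnulus q).mem_nhds (one_mem_lambertAnnulus hq)
  have hR : AnalyticAt ℂ (zetaRegular q) 1 := (analyticAt_const.add (hL 0 0 1 (-1))).congr (by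
    filter_upwards [hev] with z hz using (zetaRegular_eq hq0 hq hz).symm)
  have hS : AnalyticAt ℂ (wpRegular q) 1 := (hL 0 1 1 1).congr (by
    filter_upwards [hev] with z hz using (wpRegular_eq hq0 hq hz).symm)
  have hG : AnalyticAt ℂ (zetaSqRegular q) 1 := analyticAt_const.add (hL 1 0 (-2) (-2))
  have hx : taylorAtOne (fun z => z - 1) = HahnSeries.single 1 1 := by
    have := taylorAtOne_add (f := fun z => z) (g := fun _ => (-1 : ℂ)) (by fun_prop) (by fun_prop)
    simp only [sub_eq_add_neg]
    rw [this, taylorAtOne_id, taylorAtOne_const, xSeries]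
    simp
  have h := taylorAtOne_congr (zeta_sq_near_one hq0 hq)
  have e1 : taylorAtOne (fun z => (2 * zetaRegular q z - 1) + (z - 1) * zetaRegular q z ^ 2)
      = (HahnSeries.C 2 * taylorAtOne (zetaRegular q) + HahnSeries.C (-1)) +
        HahnSeries.single 1 1 * (taylorAtOne (zetaRegular q) * taylorAtOne (zetaRegular q)) := by
    rw [← taylorAtOne_const, ← taylorAtOne_const, ← hx, ← taylorAtOne_mul hR hR,
      ← taylorAtOne_mul (f := fun z => z - 1) (g := fun z => zetaRegular q z * zetaRegular q z)
        (by fun_prop) (hR.mul hR), ← taylorAtOne_mul (f := fun _ => 2) (by fun_prop) hR,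
      ← taylorAtOne_add (f := fun z => 2 * zetaRegular q z) (g := fun _ => -1) (by fun_prop)
        (by fun_prop), ← taylorAtOne_add (f := fun z => 2 * zetaRegular q z + -1)
        (g := fun z => (z - 1) * (zetaRegular q z * zetaRegular q z)) (by fun_prop) (by fun_prop)]
    congr 1
    funext z
    ring
  have e2 : taylorAtOne (fun z => (z - 1) * (wpRegular q z + zetaSqRegular q z))
      = HahnSeries.single 1 1 * (taylorAtOne (wpRegular q) + taylorAtOne (zetaSqRegular q)) := by
    rw [← hx, ← taylorAtOne_add hS hG, ← taylorAtOne_mul (f := fun z => z - 1)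
      (g := fun z => wpRegular q z + zetaSqRegular q z) (by fun_prop) (by fun_prop)]
  rw [e1, e2] at h
  have h11 : (HahnSeries.single 1 1 : HahnSeries ℤ ℂ) * HahnSeries.single (-1) 1 = 1 := by
    rw [HahnSeries.single_mul_single]; simp
  have h12 : (HahnSeries.single 1 1 : HahnSeries ℤ ℂ) * HahnSeries.single (-2) 1
      = HahnSeries.single (-1) 1 := by
    rw [HahnSeries.single_mul_single]; norm_num
  have hC2 : (HahnSeries.C 2 : HahnSeries ℤ ℂ) = 2 := map_ofNat _ 2
  have hC1 : (HahnSeries.C (-1) : HahnSeries ℤ ℂ) = -1 := by simp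
  rw [hC2, hC1] at h
  have hx0 : (HahnSeries.single 1 1 : HahnSeries ℤ ℂ) ≠ 0 := by simp
  apply mul_left_cancel₀ hx0
  rw [zetaSeries, wpSeries]
  linear_combination h + (HahnSeries.single (-1) 1 + 2 * taylorAtOne
      (zetaRegular q) - 1) * h11 - h12

/-- The series `½ z dG/dz = q dζ̄/dq`. -/
noncomputable def zetaQDeriv (q : ℂ) : HahnSeries ℤ ℂ := taylorAtOne (lambertSum 1 1 1 (-1) q)

theorem laurentD_zetaSqRegular (hq : ‖q‖ < 1) :
    laurentD (taylorAtOne (zetaSqRegular q)) = HahnSeries.C 2 * zetaQDeriv q := by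
  have hL : ∀ a b s t, AnalyticAt ℂ (lambertSum a b s t q) 1 :=
    fun a b s t => analyticAt_lambertSum a b s t hq (one_mem_lambertAnnulus hq)
  unfold zetaSqRegular
  rw [taylorAtOne_add analyticAt_const (hL _ _ _ _), laurentD_add, taylorAtOne_const, laurentD_C,
    laurentD_taylor_lambertSum _ _ _ _ hq, zero_add, zetaQDeriv, ← taylorAtOne_const,
    ← taylorAtOne_mul analyticAt_const (hL _ _ _ _)]
  congr 1
  funext z
  rw [← lambertSum_smul]
  norm_num

/-- `ζ̄ ℘̄ + q dζ̄/dq = ½ (z d/dz)² ζ̄`. -/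
theorem zetaSeries_mul_wpSeries (hq0 : q ≠ 0) (hq : ‖q‖ < 1) :
    zetaSeries q * wpSeries q + zetaQDeriv q
      = HahnSeries.C (1 / 2) * laurentD (laurentD (zetaSeries q)) := by
  have h := congrArg laurentD (zetaSeries_sq hq0 hq)
  -- Applying `z d/dz` to `ζ̄² = ℘̄ + G` gives `-2 ζ̄ ℘̄ = z ℘̄' + 2 q ∂_q ζ̄`, where `℘̄ = -z ζ̄'`.
  rw [laurentD_mul, laurentD_add, laurentD_zetaSqRegular hq, laurentD_zetaSeries hq0 hq] at h
  rw [laurentD_zetaSeries hq0 hq, laurentD_neg]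
  have hC2 : (HahnSeries.C 2 : HahnSeries ℤ ℂ) * HahnSeries.C (1 / 2) = 1 := by
    rw [← map_mul]; norm_num
  have hC2' : (HahnSeries.C 2 : HahnSeries ℤ ℂ) = 2 := map_ofNat _ 2
  rw [hC2'] at h hC2
  linear_combination -HahnSeries.C (1 / 2) * h - (zetaSeries q * wpSeries q + zetaQDeriv q) * hC2

end Taylor

/-! ### Pairing Laurent series with families of vectors. -/

section Pairing

variable {V : Type*} [AddCommGroup V] [Module ℂ V]

/-- A family of vectors indexed by the integers that vanishes for large indices. -/
def EventuallyZero (F : ℤ → V) : Prop := ∃ N : ℕ, ∀ n : ℤ, N ≤ n → F n = 0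

/-- The finite sum `∑ gᵢ Fᵢ`. -/
noncomputable def pairing (g : HahnSeries ℤ ℂ) (F : ℤ → V) : V := ∑ᶠ i, g.coeff i • F i

theorem HahnSeries.exists_coeff_eq_zero (g : HahnSeries ℤ ℂ) :
    ∃ N : ℕ, ∀ i : ℤ, i < -(N : ℤ) → g.coeff i = 0 := by
  refine ⟨(-g.order).toNat, fun i hi => ?_⟩
  apply HahnSeries.coeff_eq_zero_of_lt_order
  have := Int.self_le_toNat (-g.order)
  lia

theorem pairing_support_finite (g : HahnSeries ℤ ℂ) {F : ℤ → V} (hF : EventuallyZero F) :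
    (Function.support fun i => g.coeff i • F i).Finite := by
  obtain ⟨N, hN⟩ := hF
  obtain ⟨K, hK⟩ := g.exists_coeff_eq_zero
  refine (Set.finite_Ico (-(K : ℤ)) N).subset fun i hi => ?_
  by_contra hc
  refine hi ?_
  rcases lt_or_ge i (-(K : ℤ)) with h | h
  · simp [hK i h]
  · simp [hN i (by simp at hc; lia)]

theorem EventuallyZero.comp_add {F : ℤ → V} (hF : EventuallyZero F) (k : ℤ) :
    EventuallyZero fun i => F (i + k) := by
  obtain ⟨N, hN⟩ := hF
  exact ⟨N + k.natAbs, fun n hn => hN _ (by lia)⟩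

theorem EventuallyZero.add {F G : ℤ → V} (hF : EventuallyZero F) (hG : EventuallyZero G) :
    EventuallyZero fun i => F i + G i := by
  obtain ⟨N, hN⟩ := hF
  obtain ⟨K, hK⟩ := hG
  exact ⟨N + K, fun n hn => by simp [hN n (by lia), hK n (by lia)]⟩

theorem EventuallyZero.smul {F : ℤ → V} (hF : EventuallyZero F) (c : ℤ → ℂ) :
    EventuallyZero fun i => c i • F i := by
  obtain ⟨N, hN⟩ := hF
  exact ⟨N, fun n hn => by simp [hN n hn]⟩

theorem EventuallyZero.map {W : Type*} [AddCommGroup W] [Module ℂ W] {F : ℤ → V}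
    (hF : EventuallyZero F) (f : V →ₗ[ℂ] W) : EventuallyZero fun i => f (F i) := by
  obtain ⟨N, hN⟩ := hF
  exact ⟨N, fun n hn => by simp [hN n hn]⟩

theorem pairing_eq_sum (g : HahnSeries ℤ ℂ) {F : ℤ → V} {N K : ℕ} (hN : ∀ n : ℤ, N ≤ n → F n = 0)
    (hK : ∀ i : ℤ, i < -(K : ℤ) → g.coeff i = 0) :
    pairing g F = ∑ i ∈ Finset.range (K + N), g.coeff ((i : ℤ) - K) • F ((i : ℤ) - K) := by
  rw [pairing, ← finsum_comp_equiv (Equiv.subRight (K : ℤ))]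
  rw [finsum_eq_sum_of_support_subset (s := (Finset.range (K + N)).image (fun n : ℕ => (n : ℤ)))]
  · rw [Finset.sum_image (by simp)]
    rfl
  · intro i hi
    simp only [Function.mem_support, Equiv.subRight_apply] at hi
    have h1 : 0 ≤ i := by
      by_contra hc
      exact hi (by rw [hK _ (by lia), zero_smul])
    have h2 : i - K < N := by
      by_contra hc
      exact hi (by rw [hN _ (by lia), smul_zero])
    simp only [Finset.coe_image, Set.mem_image, Finset.coe_range, Set.mem_Iio]
    exact ⟨i.toNat, by lia, by lia⟩

theorem pairing_congr (g : HahnSeries ℤ ℂ) {F G : ℤ → V} (h : ∀ i, F i = G i) :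
    pairing g F = pairing g G := by rw [funext h]

theorem pairing_add (g : HahnSeries ℤ ℂ) {F G : ℤ → V} (hF : EventuallyZero F)
    (hG : EventuallyZero G) : pairing g (fun i => F i + G i) = pairing g F + pairing g G := by
  simp only [pairing, smul_add]
  exact finsum_add_distrib (pairing_support_finite g hF) (pairing_support_finite g hG)

theorem pairing_smul (g : HahnSeries ℤ ℂ) (c : ℂ) (F : ℤ → V) :
    pairing g (fun i => c • F i) = c • pairing g F := by
  simp only [pairing, smul_comm _ c]
  exact (smul_finsum c _).symm

theorem pairing_neg (g : HahnSeries ℤ ℂ) (F : ℤ → V) :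
    pairing g (fun i => -F i) = -pairing g F := by
  simpa using pairing_smul g (-1) F

theorem pairing_sub (g : HahnSeries ℤ ℂ) {F G : ℤ → V} (hF : EventuallyZero F)
    (hG : EventuallyZero G) : pairing g (fun i => F i - G i) = pairing g F - pairing g G := by
  have h := pairing_add g hF (hG.smul (fun _ => -1))
  rw [pairing_smul] at h
  simpa [sub_eq_add_neg] using h

theorem map_pairing {W : Type*} [AddCommGroup W] [Module ℂ W] (f : V →ₗ[ℂ] W)
    (g : HahnSeries ℤ ℂ) {F : ℤ → V} (hF : EventuallyZero F) :
    f (pairing g F) = pairing g (fun i => f (F i)) := by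
  rw [pairing, pairing, map_finsum f (pairing_support_finite g hF)]
  simp only [map_smul]

theorem add_pairing (g g' : HahnSeries ℤ ℂ) {F : ℤ → V} (hF : EventuallyZero F) :
    pairing (g + g') F = pairing g F + pairing g' F := by
  simp only [pairing, HahnSeries.coeff_add, add_smul]
  exact finsum_add_distrib (pairing_support_finite g hF) (pairing_support_finite g' hF)

theorem smul_pairing (c : ℂ) (g : HahnSeries ℤ ℂ) (F : ℤ → V) :
    pairing (c • g) F = c • pairing g F := by
  simp only [pairing, HahnSeries.coeff_smul, smul_assoc]
  exact (smul_finsum c _).symm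

theorem neg_pairing (g : HahnSeries ℤ ℂ) (F : ℤ → V) : pairing (-g) F = -pairing g F := by
  simp only [pairing, HahnSeries.coeff_neg, neg_smul]
  exact finsum_neg_distrib _

theorem single_mul_pairing (k : ℤ) (g : HahnSeries ℤ ℂ) (F : ℤ → V) :
    pairing (HahnSeries.single k 1 * g) F = pairing g (fun i => F (i + k)) := by
  rw [pairing, ← finsum_comp_equiv (Equiv.addRight k), pairing]
  simp [HahnSeries.coeff_single_mul_add]

theorem single_pairing (k : ℤ) (c : ℂ) (F : ℤ → V) :
    pairing (HahnSeries.single k c) F = c • F k := by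
  rw [pairing, finsum_eq_single _ k fun i hi => by rw [HahnSeries.coeff_single_of_ne hi, zero_smul],
    HahnSeries.coeff_single_same]

theorem xSeries_mul_pairing (g : HahnSeries ℤ ℂ) {F : ℤ → V} (hF : EventuallyZero F) :
    pairing (xSeries * g) F = pairing g (fun i => F i + F (i + 1)) := by
  rw [xSeries, add_mul, one_mul, add_pairing _ _ hF, single_mul_pairing,
    pairing_add g hF (hF.comp_add 1)]

theorem derivative_pairing (g : HahnSeries ℤ ℂ) (F : ℤ → V) :
    pairing (LaurentSeries.derivative ℂ g) F = pairing g (fun i => (i : ℂ) • F (i - 1)) := by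
  rw [pairing, ← finsum_comp_equiv (Equiv.subRight (1 : ℤ)), pairing]
  refine finsum_congr fun i => ?_
  rw [Equiv.subRight_apply, derivative_coeff, smul_smul]
  push_cast
  simp [mul_comm]

/-- Passing to the adjoint of `z d/dz` moves the differentiation from the function to the family of
modes. -/
theorem laurentD_pairing (g : HahnSeries ℤ ℂ) {F : ℤ → V} (hF : EventuallyZero F) :
    pairing (laurentD g) F = pairing g (fun i => (i : ℂ) • (F (i - 1) + F i)) := by
  rw [laurentD, xSeries_mul_pairing _ hF, derivative_pairing]
  simp

end Pairing

/-! ### Residues of fields against Laurent series. -/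

section Smear

variable {V : Type*} [AddCommGroup V] [Module ℂ V]

theorem HahnModule.eventuallyZero (F : VertexOperator ℂ V) (b : V) :
    EventuallyZero fun n => F.ncoeff n b := HahnModule.exists_ncoeff_eq_zero F b

/-- The operator `∑ gᵢ F₍ᵢ₎`, the residue of `g F`. -/
noncomputable def smear (F : VertexOperator ℂ V) (g : HahnSeries ℤ ℂ) : Module.End ℂ V where
  toFun b := pairing g fun n => F.ncoeff n b
  map_add' b b' := by
    simp only [map_add]
    exact pairing_add g (HahnModule.eventuallyZero F b) (HahnModule.eventuallyZero F b')
  map_smul' c b := by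
    simp only [map_smul, RingHom.id_apply]
    exact pairing_smul g c _

theorem smear_apply (F : VertexOperator ℂ V) (g : HahnSeries ℤ ℂ) (b : V) :
    smear F g b = pairing g fun n => F.ncoeff n b := rfl

/-- The mode of index `i` is the coefficient of `x^(-i-1)`, so it pairs with the coefficient of
`xⁱ`. This connects the module action on Laurent series with finite sums of modes. -/
theorem residue_smul [Superspace V] (F : VertexOperator ℂ V) (g : HahnSeries ℤ ℂ) (b : V) :
    residue (g • F b) = smear F g b := by
  rw [smear_apply, residue, HahnModule.coeff_smul, pairing]
  obtain ⟨N, hN⟩ := HahnModule.exists_ncoeff_eq_zero F b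
  have hc : ∀ i j : ℤ, i + j = -1 → ((HahnModule.of ℂ).symm (F b)).coeff j = F.ncoeff i b := by
    intro i j hij
    rw [VertexOperator.ncoeff_apply, show j = -i - 1 by lia]
    rfl
  rw [finsum_eq_sum_of_support_subset _ (s := (Finset.VAddAntidiagonal (-1)
    (Set.VAddAntidiagonal.finite_of_isPWO g.isPWO_support
      ((HahnModule.of ℂ).symm (F b)).isPWO_support (-1))).image Prod.fst)]
  · rw [Finset.sum_image]
    · refine Finset.sum_congr rfl fun ij hij => ?_
      rw [Finset.mem_vaddAntidiagonal] at hij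
      rw [hc ij.1 ij.2 (by simpa using hij.2.2)]
    · intro x hx y hy hxy
      simp only [Finset.mem_coe, Finset.mem_vaddAntidiagonal] at hx hy
      have h1 : x.1 + x.2 = -1 := by simpa using hx.2.2
      have h2 : y.1 + y.2 = -1 := by simpa using hy.2.2
      exact Prod.ext hxy (by lia)
  · intro i hi
    simp only [Finset.coe_image, Set.mem_image, Finset.mem_coe, Finset.mem_vaddAntidiagonal]
    refine ⟨(i, -1 - i), ⟨fun h => hi (by simp [h]), fun h => hi ?_, by simp⟩, rfl⟩
    simp only [← hc i (-1 - i) (by ring), h, smul_zero]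

theorem smear_add (F : VertexOperator ℂ V) (g g' : HahnSeries ℤ ℂ) :
    smear F (g + g') = smear F g + smear F g' :=
  LinearMap.ext fun b => add_pairing g g' (HahnModule.eventuallyZero F b)

theorem smear_neg (F : VertexOperator ℂ V) (g : HahnSeries ℤ ℂ) : smear F (-g) = -smear F g :=
  LinearMap.ext fun _ => neg_pairing g _

theorem smear_smul (F : VertexOperator ℂ V) (c : ℂ) (g : HahnSeries ℤ ℂ) :
    smear F (c • g) = c • smear F g :=
  LinearMap.ext fun _ => smul_pairing c g _

theorem smear_C_mul (F : VertexOperator ℂ V) (c : ℂ) (g : HahnSeries ℤ ℂ) :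
    smear F (HahnSeries.C c * g) = c • smear F g := by
  rw [HahnSeries.C_mul_eq_smul, smear_smul]

theorem neg_smear (F : VertexOperator ℂ V) (g : HahnSeries ℤ ℂ) : smear (-F) g = -smear F g := by
  ext b
  simp only [smear_apply, LinearMap.neg_apply, map_neg, Pi.neg_apply]
  exact pairing_neg g _

end Smear

/-! ### The topological algebra acting on `V` through residues. -/

section TopSmear

variable {V : Type*} [AddCommGroup V] [Module ℂ V] [Superspace V] {A : SUSYVertexAlgebra V}

/-- Integration by parts. -/
theorem smear_T (S : StronglyConformal A) (a : V) (g : HahnSeries ℤ ℂ) :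
    smear (A.Y (A.T a)) g = -smear (A.Y a) (LaurentSeries.derivative ℂ g) := by
  ext b
  rw [LinearMap.neg_apply, smear_apply, smear_apply, derivative_pairing, ← pairing_neg]
  refine pairing_congr g fun i => ?_
  rw [S.translationCovariant]
  simp

/-- Integration by parts for `x^(m+1) g'`. The powers are those that the recursion attaches to `a`,
of weight `m + 1`, and to `∂a`, of weight `m + 2`. -/
theorem smear_pow_mul_laurentD (S : StronglyConformal A) (a : V) (m : ℕ) (g : HahnSeries ℤ ℂ) :
    smear (A.Y a) (xSeries ^ m * laurentD g) = -((m : ℂ) + 1) • smear (A.Y a) (xSeries ^ m * g)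
      - smear (A.Y (A.T a)) (xSeries ^ (m + 1) * g) := by
  have hx : LaurentSeries.derivative ℂ xSeries = 1 := by
    have h := laurentD_taylorAtOne (f := fun z => z) (g := fun z => z) (by fun_prop)
      (by simp)
    rw [taylorAtOne_id, laurentD] at h
    exact mul_left_cancel₀ xSeries_ne_zero (by rw [h, mul_one])
  have hpow : ∀ k : ℕ, LaurentSeries.derivative ℂ (xSeries ^ (k + 1))
      = HahnSeries.C ((k : ℂ) + 1) * xSeries ^ k := by
    intro k
    induction k with
    | zero => simp [hx]
    | succ k ih =>
      rw [pow_succ, derivative_mul, ih, hx, map_add, map_add]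
      push_cast
      rw [map_add, map_one]
      ring
  rw [smear_T S, derivative_mul, hpow, smear_add, mul_assoc, smear_C_mul, laurentD]
  rw [show xSeries ^ m * (xSeries * LaurentSeries.derivative ℂ g)
    = xSeries ^ (m + 1) * LaurentSeries.derivative ℂ g by ring]
  module

namespace StronglyConformal

variable (S : StronglyConformal A)

/-- `J[g] = res g J`. -/
noncomputable def J (g : HahnSeries ℤ ℂ) : Module.End ℂ V := smear (A.Y S.j) g
/-- `H[g] = res g H`. -/
noncomputable def H (g : HahnSeries ℤ ℂ) : Module.End ℂ V := smear (A.Y S.h) g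
/-- `L[g] = res g L`. -/
noncomputable def L (g : HahnSeries ℤ ℂ) : Module.End ℂ V := smear S.virasoro g
/-- `Q[g] = res g Q`. -/
noncomputable def Q (g : HahnSeries ℤ ℂ) : Module.End ℂ V := smear (-A.Y (A.D S.j)) g
/-- `Q₋₁ + Q₀`. -/
noncomputable def Q' : Module.End ℂ V := S.ops.Q (-1) + S.ops.Q 0
/-- The anticommutator of `H[g]` with `Q₋₁ + Q₀`. -/
noncomputable def E (g : HahnSeries ℤ ℂ) : Module.End ℂ V := S.L (xSeries * g) - S.J (laurentD g)

theorem eventuallyZero_J (b : V) : EventuallyZero fun n => S.ops.J n b :=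
  HahnModule.eventuallyZero (A.Y S.j) b
theorem eventuallyZero_H (b : V) : EventuallyZero fun n => S.ops.H n b :=
  HahnModule.eventuallyZero (A.Y S.h) b

theorem virasoro_ncoeff (n : ℤ) : S.virasoro.ncoeff n = S.ops.L (n - 1) := by
  simp [virasoro, ops, topModes]

theorem neg_D_j_ncoeff (n : ℤ) : (-A.Y (A.D S.j)).ncoeff n = S.ops.Q (n - 1) := by
  simp [ops, topModes]

theorem J_apply (g : HahnSeries ℤ ℂ) (b : V) : S.J g b = pairing g fun n => S.ops.J n b := rfl
theorem H_apply (g : HahnSeries ℤ ℂ) (b : V) : S.H g b = pairing g fun n => S.ops.H n b := rfl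
theorem L_apply (g : HahnSeries ℤ ℂ) (b : V) : S.L g b = pairing g fun n => S.ops.L (n - 1) b := by
  rw [L, smear_apply]; simp only [virasoro_ncoeff]
theorem Q_apply (g : HahnSeries ℤ ℂ) (b : V) : S.Q g b = pairing g fun n => S.ops.Q (n - 1) b := by
  rw [Q, smear_apply]; simp only [neg_D_j_ncoeff]

theorem eventuallyZero_L (b : V) : EventuallyZero fun n => S.ops.L (n - 1) b := by
  simpa only [virasoro_ncoeff] using HahnModule.eventuallyZero S.virasoro b
theorem eventuallyZero_Q (b : V) : EventuallyZero fun n => S.ops.Q (n - 1) b := by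
  simpa only [neg_D_j_ncoeff] using HahnModule.eventuallyZero (-A.Y (A.D S.j)) b

theorem Q'_mul_Q' : S.Q' * S.Q' = 0 := by
  have h1 := S.relations.Q_Q (-1) trivial (-1) trivial
  have h2 := S.relations.Q_Q (-1) trivial 0 trivial
  have h3 := S.relations.Q_Q 0 trivial 0 trivial
  have : (2 : ℂ) • (S.Q' * S.Q') = 0 := by
    have h4 : (2 : ℂ) • (S.Q' * S.Q') = (S.ops.Q (-1) * S.ops.Q (-1) + S.ops.Q (-1) * S.ops.Q (-1))
        + (2 : ℂ) • (S.ops.Q (-1) * S.ops.Q 0 + S.ops.Q 0 * S.ops.Q (-1))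
        + (S.ops.Q 0 * S.ops.Q 0 + S.ops.Q 0 * S.ops.Q 0) := by
      rw [Q', two_smul, two_smul]
      noncomm_ring
    rw [h4, h1, h2, h3]
    simp
  exact (smul_eq_zero.1 this).resolve_left two_ne_zero

/-- The brackets of `Jₙ` with `Q₋₁` and `Q₀` are `Qₙ₋₁` and `Qₙ`; adding a mode and its successor is
multiplication by `x = 1 + (x - 1)`. -/
theorem J_Q' (g : HahnSeries ℤ ℂ) : S.J g * S.Q' - S.Q' * S.J g = S.Q (xSeries * g) := by
  ext b
  rw [LinearMap.sub_apply, Module.End.mul_apply, Module.End.mul_apply, J_apply, J_apply, Q_apply,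
    map_pairing _ _ (S.eventuallyZero_J b), xSeries_mul_pairing _ (S.eventuallyZero_Q b),
    ← pairing_sub _ (S.eventuallyZero_J _) ((S.eventuallyZero_J b).map S.Q')]
  refine pairing_congr g fun n => ?_
  have h1 := LinearMap.ext_iff.1 (S.relations.J_Q n trivial (-1) trivial) b
  have h2 := LinearMap.ext_iff.1 (S.relations.J_Q n trivial 0 trivial) b
  simp only [LinearMap.sub_apply, Module.End.mul_apply, add_zero] at h1 h2
  rw [add_sub_cancel_right, ← h2, sub_eq_add_neg n 1, ← h1]
  simp only [Q', LinearMap.add_apply, map_add]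
  abel

theorem J_H₀ (g : HahnSeries ℤ ℂ) : S.J g * S.ops.H 0 - S.ops.H 0 * S.J g = -S.H g := by
  ext b
  rw [LinearMap.sub_apply, Module.End.mul_apply, Module.End.mul_apply, J_apply, J_apply,
    LinearMap.neg_apply, H_apply, map_pairing _ _ (S.eventuallyZero_J b), ← pairing_neg,
    ← pairing_sub _ (S.eventuallyZero_J _) ((S.eventuallyZero_J b).map (S.ops.H 0))]
  refine pairing_congr g fun n => ?_
  have h1 := LinearMap.ext_iff.1 (S.relations.J_H n trivial 0 trivial) b
  simpa using h1

theorem L_H₀ (g : HahnSeries ℤ ℂ) : S.L g * S.ops.H 0 - S.ops.H 0 * S.L g = 0 := by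
  ext b
  rw [LinearMap.sub_apply, Module.End.mul_apply, Module.End.mul_apply, L_apply, L_apply,
    map_pairing _ _ (S.eventuallyZero_L b),
    ← pairing_sub _ (S.eventuallyZero_L _) ((S.eventuallyZero_L b).map (S.ops.H 0)),
    LinearMap.zero_apply]
  have h : ∀ n : ℤ, S.ops.L (n - 1) (S.ops.H 0 b) - S.ops.H 0 (S.ops.L (n - 1) b)
      = (0 : ℂ) • (0 : V) := fun n => by
    have h1 := LinearMap.ext_iff.1 (S.relations.L_H (n - 1) trivial 0 trivial) b
    simpa using h1
  rw [pairing_congr g h, pairing_smul, zero_smul]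

/-- The brackets of `Hₙ` with `Q₋₁` and `Q₀` add up to `Lₙ₋₁ + Lₙ - n (Jₙ₋₁ + Jₙ)`, which pairs to
the two terms of `E`. The central term could occur only for `n = 1` and `n = 0`, where `n² - n`
vanishes. -/
theorem H_Q' (g : HahnSeries ℤ ℂ) : S.H g * S.Q' + S.Q' * S.H g = S.E g := by
  ext b
  rw [LinearMap.add_apply, Module.End.mul_apply, Module.End.mul_apply, H_apply, H_apply, E,
    LinearMap.sub_apply, L_apply, J_apply, xSeries_mul_pairing _ (S.eventuallyZero_L b),
    laurentD_pairing _ (S.eventuallyZero_J b), map_pairing _ _ (S.eventuallyZero_H b),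
    ← pairing_add _ (S.eventuallyZero_H _) ((S.eventuallyZero_H b).map S.Q'),
    ← pairing_sub _ ((S.eventuallyZero_L b).add ((S.eventuallyZero_L b).comp_add 1))]
  · refine pairing_congr g fun n => ?_
    have h1 := LinearMap.ext_iff.1 (S.relations.H_Q n trivial (-1) trivial) b
    have h2 := LinearMap.ext_iff.1 (S.relations.H_Q n trivial 0 trivial) b
    have e1 : (if n = -(-1) then ((n : ℂ) ^ 2 - n) * S.c / 6 else 0) = 0 := by
      split_ifs with h <;> simp [h]
    have e2 : (if n = -0 then ((n : ℂ) ^ 2 - n) * S.c / 6 else 0) = 0 := by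
      split_ifs with h
      · rw [h]; simp
      · rfl
    rw [e1] at h1
    rw [e2] at h2
    simp only [LinearMap.sub_apply, LinearMap.add_apply, LinearMap.smul_apply,
      Module.End.mul_apply, add_zero, zero_smul, ← sub_eq_add_neg] at h1 h2
    rw [add_sub_cancel_right]
    simp only [Q', LinearMap.add_apply, map_add]
    linear_combination (norm := module) h1 + h2
  · exact (((S.eventuallyZero_J b).comp_add (-1)).add (S.eventuallyZero_J b)).smul
      (fun n => (n : ℂ))

/-- An anticommutator with an operator of square zero commutes with that operator. -/
theorem E_Q' (g : HahnSeries ℤ ℂ) : S.E g * S.Q' = S.Q' * S.E g := by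
  rw [← H_Q', add_mul, mul_add, mul_assoc, S.Q'_mul_Q', ← mul_assoc S.Q' S.Q', S.Q'_mul_Q']
  noncomm_ring

theorem E_H₀ (g : HahnSeries ℤ ℂ) :
    S.E g * S.ops.H 0 - S.ops.H 0 * S.E g = S.H (laurentD g) := by
  have h1 := S.L_H₀ (xSeries * g)
  have h2 := S.J_H₀ (laurentD g)
  rw [E]
  calc _ = (S.L (xSeries * g) * S.ops.H 0 - S.ops.H 0 * S.L (xSeries * g))
      - (S.J (laurentD g) * S.ops.H 0 - S.ops.H 0 * S.J (laurentD g)) := by noncomm_ring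
    _ = _ := by rw [h1, h2]; simp

/-- The conformal vector. -/
noncomputable def ω : V := A.D S.h - A.T S.j

theorem Y_ω : A.Y S.ω = S.virasoro := by rw [ω, map_sub, virasoro]

theorem ω_even : HasParity 0 S.ω := by
  have h1 := S.h_odd
  have h2 := S.j_even
  rw [HasParity] at h1 h2 ⊢
  have h3 := A.D_odd S.h
  have h4 := A.T_even S.j
  rw [h1] at h3
  rw [h2] at h4
  simp at h3 h4 ⊢
  rw [ω, map_sub, ← h3, ← h4]

theorem J_vac (n : ℤ) (hn : 0 ≤ n) : S.ops.J n A.vac = 0 := (A.creation S.j).2 n hn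

theorem L_vac (n : ℤ) (hn : -1 ≤ n) : S.ops.L n A.vac = 0 := by
  have h1 := (A.creation (A.D S.h)).2 (n + 1) (by lia)
  have h2 := (A.creation (A.T S.j)).2 (n + 1) (by lia)
  simp [ops, topModes, h1, h2]

/-- The weight is written as `m + 1`, the form used in the recursion: `m = 0` for `j` and `m = 1`
for the conformal vector, so that the modes of index `m` are `J₀` and `L₀`. -/
theorem j_mem : S.j ∈ S.ops.weightSpace (((0 : ℕ) : ℤ) + 1, 0) := by
  have hj : S.j = S.ops.J (-1) A.vac := (A.creation S.j).1.symm
  have h1 := LinearMap.ext_iff.1 (S.relations.L_J 0 trivial (-1) trivial) A.vac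
  have h2 := LinearMap.ext_iff.1 (S.relations.J_J 0 trivial (-1) trivial) A.vac
  simp [S.L_vac 0 (by lia), S.J_vac 0 le_rfl, ← hj] at h1 h2
  rw [TopOperators.mem_weightSpace_iff]
  simp [h1, h2]

theorem ω_mem : S.ω ∈ S.ops.weightSpace (((1 : ℕ) : ℤ) + 1, 0) := by
  have hω : S.ω = S.ops.L (-2) A.vac := by
    have h1 := (A.creation (A.D S.h)).1
    have h2 := (A.creation (A.T S.j)).1
    simp [ops, topModes, h1, h2, ω]
  have h1 := LinearMap.ext_iff.1 (S.relations.L_L 0 trivial (-2) trivial) A.vac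
  have h2 := LinearMap.ext_iff.1 (S.relations.L_J (-2) trivial 0 trivial) A.vac
  simp [S.L_vac 0 (by lia), S.J_vac 0 le_rfl, ← hω] at h1 h2
  rw [TopOperators.mem_weightSpace_iff]
  simp [h1, h2]

theorem T_mem {m : ℕ} {a : V} (ha : a ∈ S.ops.weightSpace ((m : ℤ) + 1, 0)) :
    A.T a ∈ S.ops.weightSpace (((m + 1 : ℕ) : ℤ) + 1, 0) := by
  have h := S.quasiConformal.relations.hasWeight_L (-1) le_rfl _ a ha
  rw [S.L_neg_one] at h
  simpa using h

theorem _root_.SUSYVertexAlgebra.hasParity_T {a : V} (ha : HasParity 0 a) :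
    HasParity 0 (A.T a) := by
  rw [HasParity, pow_zero, one_smul] at ha ⊢
  rw [← A.T_even, ha]

theorem E_neg (g : HahnSeries ℤ ℂ) : S.E (-g) = -S.E g := by
  have h : xSeries * -g = -(xSeries * g) := by ring
  rw [E, E, L, J, h, laurentD_neg, smear_neg, smear_neg, ← L, ← J]
  abel

theorem E_C_mul (c : ℂ) (g : HahnSeries ℤ ℂ) : S.E (HahnSeries.C c * g) = c • S.E g := by
  rw [E, E, L, J, mul_left_comm, laurentD_mul, laurentD_C, zero_mul, zero_add, smear_C_mul,
    smear_C_mul, smul_sub]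
  rfl

theorem E_add (g g' : HahnSeries ℤ ℂ) : S.E (g + g') = S.E g + S.E g' := by
  rw [E, L, J, mul_add, laurentD_add, smear_add, smear_add]
  change _ = (smear _ _ - smear _ _) + (smear _ _ - smear _ _)
  abel

theorem eventuallyZero_E (b : V) : EventuallyZero fun n => (S.ops.L (n - 1) b + S.ops.L n b) -
    (n : ℂ) • (S.ops.J (n - 1) b + S.ops.J n b) := by
  obtain ⟨N, hN⟩ := S.eventuallyZero_L b
  obtain ⟨K, hK⟩ := S.eventuallyZero_J b
  refine ⟨N + K + 1, fun n hn => ?_⟩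
  have h := hN (n + 1) (by lia)
  dsimp only at h hN hK ⊢
  rw [add_sub_cancel_right] at h
  rw [hN n (by lia), h, hK n (by lia), hK (n - 1) (by lia)]
  simp

/-- The family on the right does not involve `q`, so in `E[ζ̄] b` the parameter enters through the
coefficients of `ζ̄` alone. This permits differentiation in `q`. -/
theorem E_apply (g : HahnSeries ℤ ℂ) (b : V) :
    S.E g b = pairing g fun n => (S.ops.L (n - 1) b + S.ops.L n b) -
      (n : ℂ) • (S.ops.J (n - 1) b + S.ops.J n b) := by
  rw [E, LinearMap.sub_apply, L_apply, J_apply, xSeries_mul_pairing _ (S.eventuallyZero_L b),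
    laurentD_pairing _ (S.eventuallyZero_J b), ← pairing_sub]
  · simp
  · exact (S.eventuallyZero_L b).add ((S.eventuallyZero_L b).comp_add 1)
  · exact (((S.eventuallyZero_J b).comp_add (-1)).add (S.eventuallyZero_J b)).smul
      (fun n => (n : ℂ))

end StronglyConformal

end TopSmear

/-! ### Telescoping supertraces into Lambert series. -/

section Recursion

open Finset

/-- The shift of weights attached to a term of a two-sided Lambert series. -/
def lambertShift : (ℕ × ℕ) ⊕ (ℕ × ℕ) → ℤ :=
  Sum.elim (fun x => ((x.1 : ℤ) + 1) * (x.2 + 1)) (fun x => ((x.1 : ℤ) + 1) * (x.2 + 1))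

theorem sum_telescope {f c : ℤ × ℤ → ℂ} {l : ℤ} (h : ∀ p, f (p + (l, 0)) = f p + c p)
    (p : ℤ × ℤ) (K : ℕ) :
    ∑ k ∈ range K, c (p - (((k : ℤ) + 1) * l, 0)) = f p - f (p - ((K : ℤ) * l, 0)) := by
  induction K with
  | zero =>
    rw [sum_range_zero, Nat.cast_zero, zero_mul, show ((0, 0) : ℤ × ℤ) = 0 from rfl, sub_zero,
        sub_self]
  | succ K ih =>
    have h1 := h (p - (((K : ℤ) + 1) * l, 0))
    rw [show p - (((K : ℤ) + 1) * l, 0) + (l, 0) = p - ((K : ℤ) * l, 0) by ext <;> simp; ring] at h1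
    rw [sum_range_succ, ih, h1]
    push_cast
    ring

theorem hasSum_mul_prod {ι κ : Type*} {f : ι → ℂ} {g : κ → ℂ} {a : ℂ} (hf : HasSum f a)
    (hg : Summable g) : HasSum (fun z : ι × κ => f z.1 * g z.2) (a * ∑' p, g p) :=
  hf.mul hg.hasSum (summable_mul_of_summable_norm hf.summable.norm hg.norm)

/-- A family of telescoping supertraces is determined by its increments. -/
theorem hasSum_lambert_telescope {q y : ℂ} (hq0 : q ≠ 0) {m N : ℕ} {α : ℕ → ℂ}
    (hα : ∀ i, HasSum (fun x => lambertCoeff 0 0 1 (-1) q x * (Ring.choose (m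
      + lambertExp x) i : ℤ))
      (α i))
    {d : ℕ → ℤ × ℤ → ℂ} (hd0 : ∀ i p, p.1 < 0 → d i p = 0)
    (hd : ∀ i, Summable fun p : ℤ × ℤ => q ^ p.1 * y ^ p.2 * d i p) {t : ℤ → ℤ × ℤ → ℂ}
    (ht0 : ∀ l p, p.1 < 0 → t l p = 0)
    (ht : ∀ l p, t l (p + (l, 0)) = t l p +
      ∑ i ∈ range N, ((Ring.choose ((m : ℤ) + l) i : ℤ) : ℂ) * d i p) :
    HasSum (fun p : ℤ × ℤ => q ^ p.1 * y ^ p.2 * ∑ l ∈ range (p.1.toNat + 1),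
        (t ((l : ℤ) + 1) p + t (-1 - (l : ℤ)) (p + (-1 - (l : ℤ), 0))))
      (-∑ i ∈ range N, α i * ∑' p : ℤ × ℤ, q ^ p.1 * y ^ p.2 * d i p) := by
  let c : ℤ → ℤ × ℤ → ℂ := fun l p => ∑ i ∈ range N, ((Ring.choose ((m : ℤ) + l) i : ℤ) : ℂ) * d i p
  let sg : (ℕ × ℕ) ⊕ (ℕ × ℕ) → ℂ := Sum.elim (fun _ => 1) (fun _ => -1)
  have hcoeff : ∀ x, lambertCoeff 0 0 1 (-1) q x = sg x * q ^ lambertShift x := by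
    intro x
    have h : ∀ a b : ℕ, q ^ (((a : ℤ) + 1) * (b + 1)) = q ^ ((a + 1) * (b + 1)) := fun a b => by
      rw [← zpow_natCast]; push_cast; rfl
    rcases x with x | x <;> simp [lambertCoeff, sg, lambertShift, h]
  have h1 := hasSum_sum (s := range N) fun i _ => hasSum_mul_prod (hα i) (hd i)
  -- A Lambert term with `q^(l k)` shifts the conformal weight by `l k`: the product of the series
  -- for `α` and `d` is rearranged so that `q` carries the shifted weight.
  let e : (ℤ × ℤ) × ((ℕ × ℕ) ⊕ (ℕ × ℕ)) ≃ ((ℕ × ℕ) ⊕ (ℕ × ℕ)) × (ℤ × ℤ) :=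
    { toFun := fun z => (z.2, z.1 - (lambertShift z.2, 0))
      invFun := fun z => (z.2 + (lambertShift z.1, 0), z.1)
      left_inv := fun z => by simp
      right_inv := fun z => by simp }
  have h2 : HasSum (fun z : (ℤ × ℤ) × ((ℕ × ℕ) ⊕ (ℕ × ℕ)) => q ^ z.1.1 * y ^ z.1.2 *
      (sg z.2 * c (lambertExp z.2) (z.1 - (lambertShift z.2, 0))))
      (∑ i ∈ range N, α i * ∑' p : ℤ × ℤ, q ^ p.1 * y ^ p.2 * d i p) := by
    refine (e.hasSum_iff.2 h1).congr_fun fun z => ?_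
    simp only [Function.comp_apply, e, Equiv.coe_fn_mk, c, mul_sum]
    refine sum_congr rfl fun i _ => ?_
    rw [hcoeff, Prod.fst_sub, Prod.snd_sub, sub_zero, zpow_sub₀ hq0]
    have : q ^ lambertShift z.2 ≠ 0 := zpow_ne_zero _ hq0
    field_simp
  -- Convergence of the sum over blocks is inherited from the absolutely convergent product series.
  -- On one block only finitely many shifts leave a nonnegative weight, and they telescope.
  have h3 := h2.prod_fiberwise (g := fun p : ℤ × ℤ => -(q ^ p.1 * y ^ p.2 *
    ∑ l ∈ range (p.1.toNat + 1), (t ((l : ℤ) + 1) p + t (-1 - (l : ℤ)) (p + (-1 - (l : ℤ),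
      0))))) fun p => ?_
  · simpa using h3.neg
  · dsimp only
    rw [← mul_neg]
    refine HasSum.mul_left _ ?_
    set K := p.1.toNat + 1 with hK
    have hcneg : ∀ l p, p.1 < 0 → c l p = 0 := fun l p hp =>
      sum_eq_zero fun i _ => by rw [hd0 i p hp, mul_zero]
    have hbig : ∀ a b : ℕ, ¬(a < K ∧ b < K) → p.1 - ((a : ℤ) + 1) * (b + 1) < 0 := by
      intro a b hab
      have h0 : p.1 < K := by lia
      have : (K : ℤ) ≤ ((a : ℤ) + 1) * (b + 1) := by
        rcases not_and_or.1 hab with h | h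
        · have : (K : ℤ) ≤ a := by lia
          nlinarith
        · have : (K : ℤ) ≤ b := by lia
          nlinarith
      lia
    have hs := hasSum_sum_of_ne_finset_zero (L := SummationFilter.unconditional _)
      (f := fun x => sg x * c (lambertExp x) (p - (lambertShift x, 0)))
      (s := (range K ×ˢ range K).disjSum (range K ×ˢ range K)) (fun x hx => by
        rcases x with x | x
        · rw [hcneg _ _ ?_, mul_zero]
          exact hbig x.1 x.2 (by simpa using hx)
        · rw [hcneg _ _ ?_, mul_zero]
          exact hbig x.1 x.2 (by simpa using hx))
    refine (congrArg (HasSum _) ?_).mp hs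
    symm
    rw [sum_disjSum, sum_product_right, sum_product_right, ← sum_add_distrib, ← sum_neg_distrib]
    refine sum_congr rfl fun l _ => ?_
    simp only [sg, lambertExp, lambertShift, Sum.elim_inl, Sum.elim_inr, one_mul, neg_one_mul,
      sum_neg_distrib]
    rw [sum_telescope (f := t (l + 1)) (fun p => ht _ p)]
    -- For negative modes the relation is read backwards, with step `l + 1` and the opposite sign.
    -- The lower ends of both telescoping sums lie at negative weight and vanish.
    rw [sum_telescope (f := fun p => -t (-1 - (l : ℤ)) (p + (-1 - (l : ℤ), 0))) (fun p => ?_)]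
    · rw [ht0 _ (p - _), ht0 _ (p - _ + _)]
      · ring
      · simp only [Prod.fst_add, Prod.fst_sub]
        have : (K : ℤ) ≤ K * ((l : ℤ) + 1) := by nlinarith
        lia
      · simp only [Prod.fst_sub]
        have : (K : ℤ) ≤ K * ((l : ℤ) + 1) := by nlinarith
        lia
    · have h5 := ht (-1 - l) p
      have h6 : p + ((l : ℤ) + 1, 0) + (-1 - (l : ℤ), 0) = p := by ext <;> simp; ring
      rw [h6, h5, show -((l : ℤ) + 1) = -1 - l by ring]
      simp only [c]
      ring

end Recursion

/-! ### The residue against `xᵐ ζ̄` in terms of Taylor coefficients. -/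

section Zhu

open Finset

theorem xSeries_pow_coeff_natCast (m i : ℕ) :
    (xSeries ^ m).coeff i = ((Ring.choose (m : ℤ) i : ℤ) : ℂ) := by
  have h : xSeries ^ m = HahnSeries.ofPowerSeries ℤ ℂ ((1 + Polynomial.X : Polynomial ℂ) ^ m) := by
    rw [xSeries, ← PowerSeries.coe_X, ← PowerSeries.coe_one, ← PowerSeries.coe_add,
      ← PowerSeries.coe_pow]
    congr 1
    simp
  rw [h, HahnSeries.ofPowerSeries_apply_coeff, ← Polynomial.coe_pow, Polynomial.coeff_coe,
      Polynomial.coeff_one_add_X_pow,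
    Ring.choose_natCast]
  simp

theorem xSeries_pow_mul_coeff_of_neg (m : ℕ) {g : HahnSeries ℤ ℂ} (hg : ∀ i < 0, g.coeff i = 0)
    {i : ℤ} (hi : i < 0) : (xSeries ^ m * g).coeff i = 0 := by
  induction m generalizing i with
  | zero => simpa using hg i hi
  | succ m ih =>
    have := HahnSeries.coeff_single_mul_add (r := (1 : ℂ)) (x := xSeries ^ m * g) (a := i - 1)
        (b := 1)
    rw [sub_add_cancel] at this
    rw [pow_succ', mul_assoc]
    nth_rewrite 1 [xSeries]
    rw [add_mul, one_mul, HahnSeries.coeff_add, ih hi, this, ih (by lia), mul_zero, zero_add]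

variable {V : Type*} [AddCommGroup V] [Module ℂ V]

theorem pairing_eq_sum_range {g : HahnSeries ℤ ℂ} (hg : ∀ i < 0, g.coeff i = 0) {F : ℤ → V} {N : ℕ}
    (hN : ∀ n : ℤ, N ≤ n → F n = 0) : pairing g F = ∑ i ∈ range N, g.coeff i • F i := by
  rw [pairing_eq_sum g hN (K := 0) (fun i hi => hg i (by simpa using hi)), zero_add]
  simp

variable {q : ℂ}

/-- The terms of the residue of `xᵐ ζ̄` against a field. -/
theorem pairing_pow_mul_zetaSeries (hq0 : q ≠ 0) (hq : ‖q‖ < 1) (m : ℕ) {F : ℤ → V} {N : ℕ}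
    (hN : ∀ n : ℤ, N ≤ n → F n = 0) :
    pairing (xSeries ^ m * zetaSeries q) F
      = ∑ i ∈ range (N + 1), ((Ring.choose (m : ℤ) i : ℤ) : ℂ) • F (i - 1)
        + (1 / 2 : ℂ) • ∑ i ∈ range N, ((Ring.choose (m : ℤ) i : ℤ) : ℂ) • F i
        + ∑ i ∈ range N, (iteratedDeriv i (fun z => z ^ m * lambertSum 0 0 1 (-1) q z) 1
          / (i.factorial : ℂ)) • F i := by
  have hF : EventuallyZero F := ⟨N, hN⟩
  have hx : ∀ i < 0, (xSeries ^ m).coeff i = 0 := fun i hi => by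
    have := xSeries_pow_mul_coeff_of_neg m (g := 1)
        (fun j hj => by simp [HahnSeries.coeff_one]; lia) hi
    rwa [mul_one] at this
  rw [zetaSeries_eq hq0 hq, mul_add, mul_add, add_pairing _ _ hF, add_pairing _ _ hF,
    mul_comm _ (HahnSeries.single (-1) 1), single_mul_pairing, mul_comm _ (HahnSeries.C _),
    HahnSeries.C_mul_eq_smul, smul_pairing, pairing_eq_sum_range hx hN,
    pairing_eq_sum_range (N := N + 1) hx (fun n hn => hN _ (by push_cast at hn; lia)),
    ← taylorAtOne_pow_mul _ (analyticAt_lambertSum _ _ _ _ hq (one_mem_lambertAnnulus hq)),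
    pairing_eq_sum_range (fun i hi => taylorAtOne_coeff_of_neg _ hi) hN, add_assoc]
  simp only [xSeries_pow_coeff_natCast, taylorAtOne_coeff_natCast, sub_eq_add_neg]

end Zhu

/-! ### Zhu's recursion. -/

section Zhu

open Finset

variable {V M : Type*} [AddCommGroup V] [Module ℂ V] [Superspace V]
  [AddCommGroup M] [Module ℂ M] [Superspace M] {A : SUSYVertexAlgebra V} {X : SUSYModule A M}
  {S : StronglyConformal A}

namespace SUSYModule.IsPositiveEnergy

variable (hX : X.IsPositiveEnergy S)

/-- The terms of the supertrace of the zero mode of `b` against `q^(L₀) y^(J₀)`. -/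
noncomputable def term (q y : ℂ) (b : V) (p : ℤ × ℤ) : ℂ :=
  q ^ p.1 * y ^ p.2 * hX.graded.strAt p (hX.zeroMode b)

theorem term_add (q y : ℂ) (b b' : V) (p : ℤ × ℤ) :
    hX.term q y (b + b') p = hX.term q y b p + hX.term q y b' p := by
  simp only [term, map_add, TopOperators.IsGraded.strAt_add, mul_add]

theorem term_smul (q y c : ℂ) (b : V) (p : ℤ × ℤ) :
    hX.term q y (c • b) p = c * hX.term q y b p := by
  simp only [term, map_smul, TopOperators.IsGraded.strAt_smul]
  ring

/-- Absolute convergence of the supertraces on the even family. -/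
def TermConverges (q y : ℂ) : Prop := ∀ b : V, Summable (hX.term q y b)

variable {hX} {q y : ℂ}

/-- The supertrace on the even family, as a linear functional. -/
noncomputable def TermConverges.ψ (hs : hX.TermConverges q y) : V →ₗ[ℂ] ℂ where
  toFun b := ∑' p, hX.term q y b p
  map_add' b b' := by
    simp only [term_add]
    exact (hs b).tsum_add (hs b')
  map_smul' c b := by
    simp only [term_smul, tsum_mul_left, RingHom.id_apply, smul_eq_mul]

theorem TermConverges.hasSum (hs : hX.TermConverges q y) (b : V) :
    HasSum (hX.term q y b) (hs.ψ b) := (hs b).hasSum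

variable {a : V} (ha : HasParity 0 a) {m : ℕ} (haw : a ∈ S.ops.weightSpace ((m : ℤ) + 1, 0))

include ha haw

/-- Let `t l` be the supertrace of the product of the two modes shifted by `-l` and `l`. Normal
ordering expresses the polar part of `ζ̄` through all the `t l`, while telescoping expresses those
with `l ≠ 0` through the regular part. What remains is `t 0`, the insertion of the zero mode. -/
theorem hasSum_strAt_zeroMode_mul_of_mem (hs : hX.TermConverges q y) (hq0 : q ≠ 0) (hq : ‖q‖ < 1)
    {b : V} {r : ℤ × ℤ} (hb : b ∈ S.ops.weightSpace r) :
    HasSum (fun p : ℤ × ℤ => q ^ p.1 * y ^ p.2 *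
      hX.graded.strAt p (hX.zeroMode b * (X.Y a).ncoeff m))
      (hs.ψ (smear (A.Y a) (xSeries ^ m * zetaSeries q) b)) := by
  obtain ⟨N, hN⟩ := HahnModule.exists_ncoeff_eq_zero (A.Y a) b
  let t : ℤ → ℤ × ℤ → ℂ := fun l p =>
    hX.graded.strAt p ((X.Y b).ncoeff (r.1 - 1 - l) * (X.Y a).ncoeff (m + l))
  have htu : ∀ l p, t l (p + (l, 0)) = hX.graded.strAt p
      ((X.Y a).ncoeff (m + l) * (X.Y b).ncoeff (r.1 - 1 - l)) := fun l p =>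
    (hX.strAt_mode_mul ha haw _ l p).symm
  let d : ℕ → ℤ × ℤ → ℂ := fun i p => hX.graded.strAt p (hX.zeroMode ((A.Y a).ncoeff i b))
  have ht : ∀ l p, t l (p + (l, 0)) = t l p +
      ∑ i ∈ range N, ((Ring.choose ((m : ℤ) + l) i : ℤ) : ℂ) * d i p := fun l p => by
    have h := congrArg (hX.graded.strAt p) (hX.comm_eq_sum_zeroMode ha haw hb l hN)
    rw [TopOperators.IsGraded.strAt_sub, TopOperators.IsGraded.strAt_sum] at h
    simp only [TopOperators.IsGraded.strAt_smul] at h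
    rw [htu, ← sub_eq_iff_eq_add']
    exact h
  have h1 := hasSum_lambert_telescope (y := y) hq0 (m := m) (N := N)
    (fun i => taylor_lambertSum 0 0 1 (-1) hq m i) (d := d)
    (fun i p hp => hX.graded.strAt_eq_zero_of_neg hp _) (fun i => hs ((A.Y a).ncoeff i b))
    (fun l p hp => hX.graded.strAt_eq_zero_of_neg hp _) ht
  have h2 : HasSum (fun p => ∑ i ∈ range (N + 1), ((Ring.choose (m : ℤ) i : ℤ) : ℂ) *
      hX.term q y ((A.Y a).ncoeff (i - 1) b) p)
      (hs.ψ (∑ i ∈ range (N + 1), ((Ring.choose (m : ℤ) i : ℤ) : ℂ) • (A.Y a).ncoeff (i - 1) b)) :=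
        by
    rw [map_sum]
    refine hasSum_sum fun i _ => ?_
    rw [map_smul]
    exact (hs.hasSum _).mul_left _
  -- For `l = 0` nothing is shifted, so the commutator has zero supertrace on each block. Hence the
  -- constant `1/2` in `ζ̄` contributes nothing.
  have h3 : hs.ψ (∑ i ∈ range N, ((Ring.choose (m : ℤ) i : ℤ) : ℂ) • (A.Y a).ncoeff i b) = 0 := by
    refine (tsum_congr fun p => ?_).trans tsum_zero
    have h4 := ht 0 p
    rw [show p + ((0 : ℤ), (0 : ℤ)) = p from add_zero p, add_zero, left_eq_add] at h4
    rw [term, map_sum, TopOperators.IsGraded.strAt_sum]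
    simp only [map_smul, TopOperators.IsGraded.strAt_smul]
    exact mul_eq_zero_of_right _ h4
  have h5 : hs.ψ (smear (A.Y a) (xSeries ^ m * zetaSeries q) b)
      = hs.ψ (∑ i ∈ range (N + 1), ((Ring.choose (m : ℤ) i : ℤ) : ℂ) • (A.Y a).ncoeff (i - 1) b)
        - -∑ i ∈ range N, (iteratedDeriv i (fun z => z ^ m * lambertSum 0 0 1 (-1) q z) 1
          / (i.factorial : ℂ)) * ∑' p : ℤ × ℤ, q ^ p.1 * y ^ p.2 * d i p := by
    rw [smear_apply, pairing_pow_mul_zetaSeries hq0 hq m hN, map_add, map_add, map_smul, h3,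
      smul_zero, add_zero, sub_neg_eq_add, map_sum hs.ψ _ (range N)]
    simp only [map_smul, smul_eq_mul]
    rfl
  rw [h5]
  refine (h2.sub h1).congr_fun fun p => ?_
  have h6 := hX.sum_choose_strAt ha haw hb p (K := p.1.toNat + 1) hN (by lia)
  have h7 : hX.zeroMode b = (X.Y b).ncoeff (r.1 - 1) :=
    TopOperators.IsGraded.zeroMode_of_mem _ _ hb
  have h8 : ∑ i ∈ range (N + 1), ((Ring.choose (m : ℤ) i : ℤ) : ℂ) *
      hX.term q y ((A.Y a).ncoeff (i - 1) b) p = q ^ p.1 * y ^ p.2 *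
      ∑ l ∈ range (p.1.toNat + 1), (t (-1 - (l : ℤ)) (p + (-1 - (l : ℤ), 0)) + t l p) := by
    simp only [htu]
    rw [← h6, mul_sum]
    refine sum_congr rfl fun i _ => ?_
    rw [term]
    ring
  -- The two sums differ by one index at each end; the extra mode at the upper end lowers the weight
  -- below zero.
  have h9 : ∑ l ∈ range (p.1.toNat + 1), t ((l : ℤ) + 1) p + t 0 p
      = ∑ l ∈ range (p.1.toNat + 1), t (l : ℤ) p := by
    have e1 := sum_range_succ (fun l : ℕ => t (l : ℤ) p) (p.1.toNat + 1)
    rw [sum_range_succ'] at e1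
    have e2 : t ((p.1.toNat + 1 : ℕ) : ℤ) p = 0 := by
      refine (hX.graded.strAt_congr (Z := 0) fun w hw => ?_).trans (hX.graded.strAt_zero p)
      have e3 := hX.hasWeight_mode haw ((p.1.toNat + 1 : ℕ) : ℤ) p w hw
      rw [Module.End.mul_apply, hX.graded.eq_bot_of_neg (by simp; lia) e3]
      simp
    rw [e2, add_zero] at e1
    push_cast at e1
    exact e1
  have h10 : hX.graded.strAt p (hX.zeroMode b * (X.Y a).ncoeff m) = t 0 p := by
    simp only [t, h7, sub_zero, add_zero]
  rw [h10, h8, ← mul_sub, sum_add_distrib, sum_add_distrib, ← h9]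
  ring

/-- Zhu's recursion for the insertion of the zero mode of an even vector `a`. -/
theorem hasSum_strAt_zeroMode_mul (hs : hX.TermConverges q y) (hq0 : q ≠ 0) (hq : ‖q‖ < 1) (b : V) :
    HasSum (fun p : ℤ × ℤ => q ^ p.1 * y ^ p.2 *
      hX.graded.strAt p (hX.zeroMode b * (X.Y a).ncoeff m))
      (hs.ψ (smear (A.Y a) (xSeries ^ m * zetaSeries q) b)) := by
  refine S.quasiConformal.graded.induction (P := fun b => HasSum (fun p : ℤ × ℤ =>
      q ^ p.1 * y ^ p.2 *
      hX.graded.strAt p (hX.zeroMode b * (X.Y a).ncoeff m))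
      (hs.ψ (smear (A.Y a) (xSeries ^ m * zetaSeries q) b))) ?_ ?_ ?_ b
  · simp only [map_zero, zero_mul, TopOperators.IsGraded.strAt_zero, mul_zero]
    exact hasSum_zero
  · intro v w hv hw
    rw [map_add, map_add, map_add]
    refine (hv.add hw).congr_fun fun p => ?_
    rw [add_mul, TopOperators.IsGraded.strAt_add, mul_add]
  · exact fun r w hw => hasSum_strAt_zeroMode_mul_of_mem ha haw hs hq0 hq hw

end SUSYModule.IsPositiveEnergy

end Zhu

/-! ### The four components of the block on one joint eigenspace. -/

section BlockTerm

theorem OddExt.par_c₀ {R : Type*} [Ring R] [Superring R] (v : OddExt R) :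
    (Superring.par v).c₀ = Superring.par v.c₀ := rfl

theorem OddExt.par_c₁ {R : Type*} [Ring R] [Superring R] (v : OddExt R) :
    (Superring.par v).c₁ = -Superring.par v.c₁ := rfl

variable {V M : Type*} [AddCommGroup V] [Module ℂ V] [Superspace V]
  [AddCommGroup M] [Module ℂ M] [Superspace M] {A : SUSYVertexAlgebra V} {X : SUSYModule A M}
  {S : StronglyConformal A}

theorem TopOperators.IsGraded.qy_of_mem {O : TopOperators M} (hO : O.IsGraded) (q y : ℂ)
    {p : ℤ × ℤ} {w : M} (hw : w ∈ O.weightSpace p) : hO.qy q y w = (q ^ p.1 * y ^ p.2) • w :=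
  hO.qy_coe q y p ⟨w, hw⟩

theorem TopOperators.IsGraded.hasWeight_qy {O : TopOperators M} (hO : O.IsGraded) (q y : ℂ) :
    O.HasWeight 0 (hO.qy q y) := fun p w hw => by
  rw [hO.qy_of_mem q y hw, add_zero]
  exact Submodule.smul_mem _ _ hw

theorem TopOperators.HasWeight.par {O : TopOperators M} (hP : O.HasWeight 0 (parityOp M))
    {d : ℤ × ℤ} {Z : Module.End ℂ M} (hZ : O.HasWeight d Z) : O.HasWeight d (Superring.par Z) := by
  have := (hP.mul hZ).mul hP
  rwa [zero_add, add_zero] at this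

namespace SUSYModule.IsPositiveEnergy

variable (hX : X.IsPositiveEnergy S) (q y : ℂ)

/-- The components of the supertrace of `B` against the group element on one joint eigenspace. -/
noncomputable def traceComponents (p : ℤ × ℤ) : Module.End ℂ M →+ Grassmann where
  toFun B := ⟨⟨hX.graded.strAt p (B * hX.graded.qy q y),
      hX.graded.strAt p (Superring.par B * ((X.ops S).Q 0 * hX.graded.qy q y))⟩,
    ⟨-hX.graded.strAt p (Superring.par B * (hX.graded.qy q y * (X.ops S).H 0)),
      -hX.graded.strAt p (B * ((X.ops S).Q 0 * (hX.graded.qy q y * (X.ops S).H 0)))⟩⟩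
  map_zero' := by
    simp only [map_zero, zero_mul, TopOperators.IsGraded.strAt_zero, neg_zero]
    rfl
  map_add' B C := by
    simp only [map_add, add_mul, TopOperators.IsGraded.strAt_add, neg_add]
    rfl

theorem par_qy : Superring.par (hX.graded.qy q y) = hX.graded.qy q y := by
  refine hX.graded.linearMap_ext fun p w hw => ?_
  have h3 : ∀ v : M, parityOp M (parityOp M v) = v := Superspace.parity_parity
  have h1 := hX.hasWeight_parity p w hw
  rw [add_zero] at h1
  change parityOp M (hX.graded.qy q y (parityOp M w)) = _
  rw [hX.graded.qy_of_mem q y hw, hX.graded.qy_of_mem q y h1, map_smul, h3]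

include hX in
theorem par_Q₀ : Superring.par ((X.ops S).Q 0) = -(X.ops S).Q 0 := by
  have h := hX.relations.Q_odd 0 (by simp)
  change parityOp M * (X.ops S).Q 0 * parityOp M = _
  rw [h, neg_mul, mul_assoc, parityOp_mul_self, mul_one]

include hX in
theorem par_H₀ : Superring.par ((X.ops S).H 0) = -(X.ops S).H 0 := by
  have h := hX.relations.H_odd 0 (by simp)
  change parityOp M * (X.ops S).H 0 * parityOp M = _
  rw [h, neg_mul, mul_assoc, parityOp_mul_self, mul_one]

theorem blockTerm_eq_finsum (b : V) (p : ℤ × ℤ) :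
    hX.blockTerm q y b p = ∑ᶠ k : ℤ, hX.traceComponents q y p ((X.Y b).ncoeff k) := by
  rw [blockTerm]
  refine finsum_congr fun k => ?_
  have hqy := hX.par_qy q y
  have hQ := hX.par_Q₀
  ext <;> simp [OddExt.map, TopOperators.IsGraded.groupInv, edConst, delVar, epsVar, OddExt.const,
    OddExt.var, traceComponents, sub_eq_add_neg, OddExt.par_c₀,
    OddExt.par_c₁, Superring.par_par, hqy, hQ, mul_assoc, ← TopOperators.IsGraded.strAt_neg]

/-- `Q₀`, `H₀` and `q^(L₀) y^(J₀)` preserve conformal weight, so any other mode of `b` yields an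
operator without diagonal blocks. -/
theorem traceComponents_eq_zero {b : V} {r : ℤ × ℤ} (hb : b ∈ S.ops.weightSpace r) {k : ℤ}
    (hk : k ≠ r.1 - 1) (p : ℤ × ℤ) : hX.traceComponents q y p ((X.Y b).ncoeff k) = 0 := by
  have h0 : ∀ (d : ℤ × ℤ) (Z : Module.End ℂ M), (X.ops S).HasWeight d Z → d.1 ≠ 0 →
      hX.graded.strAt p Z = 0 := fun d Z hZ hd =>
    hX.graded.strAt_eq_zero hX.hasWeight_parity (r := p + d)
      (fun h => hd (by simpa using congrArg Prod.fst h)) (hZ p)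
  have hB := hX.hasWeight_ncoeff hb k
  have hB' := hX.hasWeight_parity.par hB
  have hq := hX.graded.hasWeight_qy q y
  have hQ := hX.relations.hasWeight_Q 0 (by simp)
  have hH := hX.relations.hasWeight_H 0 (by simp)
  have hk' : r.1 - k - 1 ≠ 0 := by lia
  rw [traceComponents, AddMonoidHom.coe_mk, ZeroHom.coe_mk, h0 _ _ (hB.mul hq) (by simpa using hk'),
    h0 _ _ (hB'.mul (hQ.mul hq)) (by simpa using hk'),
    h0 _ _ (hB'.mul (hq.mul hH)) (by simpa using hk'),
    h0 _ _ (hB.mul (hQ.mul (hq.mul hH))) (by simpa using hk'), neg_zero]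
  rfl

theorem blockTerm_eq (b : V) (p : ℤ × ℤ) :
    hX.blockTerm q y b p = hX.traceComponents q y p (hX.zeroMode b) := by
  rw [blockTerm_eq_finsum]
  refine (S.quasiConformal.graded.induction (P := fun b =>
    (Function.support fun k => hX.traceComponents q y p ((X.Y b).ncoeff k)).Finite ∧
    ∑ᶠ k : ℤ, hX.traceComponents q y p ((X.Y b).ncoeff k)
      = hX.traceComponents q y p (hX.zeroMode b)) ?_ ?_ ?_ b).2
  · simp
  · rintro v w ⟨hv, hv'⟩ ⟨hw, hw'⟩
    simp only [map_add, Pi.add_apply]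
    refine ⟨(hv.union hw).subset (Function.support_add _ _), ?_⟩
    rw [finsum_add_distrib hv hw, hv', hw']
  · intro r v hv
    refine ⟨(Set.finite_singleton (r.1 - 1)).subset fun k hk => ?_, ?_⟩
    · by_contra hc
      exact hk (hX.traceComponents_eq_zero q y hv hc p)
    · rw [finsum_eq_single _ (r.1 - 1) fun k hk => hX.traceComponents_eq_zero q y hv hk p,
        TopOperators.IsGraded.zeroMode_of_mem _ _ hv]

variable (b : V) (p : ℤ × ℤ)

theorem blockTerm_c₀_c₀ : (hX.blockTerm q y b p).c₀.c₀ = hX.term q y b p := by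
  rw [blockTerm_eq]
  exact hX.graded.strAt_mul_of_eigen fun w hw => hX.graded.qy_of_mem q y hw

theorem blockTerm_c₀_c₁ : (hX.blockTerm q y b p).c₀.c₁
    = q ^ p.1 * y ^ p.2 * hX.graded.strAt p (Superring.par (hX.zeroMode b) * (X.ops S).Q 0) := by
  rw [blockTerm_eq, ← hX.graded.strAt_mul_of_eigen fun w hw => hX.graded.qy_of_mem q y hw,
      mul_assoc]
  rfl

/-- `H₀` lowers the charge by one, whence the factor `y⁻¹`. -/
theorem qy_H₀ (hy : y ≠ 0) {w : M} (hw : w ∈ (X.ops S).weightSpace p) :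
    hX.graded.qy q y ((X.ops S).H 0 w) = (y⁻¹ * (q ^ p.1 * y ^ p.2)) • (X.ops S).H 0 w := by
  rw [hX.graded.qy_of_mem q y (hX.relations.hasWeight_H 0 (by simp) p w hw)]
  congr 1
  simp only [Prod.fst_add, Prod.snd_add, neg_zero, add_zero, zpow_add₀ hy, zpow_neg_one]
  ring

theorem blockTerm_c₁_c₀ (hy : y ≠ 0) : (hX.blockTerm q y b p).c₁.c₀
    = -y⁻¹ * (q ^ p.1 * y ^ p.2 *
      hX.graded.strAt p (Superring.par (hX.zeroMode b) * (X.ops S).H 0)) := by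
  rw [blockTerm_eq, neg_mul, ← mul_assoc, ← TopOperators.IsGraded.strAt_smul]
  refine congrArg Neg.neg (hX.graded.strAt_congr fun w hw => ?_)
  simp only [Module.End.mul_apply, LinearMap.smul_apply, hX.qy_H₀ q y p hy hw, map_smul]

theorem blockTerm_c₁_c₁ (hy : y ≠ 0) : (hX.blockTerm q y b p).c₁.c₁
    = -y⁻¹ * (q ^ p.1 * y ^ p.2 *
      hX.graded.strAt p (hX.zeroMode b * ((X.ops S).Q 0 * (X.ops S).H 0))) := by
  rw [blockTerm_eq, neg_mul, ← mul_assoc, ← TopOperators.IsGraded.strAt_smul]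
  refine congrArg Neg.neg (hX.graded.strAt_congr fun w hw => ?_)
  simp only [Module.End.mul_apply, LinearMap.smul_apply, hX.qy_H₀ q y p hy hw, map_smul]

end SUSYModule.IsPositiveEnergy

end BlockTerm

/-! ### Derivatives of the supertrace in `q` and `y`. -/

section Derivatives

variable {V M : Type*} [AddCommGroup V] [Module ℂ V] [Superspace V]
  [AddCommGroup M] [Module ℂ M] [Superspace M] {A : SUSYVertexAlgebra V} {X : SUSYModule A M}
  {S : StronglyConformal A}

namespace SUSYModule.IsPositiveEnergy

variable (hX : X.IsPositiveEnergy S)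

section

variable {hX} {q y : ℂ} (hs : hX.TermConverges q y) (hq0 : q ≠ 0) (hq : ‖q‖ < 1)

include hq0 hq

/-- The recursion for `a = j`: the inserted mode is `J₀`, which acts on each block by its charge. -/
theorem hasSum_charge (b : V) : HasSum (fun p : ℤ × ℤ => (p.2 : ℂ) * hX.term q y b p)
    (hs.ψ (S.J (zetaSeries q) b)) := by
  have h := hasSum_strAt_zeroMode_mul S.j_even S.j_mem hs hq0 hq b
  rw [pow_zero, one_mul] at h
  refine h.congr_fun fun p => ?_
  have h1 : hX.graded.strAt p (hX.zeroMode b * (X.Y S.j).ncoeff ((0 : ℕ) : ℤ)) =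
      (p.2 : ℂ) * hX.graded.strAt p (hX.zeroMode b) :=
    hX.graded.strAt_mul_of_eigen fun w hw => (TopOperators.mem_weightSpace_iff.1 hw).2
  rw [h1, term]
  ring

/-- The recursion for the conformal vector: the inserted mode is `L₀`. -/
theorem hasSum_energy (b : V) : HasSum (fun p : ℤ × ℤ => (p.1 : ℂ) * hX.term q y b p)
    (hs.ψ (S.L (xSeries * zetaSeries q) b)) := by
  have h := hasSum_strAt_zeroMode_mul S.ω_even S.ω_mem hs hq0 hq b
  rw [pow_one, S.Y_ω] at h
  refine h.congr_fun fun p => ?_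
  have h2 : (X.Y S.ω).ncoeff ((1 : ℕ) : ℤ) = (X.ops S).L 0 := by
    simp [StronglyConformal.ω, SUSYModule.ops, topModes]
  have h1 : hX.graded.strAt p (hX.zeroMode b * (X.Y S.ω).ncoeff ((1 : ℕ) : ℤ)) =
      (p.1 : ℂ) * hX.graded.strAt p (hX.zeroMode b) :=
    hX.graded.strAt_mul_of_eigen fun w hw => by
      rw [h2]; exact (TopOperators.mem_weightSpace_iff.1 hw).1
  rw [h1, term]
  ring

/-- The supertrace vanishes on residues against total derivatives of `ζ̄`. -/
theorem ψ_smear_laurentD (k m : ℕ) {a : V} (ha : HasParity 0 a)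
    (haw : a ∈ S.ops.weightSpace ((m : ℤ) + 1, 0)) (b : V) :
    hs.ψ (smear (A.Y a) (xSeries ^ m * laurentD^[k + 1] (zetaSeries q)) b) = 0 := by
  induction k generalizing m a with
  | zero =>
    have h1 := hasSum_strAt_zeroMode_mul ha haw hs hq0 hq b
    have h2 := hasSum_strAt_zeroMode_mul (SUSYVertexAlgebra.hasParity_T ha)
        (S.T_mem haw) hs hq0 hq b
    -- Both sides are values of the recursion, for `∂a` and for `a`, and `(∂a)₍ₘ₊₁₎ = -(m + 1) a₍ₘ₎`
    -- on the module.
    have h3 : hs.ψ (smear (A.Y (A.T a)) (xSeries ^ (m + 1) * zetaSeries q) b)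
        = -((m : ℂ) + 1) * hs.ψ (smear (A.Y a) (xSeries ^ m * zetaSeries q) b) := by
      refine h2.unique ((h1.mul_left (-((m : ℂ) + 1))).congr_fun fun p => ?_)
      rw [X.translationCovariant S, mul_smul_comm, TopOperators.IsGraded.strAt_smul]
      push_cast
      rw [add_sub_cancel_right]
      ring
    rw [zero_add, Function.iterate_one, smear_pow_mul_laurentD S, LinearMap.sub_apply, map_sub, h3,
      LinearMap.smul_apply, map_smul, smul_eq_mul, sub_self]
  | succ k ih =>
    -- Integration by parts reduces a higher derivative to the previous order for `a` and for `∂a`,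
    -- which is why the induction runs over all vectors.
    rw [Function.iterate_succ_apply', smear_pow_mul_laurentD S, LinearMap.sub_apply, map_sub,
      LinearMap.smul_apply, map_smul, ih m ha haw, ih (m + 1) (SUSYVertexAlgebra.hasParity_T ha)
        (S.T_mem haw),
      smul_zero, sub_zero]

theorem ψ_J_laurentD (k : ℕ) (b : V) : hs.ψ (S.J (laurentD^[k + 1] (zetaSeries q)) b) = 0 := by
  have h := ψ_smear_laurentD hs hq0 hq k 0 S.j_even S.j_mem b
  rwa [pow_zero, one_mul] at h

theorem ψ_E_laurentD (k : ℕ) (b : V) : hs.ψ (S.E (laurentD^[k + 1] (zetaSeries q)) b) = 0 := by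
  have h := ψ_smear_laurentD hs hq0 hq k 1 S.ω_even S.ω_mem b
  rw [pow_one, S.Y_ω] at h
  rw [StronglyConformal.E, LinearMap.sub_apply, map_sub, ← Function.iterate_succ_apply' laurentD,
    ψ_J_laurentD hs hq0 hq, sub_zero]
  exact h

theorem ψ_J_wpSeries (b : V) : hs.ψ (S.J (wpSeries q) b) = 0 := by
  have h := ψ_J_laurentD hs hq0 hq 0 b
  rw [zero_add, Function.iterate_one, laurentD_zetaSeries hq0 hq, StronglyConformal.J, smear_neg,
    LinearMap.neg_apply, map_neg, neg_eq_zero] at h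
  exact h

theorem ψ_E_wpSeries (b : V) : hs.ψ (S.E (wpSeries q) b) = 0 := by
  have h := ψ_E_laurentD hs hq0 hq 0 b
  rwa [zero_add, Function.iterate_one, laurentD_zetaSeries hq0 hq, S.E_neg,
    LinearMap.neg_apply, map_neg, neg_eq_zero] at h

/-- `ζ̄ ℘̄ + q ∂_q ζ̄` is a second derivative of `ζ̄`, so its residue is killed by `ψ`. -/
theorem ψ_J_zetaSeries_mul_wpSeries (b : V) :
    hs.ψ (S.J (zetaSeries q * wpSeries q) b) = -hs.ψ (S.J (zetaQDeriv q) b) := by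
  have h := ψ_J_laurentD hs hq0 hq 1 b
  have h2 : S.J (zetaSeries q * wpSeries q) + S.J (zetaQDeriv q)
      = (1 / 2 : ℂ) • S.J (laurentD^[1 + 1] (zetaSeries q)) := by
    rw [StronglyConformal.J, StronglyConformal.J, ← smear_add, zetaSeries_mul_wpSeries hq0 hq,
      smear_C_mul]
    rfl
  rw [eq_neg_iff_add_eq_zero, ← map_add, ← LinearMap.add_apply, h2, LinearMap.smul_apply, map_smul,
    h, smul_zero]

theorem ψ_E_zetaSeries_mul_wpSeries (b : V) :
    hs.ψ (S.E (zetaSeries q * wpSeries q) b) = -hs.ψ (S.E (zetaQDeriv q) b) := by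
  have h := ψ_E_laurentD hs hq0 hq 1 b
  have h2 : S.E (zetaSeries q * wpSeries q) + S.E (zetaQDeriv q)
      = (1 / 2 : ℂ) • S.E (laurentD^[1 + 1] (zetaSeries q)) := by
    rw [← S.E_add, zetaSeries_mul_wpSeries hq0 hq, S.E_C_mul]
    rfl
  rw [eq_neg_iff_add_eq_zero, ← map_add, ← LinearMap.add_apply, h2, LinearMap.smul_apply, map_smul,
    h, smul_zero]

/-- The two operators differ by a residue against a total derivative. `E` is preferred because of
its commutation with `Q₋₁ + Q₀`. -/
theorem ψ_L_eq (b : V) : hs.ψ (S.L (xSeries * zetaSeries q) b) = hs.ψ (S.E (zetaSeries q) b) := by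
  have h := ψ_J_laurentD hs hq0 hq 0 b
  rw [zero_add, Function.iterate_one] at h
  rw [StronglyConformal.E, LinearMap.sub_apply, map_sub, h, sub_zero]

end

/-- The supertrace on the even family. -/
noncomputable def trace (q y : ℂ) (b : V) : ℂ := ∑' p, hX.term q y b p

theorem TermConverges.trace_eq {q y : ℂ} (hs : hX.TermConverges q y) (b : V) :
    hX.trace q y b = hs.ψ b := rfl

variable {U : Set (ℂ × ℂ)} (hUo : IsOpen U) (hU : ∀ p ∈ U, 0 < ‖p.1‖ ∧ ‖p.1‖ < 1 ∧ p.2 ≠ 0)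
  (hs : ∀ p ∈ U, hX.TermConverges p.1 p.2) {q y : ℂ} (hqy : (q, y) ∈ U)

include hUo hU hs hqy

theorem hasDerivAt_trace_charge (b : V) :
    HasDerivAt (fun z => hX.trace q z b) (y⁻¹ * (hs _ hqy).ψ (S.J (zetaSeries q) b)) y := by
  obtain ⟨h0, h1, hy⟩ := hU _ hqy
  have hq0 : q ≠ 0 := norm_pos_iff.1 h0
  have h := hasDerivAt_tsum_zpow (U := {z | (q, z) ∈ U})
    (c := fun p : ℤ × ℤ => q ^ p.1 * hX.graded.strAt p (hX.zeroMode b)) (e := fun p => p.2)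
    (hUo.preimage (by fun_prop)) (fun h => (hU _ h).2.2 rfl)
    (fun z hz => ((hs _ hz) b).congr fun p => by rw [term]; ring) hqy
  have h3 : ∀ z, hX.trace q z b = ∑' p : ℤ × ℤ, q ^ p.1 * hX.graded.strAt p
      (hX.zeroMode b) * z ^ p.2 :=
    fun z => tsum_congr fun p => by rw [term]; ring
  simp only [h3]
  refine h.2.congr_deriv ?_
  rw [← ((hasSum_charge (hs _ hqy) hq0 h1 b).mul_left y⁻¹).tsum_eq]
  refine tsum_congr fun p => ?_
  rw [term, zpow_sub_one₀ hy]
  ring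

theorem hasDerivAt_trace_energy (b : V) :
    HasDerivAt (fun z => hX.trace z y b)
      (q⁻¹ * (hs _ hqy).ψ (S.L (xSeries * zetaSeries q) b)) q := by
  obtain ⟨h0, h1, hy⟩ := hU _ hqy
  have hq0 : q ≠ 0 := norm_pos_iff.1 h0
  have h := hasDerivAt_tsum_zpow (U := {z | (z, y) ∈ U})
    (c := fun p : ℤ × ℤ => y ^ p.2 * hX.graded.strAt p (hX.zeroMode b)) (e := fun p => p.1)
    (hUo.preimage (by fun_prop)) (fun h => (hU _ h).1.ne' norm_zero)
    (fun z hz => ((hs _ hz) b).congr fun p => by rw [term]; ring) hqy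
  have h3 : ∀ z, hX.trace z y b = ∑' p : ℤ × ℤ, y ^ p.2 * hX.graded.strAt p
      (hX.zeroMode b) * z ^ p.1 :=
    fun z => tsum_congr fun p => by rw [term]; ring
  simp only [h3]
  refine h.2.congr_deriv ?_
  rw [← ((hasSum_energy (hs _ hqy) hq0 h1 b).mul_left q⁻¹).tsum_eq]
  refine tsum_congr fun p => ?_
  rw [term, zpow_sub_one₀ hq0]
  ring

theorem hasDerivAt_trace_energy' (b : V) :
    HasDerivAt (fun z => hX.trace z y b) (q⁻¹ * hX.trace q y (S.E (zetaSeries q) b)) q := by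
  obtain ⟨h0, h1, hy⟩ := hU _ hqy
  rw [(hs _ hqy).trace_eq, ← ψ_L_eq (hs _ hqy) (norm_pos_iff.1 h0) h1]
  exact hX.hasDerivAt_trace_energy hUo hU hs hqy b

/-- The derivative in `q` of the supertrace of a residue against `ζ̄`. -/
theorem hasDerivAt_trace_pairing {F : ℤ → V} (hF : EventuallyZero F) :
    HasDerivAt (fun z => hX.trace z y (pairing (zetaSeries z) F))
      (q⁻¹ * (hX.trace q y (S.E (zetaSeries q) (pairing (zetaSeries q) F))
        + hX.trace q y (pairing (zetaQDeriv q) F))) q := by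
  obtain ⟨h0, h1, hy⟩ := hU _ hqy
  have hq0 : q ≠ 0 := norm_pos_iff.1 h0
  obtain ⟨N, hN⟩ := hF
  have hF : EventuallyZero F := ⟨N, hN⟩
  have hev : ∀ᶠ z in nhds q, (z, y) ∈ U :=
    (hUo.preimage (f := fun z => (z, y)) (by fun_prop)).mem_nhds hqy
  -- Against a fixed family only finitely many Taylor coefficients of `ζ̄` matter, so the product
  -- rule applies; differentiating these coefficients gives the term with `zetaQDeriv`.
  have hpair : ∀ z, z ≠ 0 → ‖z‖ < 1 → pairing (zetaSeries z) F = F (-1) + (1 / 2 : ℂ) • F 0 +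
      ∑ i ∈ Finset.range N, (iteratedDeriv i (lambertSum 0 0 1 (-1) z) 1 /
        (i.factorial : ℂ)) • F i := by
    intro z hz0 hz
    rw [zetaSeries_eq hz0 hz, add_pairing _ _ hF, add_pairing _ _ hF, single_pairing, one_smul,
      HahnSeries.C_apply, single_pairing,
      pairing_eq_sum_range (fun i hi => taylorAtOne_coeff_of_neg _ hi) hN, add_assoc]
    simp only [taylorAtOne_coeff_natCast]
  have hQ : pairing (zetaQDeriv q) F = ∑ i ∈ Finset.range N,
      (iteratedDeriv i (lambertSum 1 1 1 (-1) q) 1 / (i.factorial : ℂ)) • F i := by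
    rw [zetaQDeriv, pairing_eq_sum_range (fun i hi => taylorAtOne_coeff_of_neg _ hi) hN]
    simp only [taylorAtOne_coeff_natCast]
  have hd : ∀ b, HasDerivAt (fun z => hX.trace z y b)
      (q⁻¹ * (hs _ hqy).ψ (S.E (zetaSeries q) b)) q :=
    hX.hasDerivAt_trace_energy' hUo hU hs hqy
  have hsum := HasDerivAt.fun_sum (u := Finset.range N) fun i _ =>
    (hasDerivAt_taylor_lambertSum 0 0 1 (-1) hq0 h1 i).mul (hd (F i))
  have hall := ((hd (F (-1))).add ((hd (F 0)).const_mul (1 / 2 : ℂ))).add hsum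
  refine (hall.congr_of_eventuallyEq ?_).congr_deriv ?_
  · filter_upwards [hev] with z hz
    obtain ⟨g0, g1, -⟩ := hU _ hz
    rw [hpair z (norm_pos_iff.1 g0) g1, (hs _ hz).trace_eq]
    simp only [Pi.add_apply, map_add, map_smul, map_sum, smul_eq_mul]
    rfl
  · rw [hQ, hpair q hq0 h1, (hs _ hqy).trace_eq, (hs _ hqy).trace_eq]
    simp only [map_add, map_smul, map_sum, smul_eq_mul, mul_add, Finset.mul_sum]
    rw [Finset.sum_add_distrib]
    simp only [(hs _ hqy).trace_eq]
    have e1 : ∀ i, q⁻¹ * (iteratedDeriv i (lambertSum (0 + 1) (0 + 1) 1 (-1) q) 1 /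
      (i.factorial : ℂ)) * (hs _ hqy).ψ (F i) = q⁻¹ * (iteratedDeriv i (lambertSum 1 1 1 (-1) q) 1 /
      (i.factorial : ℂ) * (hs _ hqy).ψ (F i)) := fun i => by ring
    have e2 : ∀ i, iteratedDeriv i (lambertSum 0 0 1 (-1) q) 1 / (i.factorial : ℂ) *
      (q⁻¹ * (hs _ hqy).ψ (S.E (zetaSeries q) (F i))) = q⁻¹ *
      (iteratedDeriv i (lambertSum 0 0 1 (-1) q) 1 / (i.factorial : ℂ) *
      (hs _ hqy).ψ (S.E (zetaSeries q) (F i))) := fun i => by ring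
    simp only [e1, e2]
    ring

/-- The second derivative in `q` of the supertrace. -/
theorem hasDerivAt_trace_E (b : V) :
    HasDerivAt (fun z => hX.trace z y (S.E (zetaSeries z) b))
      (q⁻¹ * (hX.trace q y (S.E (zetaSeries q) (S.E (zetaSeries q) b))
        + hX.trace q y (S.E (zetaQDeriv q) b))) q := by
  have h := hX.hasDerivAt_trace_pairing hUo hU hs hqy (S.eventuallyZero_E b)
  simp only [← S.E_apply] at h
  exact h

/-- The mixed second derivatives of the supertrace agree. -/
theorem trace_J_E (b : V) : hX.trace q y (S.J (zetaSeries q) (S.E (zetaSeries q) b))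
    = hX.trace q y (S.E (zetaSeries q) (S.J (zetaSeries q) b))
      + hX.trace q y (S.J (zetaQDeriv q) b) := by
  obtain ⟨h0, h1, hy⟩ := hU _ hqy
  have hq0 : q ≠ 0 := norm_pos_iff.1 h0
  have hz : ∀ p ∈ U, p.1 ≠ 0 ∧ ‖p.1‖ < 1 := fun p hp => ⟨norm_pos_iff.1 (hU p hp).1, (hU p hp).2.1⟩
  have evq : ∀ᶠ z in nhds q, (z, y) ∈ U :=
    (hUo.preimage (f := fun z => (z, y)) (by fun_prop)).mem_nhds hqy
  have evy : ∀ᶠ z in nhds y, (q, z) ∈ U :=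
    (hUo.preimage (f := fun z => (q, z)) (by fun_prop)).mem_nhds hqy
  have d1 : HasDerivAt (fun z => hX.trace q z (S.E (zetaSeries q) b))
      (y⁻¹ * hX.trace q y (S.J (zetaSeries q) (S.E (zetaSeries q) b))) y :=
    hX.hasDerivAt_trace_charge hUo hU hs hqy _
  have d2 : HasDerivAt (fun z => hX.trace z y (S.J (zetaSeries z) b))
      (q⁻¹ * (hX.trace q y (S.E (zetaSeries q) (S.J (zetaSeries q) b))
        + hX.trace q y (S.J (zetaQDeriv q) b))) q :=
    hX.hasDerivAt_trace_pairing hUo hU hs hqy (S.eventuallyZero_J b)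
  -- Both mixed derivatives are computed termwise as well, and each term then acquires the same
  -- factor `p.1 * p.2`.
  have e1 := hasDerivAt_tsum_zpow (U := {z | (q, z) ∈ U})
    (c := fun p : ℤ × ℤ => (p.1 : ℂ) * (q ^ p.1 * hX.graded.strAt p (hX.zeroMode b)))
    (e := fun p => p.2)
    (hUo.preimage (by fun_prop)) (fun h => (hU _ h).2.2 rfl)
    (fun z hz' => (hasSum_energy (hs _ hz') (hz _ hz').1 (hz _ hz').2 b).summable.congr
      fun p => by rw [term]; ring) hqy
  have e2 := hasDerivAt_tsum_zpow (U := {z | (z, y) ∈ U})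
    (c := fun p : ℤ × ℤ => (p.2 : ℂ) * (y ^ p.2 * hX.graded.strAt p (hX.zeroMode b)))
    (e := fun p => p.1)
    (hUo.preimage (by fun_prop)) (fun h => (hU _ h).1.ne' norm_zero)
    (fun z hz' => (hasSum_charge (hs _ hz') (hz _ hz').1 (hz _ hz').2 b).summable.congr
      fun p => by rw [term]; ring) hqy
  have f1 := d1.congr_of_eventuallyEq (f₁ := fun z => ∑' p : ℤ × ℤ,
    (p.1 : ℂ) * (q ^ p.1 * hX.graded.strAt p (hX.zeroMode b)) * z ^ p.2) (by
      filter_upwards [evy] with z hz'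
      rw [(hs _ hz').trace_eq, ← ψ_L_eq (hs _ hz') hq0 h1,
        ← (hasSum_energy (hs _ hz') hq0 h1 b).tsum_eq]
      exact tsum_congr fun p => by rw [term]; ring)
  have f2 := d2.congr_of_eventuallyEq (f₁ := fun z => ∑' p : ℤ × ℤ,
    (p.2 : ℂ) * (y ^ p.2 * hX.graded.strAt p (hX.zeroMode b)) * z ^ p.1) (by
      filter_upwards [evq] with z hz'
      rw [(hs _ hz').trace_eq, ← (hasSum_charge (hs _ hz') (hz _ hz').1 (hz _ hz').2 b).tsum_eq]
      exact tsum_congr fun p => by rw [term]; ring)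
  have g1 := f1.unique e1.2
  have g2 := f2.unique e2.2
  rw [inv_mul_eq_iff_eq_mul₀ hy, ← tsum_mul_left] at g1
  rw [inv_mul_eq_iff_eq_mul₀ hq0, ← tsum_mul_left] at g2
  rw [g1, g2]
  refine tsum_congr fun p => ?_
  rw [zpow_sub_one₀ hy, zpow_sub_one₀ hq0]
  field_simp

end SUSYModule.IsPositiveEnergy

end Derivatives

/-! ### Odd components of the block in terms of even supertraces. -/

section Components

variable {V M : Type*} [AddCommGroup V] [Module ℂ V] [Superspace V]
  [AddCommGroup M] [Module ℂ M] [Superspace M] {A : SUSYVertexAlgebra V} {X : SUSYModule A M}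
  {S : StronglyConformal A}

/-- Reindexing by the charge is how carrying an operator of charge `k` around the trace produces
`yᵏ`. -/
theorem hasSum_shift_charge {q y : ℂ} (hy : y ≠ 0) {f : ℤ × ℤ → ℂ} {s : ℂ}
    (h : HasSum (fun p : ℤ × ℤ => q ^ p.1 * y ^ p.2 * f p) s) (k : ℤ) :
    HasSum (fun p : ℤ × ℤ => q ^ p.1 * y ^ p.2 * f (p - (0, k))) (y ^ k * s) := by
  refine (((Equiv.subRight ((0 : ℤ), k)).hasSum_iff.2 h).mul_left (y ^ k)).congr_fun fun p => ?_
  simp only [Function.comp_apply, Equiv.subRight_apply, Prod.fst_sub, Prod.snd_sub, sub_zero,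
    zpow_sub₀ hy]
  have := zpow_ne_zero k hy
  field_simp

namespace SUSYModule.IsPositiveEnergy

variable {hX : X.IsPositiveEnergy S} {q y : ℂ}

theorem EvenBlockConverges.termConverges (hs : hX.EvenBlockConverges q y) :
    hX.TermConverges q y := fun b => (hs b).congr fun p => hX.blockTerm_c₀_c₀ q y b p

theorem BlockConverges.termConverges (hs : hX.BlockConverges q y) : hX.TermConverges q y :=
  EvenBlockConverges.termConverges fun b => (hs b).1

variable (hX) in
theorem evenBlock_eq_trace (b : V) : hX.evenBlock q y b = hX.trace q y b :=
  tsum_congr fun p => hX.blockTerm_c₀_c₀ q y b p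

variable (hX) in
theorem strAt_Q₀_mul (Z : Module.End ℂ M) (p : ℤ × ℤ) : hX.graded.strAt p ((X.ops S).Q 0 * Z)
    = hX.graded.strAt (p - (0, 1)) (Superring.par Z * (X.ops S).Q 0) := by
  have h := hX.graded.strAt_mul hX.hasWeight_parity (hX.relations.hasWeight_Q 0 (by simp)) Z
    (p - (0, 1))
  rwa [neg_zero, sub_add_cancel] at h

variable (hX) in
theorem strAt_H₀_mul (Z : Module.End ℂ M) (p : ℤ × ℤ) : hX.graded.strAt p ((X.ops S).H 0 * Z)
    = hX.graded.strAt (p - (0, -1)) (Superring.par Z * (X.ops S).H 0) := by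
  have h := hX.graded.strAt_mul hX.hasWeight_parity (hX.relations.hasWeight_H 0 (by simp)) Z
    (p - (0, -1))
  rwa [neg_zero, sub_add_cancel] at h

variable (hX) in
theorem zeroMode_Q' (b : V) : hX.zeroMode (S.Q' b) = (X.ops S).Q 0 * hX.zeroMode b
    - Superring.par (hX.zeroMode b) * (X.ops S).Q 0 :=
  (IsQuasiConformalAction.comm_Q_zeroMode hX S.quasiConformal.graded S.quasiConformal.relations
    X.Y_even b).symm

variable (hX) in
theorem zeroMode_H₀ (b : V) : hX.zeroMode (S.ops.H 0 b) = (X.ops S).H 0 * hX.zeroMode b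
    - Superring.par (hX.zeroMode b) * (X.ops S).H 0 :=
  (IsQuasiConformalAction.comm_H_zeroMode hX S.quasiConformal.graded S.quasiConformal.relations
    X.Y_even b).symm

variable (hs : hX.BlockConverges q y) (hy : y ≠ 0)

include hs hy

/-- The zero mode of `(Q₋₁ + Q₀) b` is the supercommutator of `Q₀` with that of `b`. Carrying `Q₀`
around past `y^(J₀)` multiplies its supertrace by `y`. -/
theorem trace_Q' (b : V) : hX.trace q y (S.Q' b) = (y - 1) * (hX.block q y b).c₀.c₁ := by
  have h1 : HasSum (fun p : ℤ × ℤ => q ^ p.1 * y ^ p.2 *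
      hX.graded.strAt p (Superring.par (hX.zeroMode b) * (X.ops S).Q 0)) (hX.block q y b).c₀.c₁ :=
    (hs b).2.1.hasSum.congr_fun fun p => (hX.blockTerm_c₀_c₁ q y b p).symm
  have h2 := (hasSum_shift_charge hy h1 1).sub h1
  rw [zpow_one] at h2
  rw [sub_one_mul, ← h2.tsum_eq]
  refine tsum_congr fun p => ?_
  rw [term, zeroMode_Q', TopOperators.IsGraded.strAt_sub, hX.strAt_Q₀_mul]
  ring

theorem hasSum_c₁_c₀ (b : V) : HasSum (fun p : ℤ × ℤ => q ^ p.1 * y ^ p.2 *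
      hX.graded.strAt p (Superring.par (hX.zeroMode b) * (X.ops S).H 0))
      (-y * (hX.block q y b).c₁.c₀) := by
  refine ((hs b).2.2.1.hasSum.mul_left (-y)).congr_fun fun p => ?_
  rw [hX.blockTerm_c₁_c₀ q y b p hy]
  field_simp

/-- As for `Q₀`, now with charge `-1`. The factor `y⁻¹ - 1` meets the `-y` that relates the
`ε`-component to the supertrace with `H₀` on the right. -/
theorem trace_H₀ (b : V) : hX.trace q y (S.ops.H 0 b) = (y - 1) * (hX.block q y b).c₁.c₀ := by
  have h1 := hasSum_c₁_c₀ hs hy b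
  have h2 := (hasSum_shift_charge hy h1 (-1)).sub h1
  trans y ^ (-1 : ℤ) * (-y * (hX.block q y b).c₁.c₀) - -y * (hX.block q y b).c₁.c₀
  · rw [← h2.tsum_eq]
    refine tsum_congr fun p => ?_
    rw [term, zeroMode_H₀, TopOperators.IsGraded.strAt_sub, hX.strAt_H₀_mul]
    ring
  · rw [zpow_neg_one]
    field_simp
    ring

/-- Carrying `Q₀` around turns the left side into supertraces of `o(b) Q₀ H₀` and `o(b) H₀ Q₀`. The
first is the `εδ`-component up to the factor `-y`; the second differs from it through `H₀ Q₀ + Q₀ H₀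
= L₀`, whose insertion is the energy derivative. -/
theorem block_Q'_c₁_c₀ (hq0 : q ≠ 0) (hq : ‖q‖ < 1) (b : V) : (hX.block q y (S.Q' b)).c₁.c₀
    = (1 - y) * (hX.block q y b).c₁.c₁ - hX.trace q y (S.E (zetaSeries q) b) := by
  have h1 : HasSum (fun p : ℤ × ℤ => q ^ p.1 * y ^ p.2 * hX.graded.strAt p
      (hX.zeroMode b * ((X.ops S).Q 0 * (X.ops S).H 0))) (-y * (hX.block q y b).c₁.c₁) := by
    refine ((hs b).2.2.2.hasSum.mul_left (-y)).congr_fun fun p => ?_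
    rw [hX.blockTerm_c₁_c₁ q y b p hy]
    field_simp
  have hH := hX.relations.H_Q 0 (by simp) 0 (by simp)
  simp only [add_zero, Int.cast_zero, zero_smul, sub_zero, mul_zero, zero_div, ite_self] at hH
  have h2 := (hasSum_energy hs.termConverges hq0 hq b).sub h1
  rw [ψ_L_eq hs.termConverges hq0 hq, ← TermConverges.trace_eq] at h2
  have h3 : HasSum (fun p : ℤ × ℤ => q ^ p.1 * y ^ p.2 * hX.graded.strAt p
      (hX.zeroMode b * ((X.ops S).H 0 * (X.ops S).Q 0)))
      (hX.trace q y (S.E (zetaSeries q) b) - -y * (hX.block q y b).c₁.c₁) := by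
    refine h2.congr_fun fun p => ?_
    have h4 : hX.graded.strAt p (hX.zeroMode b * (X.ops S).L 0)
        = (p.1 : ℂ) * hX.graded.strAt p (hX.zeroMode b) :=
      hX.graded.strAt_mul_of_eigen fun w hw => (TopOperators.mem_weightSpace_iff.1 hw).1
    rw [← hH, mul_add, TopOperators.IsGraded.strAt_add] at h4
    rw [term]
    linear_combination q ^ p.1 * y ^ p.2 * h4
  have h5 := h1.add (hasSum_shift_charge hy h3 1)
  have h6 := (hasSum_c₁_c₀ hs hy (S.Q' b)).unique (h5.congr_fun fun p => ?_)
  · rw [zpow_one] at h6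
    apply mul_left_cancel₀ (neg_ne_zero.2 hy)
    rw [h6]
    ring
  · have e : Superring.par (hX.zeroMode (S.Q' b)) * (X.ops S).H 0
        = hX.zeroMode b * ((X.ops S).Q 0 * (X.ops S).H 0)
          - (X.ops S).Q 0 * (Superring.par (hX.zeroMode b) * (X.ops S).H 0) := by
      rw [zeroMode_Q', map_sub, map_mul, map_mul, Superring.par_par, hX.par_Q₀]
      noncomm_ring
    rw [e, TopOperators.IsGraded.strAt_sub, hX.strAt_Q₀_mul, map_mul, Superring.par_par, hX.par_H₀,
      mul_neg, neg_mul, TopOperators.IsGraded.strAt_neg, mul_assoc (hX.zeroMode b)]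
    ring

/-- The components of the conformal block in terms of supertraces on the even family. -/
theorem block_eq (hq0 : q ≠ 0) (hq : ‖q‖ < 1) (hy1 : y ≠ 1) (b : V) : hX.block q y b =
    ⟨⟨hX.trace q y b, -(1 - y)⁻¹ * hX.trace q y (S.Q' b)⟩,
      ⟨-(1 - y)⁻¹ * hX.trace q y (S.ops.H 0 b),
        -(1 - y)⁻¹ ^ 2 * hX.trace q y (S.ops.H 0 (S.Q' b))
          + (1 - y)⁻¹ * hX.trace q y (S.E (zetaSeries q) b)⟩⟩ := by
  have h1 : 1 - y ≠ 0 := sub_ne_zero.2 hy1.symm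
  have h2 := block_Q'_c₁_c₀ hs hy hq0 hq b
  have h3 := trace_H₀ hs hy (S.Q' b)
  have h4 := trace_H₀ hs hy b
  have h5 := trace_Q' hs hy b
  -- Two expressions for the `ε`-component at `(Q₋₁ + Q₀) b`; equating them determines the
  -- `εδ`-component at `b`, as `y ≠ 1`.
  rw [h2] at h3
  ext
  · exact hX.evenBlock_eq_trace b
  · dsimp only
    rw [h5]
    field_simp
    ring
  · dsimp only
    rw [h4]
    field_simp
    ring
  · dsimp only
    rw [h3]
    field_simp
    ring

end SUSYModule.IsPositiveEnergy

end Components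

/-! ### The super residues in components. -/

section SuperResidue

variable {V : Type*} [AddCommGroup V] [Module ℂ V] [Superspace V] {A : SUSYVertexAlgebra V}

theorem OddExt.smul_c₀ {R W : Type*} [Ring R] [Superring R] [Add W] [SMul R W] (f : OddExt R)
    (v : OddExt W) : (f • v).c₀ = f.c₀ • v.c₀ := rfl

theorem OddExt.smul_c₁ {R W : Type*} [Ring R] [Superring R] [Add W] [SMul R W] (f : OddExt R)
    (v : OddExt W) : (f • v).c₁ = f.c₁ • v.c₀ + Superring.par f.c₀ • v.c₁ := rfl

theorem HahnSeries.superring_par (g : HahnSeries ℤ ℂ) : Superring.par g = g := rfl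

theorem residue_add (v w : HahnModule ℤ ℂ V) : residue (v + w) = residue v + residue w := rfl

/-- Integration by parts in `(D h)(x) = L(x) + ∂_x J(x)` against `x g` produces `-(g + x g')` with
`J`; the extra residue of `g J` cancels the part in which `x` was differentiated. -/
theorem StronglyConformal.smear_D_h_add (S : StronglyConformal A) (g : HahnSeries ℤ ℂ) :
    smear (A.Y (A.D S.h)) (xSeries * g) + smear (A.Y S.j) g = S.E g := by
  have hx : LaurentSeries.derivative ℂ xSeries = 1 := by
    have h := laurentD_taylorAtOne (f := fun z => z) (g := fun z => z) (by fun_prop)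
      (by simp)
    rw [taylorAtOne_id, laurentD] at h
    exact mul_left_cancel₀ xSeries_ne_zero (by rw [h, mul_one])
  have h := smear_T S S.j (xSeries * g)
  rw [derivative_mul, hx, one_mul, smear_add] at h
  ext b
  have h2 := LinearMap.ext_iff.1 h b
  rw [StronglyConformal.E, StronglyConformal.L, StronglyConformal.virasoro]
  simp only [LinearMap.add_apply, LinearMap.sub_apply, LinearMap.neg_apply] at h2 ⊢
  have h3 : smear (A.Y (A.D S.h) - A.Y (A.T S.j)) (xSeries * g) b
      = smear (A.Y (A.D S.h)) (xSeries * g) b - smear (A.Y (A.T S.j)) (xSeries * g) b := by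
    simp only [smear_apply, map_sub, Pi.sub_apply, LinearMap.sub_apply]
    exact pairing_sub _ (HahnModule.eventuallyZero _ b) (HahnModule.eventuallyZero _ b)
  rw [h3, h2]
  change _ = _ - smear (A.Y S.j) (laurentD g) b
  rw [laurentD]
  abel

theorem StronglyConformal.residue_D_h_add (S : StronglyConformal A) (g : HahnSeries ℤ ℂ) (b : V) :
    residue ((g * xSeries) • A.Y (A.D S.h) b + g • A.Y S.j b) = S.E g b := by
  rw [residue_add, residue_smul, residue_smul, mul_comm, ← LinearMap.add_apply, S.smear_D_h_add]

theorem StronglyConformal.residue_D_h_add_add (S : StronglyConformal A) (g e : HahnSeries ℤ ℂ)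
    (b : V) : residue ((g * xSeries) • A.Y (A.D S.h) b + (g + e) • A.Y S.j b)
      = S.E g b + S.J e b := by
  rw [residue_add, residue_smul, residue_smul, mul_comm, ← S.smear_D_h_add, smear_add,
    StronglyConformal.J, LinearMap.add_apply, LinearMap.add_apply, add_assoc]

/-- In the `ε`-component the denominator `x` of the term with `℘̄ / x` cancels the coefficient `x`
of the superfield of `h`. -/
theorem superResidue_superZeta_one (S : StronglyConformal A) (q y : ℂ) (b : V) :
    superResidue ((SuperFunction.superZeta q y * SuperFunction.x) • A.superfield S.h b
      + (SuperFunction.superZeta q y * SuperFunction.theta) • A.superfield S.j b)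
    = ⟨⟨S.E (zetaSeries q) b, 0⟩, ⟨(1 - y)⁻¹ • S.H (wpSeries q) b,
        -(1 - y)⁻¹ • S.E (zetaSeries q * wpSeries q) b⟩⟩ := by
  rw [SuperFunction.superZeta, SuperFunction.ofConst]
  generalize hc : (HahnSeries.C (1 - y)⁻¹ : HahnSeries ℤ ℂ) = c
  ext <;> simp [superResidue, OddExt.map, SuperFunction.x,
    SuperFunction.theta, SuperFunction.ofSeries, SuperFunction.eps,
    SuperFunction.del, SUSYVertexAlgebra.superfield, edConst, delVar, epsVar, OddExt.const,
    OddExt.var, sub_eq_add_neg, OddExt.par_c₀, OddExt.par_c₁, OddExt.smul_c₀, OddExt.smul_c₁,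
    HahnSeries.superring_par]
  · exact S.residue_D_h_add _ b
  · rfl
  · rw [mul_assoc, div_mul_cancel₀ _ xSeries_ne_zero, residue_smul, ← hc, smear_C_mul,
      sub_eq_add_neg]
    rfl
  · rw [S.residue_D_h_add, show zetaSeries q * -(c * -1 * -1 * wpSeries q)
      = -(c * (zetaSeries q * wpSeries q)) by ring, S.E_neg, ← hc, S.E_C_mul, sub_eq_add_neg]
    rfl

theorem superResidue_superZeta_two (S : StronglyConformal A) (q : ℂ) {y : ℂ} (hy1 : y ≠ 1) (b : V) :
    superResidue ((SuperFunction.superZeta q y * (SuperFunction.x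
          + SuperFunction.eps * SuperFunction.theta)) • A.superfield S.h b
      + (SuperFunction.superZeta q y * (SuperFunction.del * SuperFunction.x
          + (SuperFunction.ofConst y - SuperFunction.eps * SuperFunction.del)
            * SuperFunction.theta)) • A.superfield S.j b)
    = ⟨⟨S.E (zetaSeries q) b + (y - 1) • S.J (zetaSeries q) b, S.Q (xSeries * zetaSeries q) b⟩,
        ⟨(1 - y)⁻¹ • S.H (wpSeries q) b - S.H (zetaSeries q) b,
        -(1 - y)⁻¹ • S.E (zetaSeries q * wpSeries q) b - S.J (zetaSeries q) b
          + (1 - y)⁻¹ • S.J (wpSeries q) b + S.J (zetaSeries q * wpSeries q) b⟩⟩ := by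
  rw [SuperFunction.superZeta, SuperFunction.ofConst, SuperFunction.ofConst]
  generalize hc : (HahnSeries.C (1 - y)⁻¹ : HahnSeries ℤ ℂ) = c
  generalize hd : (HahnSeries.C y : HahnSeries ℤ ℂ) = d
  -- In the form `y / (1 - y) = 1 / (1 - y) - 1` this splits the coefficient of `J` in the
  -- `εδ`-component.
  have hcd : c * (1 - d) = 1 := by
    rw [← hc, ← hd, ← map_one HahnSeries.C, ← map_sub, ← map_mul,
      inv_mul_cancel₀ (sub_ne_zero.2 hy1.symm)]
  have hd1 : HahnSeries.C (y - 1) = d - 1 := by rw [map_sub, hd, map_one]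
  ext <;> simp [superResidue, OddExt.map, SuperFunction.x,
    SuperFunction.theta, SuperFunction.ofSeries, SuperFunction.eps,
    SuperFunction.del, SUSYVertexAlgebra.superfield, edConst, delVar, epsVar, OddExt.const,
    OddExt.var, sub_eq_add_neg, OddExt.par_c₀, OddExt.par_c₁, OddExt.smul_c₀, OddExt.smul_c₁,
    HahnSeries.superring_par]
  · rw [show zetaSeries q * d = zetaSeries q + (d - 1) * zetaSeries q by ring,
      S.residue_D_h_add_add, ← hd1, StronglyConformal.J, smear_C_mul, sub_eq_add_neg]
    rfl
  · rw [residue_smul, StronglyConformal.Q, neg_smear, ← smear_neg]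
    congr 2
    ring
  · rw [mul_assoc, div_mul_cancel₀ _ xSeries_ne_zero, residue_smul, smear_add, ← hc, smear_C_mul,
      show zetaSeries q * -1 = -zetaSeries q by ring, smear_neg, sub_eq_add_neg]
    rfl
  · rw [mul_assoc c (wpSeries q / xSeries), div_mul_cancel₀ _ xSeries_ne_zero]
    rw [show zetaSeries q * -(c * -1 * -1 * wpSeries q) = -(c *
        (zetaSeries q * wpSeries q)) by ring,
      show c * wpSeries q + (-(c * (zetaSeries q * wpSeries q)) * d + zetaSeries q * -(-1 * -1))
        = -(c * (zetaSeries q * wpSeries q)) + (c * wpSeries q + -zetaSeries q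
          + zetaSeries q * wpSeries q) by
        linear_combination (zetaSeries q * wpSeries q) * hcd,
      S.residue_D_h_add_add, S.E_neg, ← hc, S.E_C_mul, StronglyConformal.J, smear_add, smear_add,
      smear_C_mul, smear_neg, sub_eq_add_neg]
    simp only [LinearMap.add_apply, LinearMap.neg_apply, LinearMap.smul_apply, StronglyConformal.J]
    abel

end SuperResidue

/-! ### The differential equations. -/

section Main

variable {V M : Type*} [AddCommGroup V] [Module ℂ V] [Superspace V]
  [AddCommGroup M] [Module ℂ M] [Superspace M] {A : SUSYVertexAlgebra V} {X : SUSYModule A M}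
  {S : StronglyConformal A}

namespace SUSYModule.IsPositiveEnergy

variable (hX : X.IsPositiveEnergy S) {U : Set (ℂ × ℂ)} (hUo : IsOpen U)
  (hU : ∀ p ∈ U, 0 < ‖p.1‖ ∧ ‖p.1‖ < 1 ∧ p.2 ≠ 0)

/-- The minus sign comes from `δ ε = -ε δ`, when `δ` meets the `ε`-component of a block. -/
theorem blockExt_mk (q y : ℂ) (a b c d : V) : hX.blockExt q y ⟨⟨a, b⟩, ⟨c, d⟩⟩ =
    ⟨⟨(hX.block q y a).c₀.c₀, (hX.block q y a).c₀.c₁ + (hX.block q y b).c₀.c₀⟩,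
      ⟨(hX.block q y a).c₁.c₀ + (hX.block q y c).c₀.c₀,
        (hX.block q y a).c₁.c₁ - (hX.block q y b).c₁.c₀ + (hX.block q y c).c₀.c₁
          + (hX.block q y d).c₀.c₀⟩⟩ := by
  have hpar : ∀ z : ℂ, Superring.par z = z := fun _ => rfl
  ext <;> simp [blockExt, delVar, epsVar, OddExt.const, OddExt.var, OddExt.par_c₀, OddExt.par_c₁,
    hpar]
  ring

include hUo hU

theorem evenBlock_equations (hs : ∀ p ∈ U, hX.EvenBlockConverges p.1 p.2) {q y : ℂ}
    (hqy : (q, y) ∈ U) (b : V) : ∃ φq φy : ℂ,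
      HasDerivAt (fun z => hX.evenBlock z y b) φq q ∧
      HasDerivAt (fun z => hX.evenBlock q z b) φy y ∧
      q * φq = hX.evenBlock q y (residue ((xSeries * zetaSeries q) • S.virasoro b)) ∧
      y * φy = hX.evenBlock q y (residue (zetaSeries q • A.Y S.j b)) := by
  obtain ⟨h0, h1, hy⟩ := hU _ hqy
  have hq0 : q ≠ 0 := norm_pos_iff.1 h0
  have hs' : ∀ p ∈ U, hX.TermConverges p.1 p.2 := fun p hp => (hs p hp).termConverges
  simp only [hX.evenBlock_eq_trace, residue_smul]
  refine ⟨_, _, hX.hasDerivAt_trace_energy hUo hU hs' hqy b,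
    hX.hasDerivAt_trace_charge hUo hU hs' hqy b, ?_, ?_⟩
  · rw [mul_inv_cancel_left₀ hq0]
    rfl
  · rw [mul_inv_cancel_left₀ hy]
    rfl

/-- By `block_eq` the block is built from `ψ` at `b`, `(Q₋₁ + Q₀) b`, `H₀ b`, `H₀ (Q₋₁ + Q₀) b` and
`E[ζ̄] b`. Differentiation applies `E[ζ̄]` or `J[ζ̄]` last, whereas the blocks of residues have
these operators applied first. The difference consists of commutators, which supply the residues
with `H` and `Q`. The Euler operator in `ε, δ` compensates for the derivatives of the powers of `(1
- y)⁻¹`, up to a multiple of `ψ(E[ζ̄] b)` in the `εδ`-component. -/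
theorem block_equations (hs : ∀ p ∈ U, hX.BlockConverges p.1 p.2) {q y : ℂ}
    (hqy : (q, y) ∈ U) (hy1 : y ≠ 1) (b : V) : ∃ φq φy : Grassmann,
      Grassmann.HasDeriv (fun z => hX.block z y b) φq q ∧
      Grassmann.HasDeriv (fun z => hX.block q z b) φy y ∧
      edConst q * φq
        = hX.blockExt q y (superResidue
            ((SuperFunction.superZeta q y * SuperFunction.x) • A.superfield S.h b
              + (SuperFunction.superZeta q y * SuperFunction.theta) • A.superfield S.j b)) ∧
      (1 + epsVar ℂ * delVar ℂ) * (edConst q * φq)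
          + (edConst (y - 1) - epsVar ℂ * delVar ℂ) * (edConst y * φy)
          + edConst y * (epsVar ℂ * Grassmann.dEps (hX.block q y b)
            + delVar ℂ * Grassmann.dDel (hX.block q y b))
        = hX.blockExt q y (superResidue
            ((SuperFunction.superZeta q y * (SuperFunction.x
              + SuperFunction.eps * SuperFunction.theta)) • A.superfield S.h b
              + (SuperFunction.superZeta q y * (SuperFunction.del * SuperFunction.x
                + (SuperFunction.ofConst y - SuperFunction.eps * SuperFunction.del)
                  * SuperFunction.theta)) • A.superfield S.j b)) := by
  obtain ⟨h0, h1, hy⟩ := hU _ hqy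
  have hq0 : q ≠ 0 := norm_pos_iff.1 h0
  have h1y : 1 - y ≠ 0 := sub_ne_zero.2 hy1.symm
  have hs' : ∀ p ∈ U, hX.TermConverges p.1 p.2 := fun p hp => (hs p hp).termConverges
  have evq : ∀ᶠ z in nhds q, (z, y) ∈ U :=
    (hUo.preimage (f := fun z => (z, y)) (by fun_prop)).mem_nhds hqy
  have evy : ∀ᶠ z in nhds y, (q, z) ∈ U ∧ z ≠ 1 :=
    Filter.Eventually.and ((hUo.preimage (f := fun z => (q, z)) (by fun_prop)).mem_nhds hqy)
      (isOpen_ne.mem_nhds hy1)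
  have hblock : ∀ q y : ℂ, (q, y) ∈ U → y ≠ 1 → ∀ b, hX.block q y b =
    ⟨⟨hX.trace q y b, -(1 - y)⁻¹ * hX.trace q y (S.Q' b)⟩,
      ⟨-(1 - y)⁻¹ * hX.trace q y (S.ops.H 0 b),
        -(1 - y)⁻¹ ^ 2 * hX.trace q y (S.ops.H 0 (S.Q' b))
          + (1 - y)⁻¹ * hX.trace q y (S.E (zetaSeries q) b)⟩⟩ := fun q y hqy hy1 b =>
    block_eq (hs _ hqy) (hU _ hqy).2.2 (norm_pos_iff.1 (hU _ hqy).1) (hU _ hqy).2.1 hy1 b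
  have dq : ∀ b, HasDerivAt (fun z => hX.trace z y b)
      (q⁻¹ * hX.trace q y (S.E (zetaSeries q) b)) q :=
    hX.hasDerivAt_trace_energy' hUo hU hs' hqy
  have dy : ∀ b, HasDerivAt (fun z => hX.trace q z b)
      (y⁻¹ * hX.trace q y (S.J (zetaSeries q) b)) y :=
    hX.hasDerivAt_trace_charge hUo hU hs' hqy
  have dqE := hX.hasDerivAt_trace_E hUo hU hs' hqy b
  have ds : HasDerivAt (fun z : ℂ => (1 - z)⁻¹) ((1 - y)⁻¹ ^ 2) y := by
    refine (((hasDerivAt_id y).const_sub 1).inv h1y).congr_deriv ?_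
    simp
  obtain ⟨s, hsdef⟩ : ∃ s : ℂ, s = (1 - y)⁻¹ := ⟨_, rfl⟩
  rw [← hsdef] at ds
  have hsy : s * (1 - y) = 1 := by rw [hsdef, inv_mul_cancel₀ h1y]
  let ψ : V →ₗ[ℂ] ℂ := (hs' _ hqy).ψ
  have hψ : ∀ b, hX.trace q y b = ψ b := fun b => rfl
  have hblockψ : ∀ b, hX.block q y b = ⟨⟨ψ b, -s * ψ (S.Q' b)⟩, ⟨-s * ψ (S.ops.H 0 b),
      -s ^ 2 * ψ (S.ops.H 0 (S.Q' b)) + s * ψ (S.E (zetaSeries q) b)⟩⟩ := fun b => by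
    rw [hblock q y hqy hy1, hsdef]
    rfl
  have hEE : hX.trace q y (S.E (zetaQDeriv q) b) = -ψ (S.E (zetaSeries q * wpSeries q) b) := by
    rw [ψ_E_zetaSeries_mul_wpSeries (hs' _ hqy) hq0 h1, neg_neg]
    rfl
  have hJJ : hX.trace q y (S.J (zetaQDeriv q) b) = -ψ (S.J (zetaSeries q * wpSeries q) b) := by
    rw [ψ_J_zetaSeries_mul_wpSeries (hs' _ hqy) hq0 h1, neg_neg]
    rfl
  have hJE : ψ (S.J (zetaSeries q) (S.E (zetaSeries q) b)) =
      ψ (S.E (zetaSeries q) (S.J (zetaSeries q) b)) + hX.trace q y (S.J (zetaQDeriv q) b) :=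
    hX.trace_J_E hUo hU hs' hqy b
  rw [hJJ] at hJE
  have hJw : ψ (S.J (wpSeries q) b) = 0 := ψ_J_wpSeries (hs' _ hqy) hq0 h1 b
  have hEw : ψ (S.E (wpSeries q) b) = 0 := ψ_E_wpSeries (hs' _ hqy) hq0 h1 b
  -- commutation relations on `V`
  have cEQ : ∀ b, S.E (zetaSeries q) (S.Q' b) = S.Q' (S.E (zetaSeries q) b) :=
    LinearMap.ext_iff.1 (S.E_Q' (zetaSeries q))
  have cEH : ∀ b, ψ (S.E (zetaSeries q) (S.ops.H 0 b)) = ψ (S.ops.H 0 (S.E (zetaSeries q) b))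
      - ψ (S.H (wpSeries q) b) := fun b => by
    have h := LinearMap.ext_iff.1 (S.E_H₀ (zetaSeries q)) b
    rw [laurentD_zetaSeries hq0 h1, StronglyConformal.H, smear_neg] at h
    have h2 := congrArg ψ h
    simp only [LinearMap.sub_apply, LinearMap.neg_apply, Module.End.mul_apply, map_sub,
        map_neg] at h2
    exact eq_add_of_sub_eq' h2 |>.trans (sub_eq_add_neg _ _).symm
  have cJQ : ∀ b, S.J (zetaSeries q) (S.Q' b) = S.Q' (S.J (zetaSeries q) b)
      + S.Q (xSeries * zetaSeries q) b := fun b => by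
    have h := LinearMap.ext_iff.1 (S.J_Q' (zetaSeries q)) b
    rw [← h]
    simp
  have cJH : ∀ b, ψ (S.J (zetaSeries q) (S.ops.H 0 b)) = ψ (S.ops.H 0 (S.J (zetaSeries q) b))
      - ψ (S.H (zetaSeries q) b) := fun b => by
    have h2 := congrArg ψ (LinearMap.ext_iff.1 (S.J_H₀ (zetaSeries q)) b)
    simp only [LinearMap.sub_apply, LinearMap.neg_apply, Module.End.mul_apply, map_sub,
        map_neg] at h2
    linear_combination h2
  have cHQ : ∀ g, ψ (S.H g (S.Q' b)) + ψ (S.Q' (S.H g b)) = ψ (S.E g b) := fun g => by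
    rw [← map_add]
    exact congrArg ψ (LinearMap.ext_iff.1 (S.H_Q' g) b)
  -- Together these handle `H[℘̄]` in the `εδ`-component: under `ψ` it anticommutes with `Q₋₁ + Q₀`,
  -- because `ψ` vanishes on `E[℘̄]`.
  have e2 := cEH (S.Q' b)
  rw [cEQ] at e2
  have e3 := cHQ (wpSeries q)
  rw [hEw] at e3
  obtain ⟨φq, hφq⟩ : ∃ φ : Grassmann, φ =
    ⟨⟨q⁻¹ * ψ (S.E (zetaSeries q) b), -s * (q⁻¹ * ψ (S.E (zetaSeries q) (S.Q' b)))⟩,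
      ⟨-s * (q⁻¹ * ψ (S.E (zetaSeries q) (S.ops.H 0 b))),
      -s ^ 2 * (q⁻¹ * ψ (S.E (zetaSeries q) (S.ops.H 0 (S.Q' b))))
        + s * (q⁻¹ * (ψ (S.E (zetaSeries q) (S.E (zetaSeries q) b))
        + hX.trace q y (S.E (zetaQDeriv q) b)))⟩⟩ := ⟨_, rfl⟩
  obtain ⟨φy, hφy⟩ : ∃ φ : Grassmann, φ =
    ⟨⟨y⁻¹ * ψ (S.J (zetaSeries q) b), -s ^ 2 * ψ (S.Q' b) + -s * (y⁻¹ *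
      ψ (S.J (zetaSeries q) (S.Q' b)))⟩,
      ⟨-s ^ 2 * ψ (S.ops.H 0 b) + -s * (y⁻¹ * ψ (S.J (zetaSeries q) (S.ops.H 0 b))),
      -(2 * s * s ^ 2) * ψ (S.ops.H 0 (S.Q' b)) + -s ^ 2 *
        (y⁻¹ * ψ (S.J (zetaSeries q) (S.ops.H 0 (S.Q' b))))
        + (s ^ 2 * ψ (S.E (zetaSeries q) b) + s *
          (y⁻¹ * ψ (S.J (zetaSeries q) (S.E (zetaSeries q) b))))⟩⟩ := ⟨_, rfl⟩
  have hqφ : edConst q * φq = ⟨⟨ψ (S.E (zetaSeries q) b), -s * ψ (S.E (zetaSeries q) (S.Q' b))⟩,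
      ⟨-s * ψ (S.E (zetaSeries q) (S.ops.H 0 b)),
      -s ^ 2 * ψ (S.E (zetaSeries q) (S.ops.H 0 (S.Q' b))) + s * (ψ (S.E (zetaSeries q)
        (S.E (zetaSeries q) b)) + hX.trace q y (S.E (zetaQDeriv q) b))⟩⟩ := by
    rw [hφq]
    ext <;> simp [edConst, OddExt.const, Superring.par] <;> field_simp
  have hyφ : edConst y * φy = ⟨⟨ψ (S.J (zetaSeries q) b),
      -s ^ 2 * y * ψ (S.Q' b) - s * ψ (S.J (zetaSeries q) (S.Q' b))⟩,
      ⟨-s ^ 2 * y * ψ (S.ops.H 0 b) - s * ψ (S.J (zetaSeries q) (S.ops.H 0 b)),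
      -2 * s ^ 3 * y * ψ (S.ops.H 0 (S.Q' b)) - s ^ 2 * ψ (S.J (zetaSeries q) (S.ops.H 0 (S.Q' b)))
        + s ^ 2 * y * ψ (S.E (zetaSeries q) b)
        + s * ψ (S.J (zetaSeries q) (S.E (zetaSeries q) b))⟩⟩ := by
    rw [hφy]
    ext <;> simp [edConst, OddExt.const, Superring.par] <;> field_simp <;> ring
  refine ⟨φq, φy, ?_, ?_, ?_, ?_⟩
  · have ev : ∀ᶠ z in nhds q, hX.block z y b = _ := evq.mono fun z hz => hblock z y hz hy1 b
    rw [hφq]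
    refine ⟨?_, ?_, ?_, ?_⟩
    · exact (dq b).congr_of_eventuallyEq (ev.mono fun z hz => by simp only [hz])
    · exact ((dq (S.Q' b)).const_mul (-s)).congr_of_eventuallyEq
        (ev.mono fun z hz => by simp only [hz, hsdef])
    · exact ((dq (S.ops.H 0 b)).const_mul (-s)).congr_of_eventuallyEq
        (ev.mono fun z hz => by simp only [hz, hsdef])
    · exact (((dq (S.ops.H 0 (S.Q' b))).const_mul (-s ^ 2)).add
        (dqE.const_mul s)).congr_of_eventuallyEq
        (ev.mono fun z hz => by simp only [hz, hsdef]; rfl)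
  · have ev : ∀ᶠ z in nhds y, hX.block q z b = _ := evy.mono fun z hz => hblock q z hz.1 hz.2 b
    rw [hφy]
    refine ⟨?_, ?_, ?_, ?_⟩
    · exact (dy b).congr_of_eventuallyEq (ev.mono fun z hz => by simp only [hz])
    · refine ((ds.neg.mul (dy (S.Q' b))).congr_of_eventuallyEq
        (ev.mono fun z hz => by simp only [hz]; rfl)).congr_deriv ?_
      simp [hψ, hsdef]
    · refine ((ds.neg.mul (dy (S.ops.H 0 b))).congr_of_eventuallyEq
        (ev.mono fun z hz => by simp only [hz]; rfl)).congr_deriv ?_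
      simp [hψ, hsdef]
    · have h := ((ds.pow 2).neg.mul (dy (S.ops.H 0 (S.Q' b)))).add
        (ds.mul (dy (S.E (zetaSeries q) b)))
      refine (h.congr_of_eventuallyEq (ev.mono fun z hz => by simp only [hz]; rfl)).congr_deriv ?_
      simp [hψ, hsdef]
  · rw [superResidue_superZeta_one, blockExt_mk, hqφ]
    simp only [hblockψ, ← hsdef]
    ext
    · rfl
    · simp [cEQ]
    · simp only [map_smul, smul_eq_mul]
      linear_combination -s * cEH b
    · simp only [map_smul, smul_eq_mul, map_zero]
      linear_combination -s ^ 2 * e2 + s ^ 2 * e3 + s * hEE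
  · rw [superResidue_superZeta_two _ _ hy1, blockExt_mk, hqφ, hyφ]
    simp only [hblockψ, ← hsdef]
    have hpar : ∀ z : ℂ, Superring.par z = z := fun _ => rfl
    ext
    all_goals simp [edConst, OddExt.const, OddExt.var, epsVar, delVar, Grassmann.dEps,
      Grassmann.dDel, OddExt.par_c₀, OddExt.par_c₁, hpar, sub_eq_add_neg]
    · rw [cEQ, cJQ, map_add]
      linear_combination (s * y * ψ (S.Q' b) + ψ (S.Q (xSeries * zetaSeries q) b)) * hsy
    · linear_combination -s * cEH b - s * (y - 1) * cJH b
        + (s * y * ψ (S.ops.H 0 b) - ψ (S.H (zetaSeries q) b)) * hsy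
    -- This component uses the agreement of mixed derivatives in `hJE` and the anticommutator of
    -- `H[ζ̄]` with `Q₋₁ + Q₀`; the multiples of `hsy` clear the denominators `1 - y`.
    · have e4 := cJH (S.Q' b)
      rw [cJQ, map_add, map_add] at e4
      have e5 := cHQ (zetaSeries q)
      linear_combination -s ^ 2 * e2 + s ^ 2 * e3 + s * hEE + (y - 1) * s * hJE
        - (y - 1) * s ^ 2 * e4
        - s * e5 - s * hJw
        + (-(1 + s * y) * ψ (S.E (zetaSeries q) b) - s * ψ (S.H (zetaSeries q) (S.Q' b))
          + ψ (S.J (zetaSeries q * wpSeries q) b)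
          + s * ψ (S.ops.H 0 (S.Q (xSeries * zetaSeries q) b))
          + 2 * s ^ 2 * y * ψ (S.ops.H 0 (S.Q' b))) * hsy

end SUSYModule.IsPositiveEnergy

end Main

theorem mainTheorem3 {V M : Type*} [AddCommGroup V] [Module ℂ V] [Superspace V]
    [AddCommGroup M] [Module ℂ M] [Superspace M]
    (A : SUSYVertexAlgebra V) (S : StronglyConformal A)
    (X : SUSYModule A M) (hX : X.IsPositiveEnergy S)
    (U : Set (ℂ × ℂ)) (hUo : IsOpen U) (hU : ∀ p ∈ U, 0 < ‖p.1‖ ∧ ‖p.1‖ < 1 ∧ p.2 ≠ 0) :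
    -- the full family, with parameters `(q, y, ε, δ)` and `y ≠ 1`
    ((∀ p ∈ U, hX.BlockConverges p.1 p.2) →
      ∀ q y : ℂ, (q, y) ∈ U → y ≠ 1 → ∀ b : V, ∃ φq φy : Grassmann,
        Grassmann.HasDeriv (fun z => hX.block z y b) φq q ∧
        Grassmann.HasDeriv (fun z => hX.block q z b) φy y ∧
        edConst q * φq
          = hX.blockExt q y (superResidue
              ((SuperFunction.superZeta q y * SuperFunction.x) • A.superfield S.h b
                + (SuperFunction.superZeta q y * SuperFunction.theta) • A.superfield S.j b)) ∧
        (1 + epsVar ℂ * delVar ℂ) * (edConst q * φq)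
            + (edConst (y - 1) - epsVar ℂ * delVar ℂ) * (edConst y * φy)
            + edConst y * (epsVar ℂ * Grassmann.dEps (hX.block q y b)
              + delVar ℂ * Grassmann.dDel (hX.block q y b))
          = hX.blockExt q y (superResidue
              ((SuperFunction.superZeta q y * (SuperFunction.x + SuperFunction.eps * SuperFunction.theta)) • A.superfield S.h b
                + (SuperFunction.superZeta q y * (SuperFunction.del * SuperFunction.x
                  + (SuperFunction.ofConst y - SuperFunction.eps * SuperFunction.del)
                    * SuperFunction.theta)) •
                  A.superfield S.j b))) ∧
    -- the even family `ε = δ = 0`, with parameters `(q, y)`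
    ((∀ p ∈ U, hX.EvenBlockConverges p.1 p.2) →
      ∀ q y : ℂ, (q, y) ∈ U → ∀ b : V, ∃ φq φy : ℂ,
        HasDerivAt (fun z => hX.evenBlock z y b) φq q ∧
        HasDerivAt (fun z => hX.evenBlock q z b) φy y ∧
        q * φq = hX.evenBlock q y (residue ((xSeries * zetaSeries q) • S.virasoro b)) ∧
        y * φy = hX.evenBlock q y (residue (zetaSeries q • A.Y S.j b))) :=
  ⟨fun hs _ _ hqy hy1 b => hX.block_equations hUo hU hs hqy hy1 b,
    fun hs _ _ hqy b => hX.evenBlock_equations hUo hU hs hqy b⟩
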